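/- For integers $1 \le n \le N$ let $W(n) = \sigma_{n-1}\sigma_{n-2}\cdots\sigma_1$, regarded as a braid of index $N$ (a braid on $N$ strands with the standard generators $\sigma_1,\dots,\sigma_{N-1}$, each $\sigma_i$ being a positive crossing of the $i$-th and $(i+1)$-st strands; $W(1)$ is the trivial braid). Let $a_1, a_2, b_1, b_2$ be positive integers with $a_1 < a_2$ and $b_1 < b_2$. Then the closures of the braids \[ W(b_2)^{a_1}\, W(b_1)^{a_2-a_1}\ \text{ of index } b_2 \qquad\text{and}\qquad W(a_2)^{b_1}\, W(a_1)^{b_2-b_1}\ \text{ of index } a_2 \] are the same link, that is, with the orientations induced by the direction of the braid strands they are isotopic oriented links in three-space. (This extends the symmetry $T(a,b)=T(b,a)$ of torus links.) -/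

import Mathlib

/-! ### Oriented polygonal links in three-space -/

/-- Three-space, with coordinates `(x, y, z)`. -/
abbrev Space : Type := ℝ × ℝ × ℝ

/-- A directed straight edge, given by its initial and its terminal point. -/
abbrev DirEdge : Type := Space × Space

/-- The closed straight segment underlying a directed edge. -/
def DirEdge.seg (e : DirEdge) : Set Space := segment ℝ e.1 e.2

/-- An oriented polygonal link: a finite set of nondegenerate directed edges, such that every
vertex is the initial point of exactly one edge and the terminal point of exactly one edge, and
two different edges meet at most in common end points. Hence the union of the edges is a finite
disjoint union of oriented simple closed polygons. -/
@[ext]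
structure PolyLink where
  edges : Set DirEdge
  finite : edges.Finite
  nondegenerate : ∀ e ∈ edges, e.1 ≠ e.2
  initial_inj : Set.InjOn Prod.fst edges
  terminal_inj : Set.InjOn Prod.snd edges
  closed : Prod.fst '' edges = Prod.snd '' edges
  embedded : ∀ e ∈ edges, ∀ f ∈ edges, e ≠ f →
    e.seg ∩ f.seg ⊆ {e.1, e.2} ∩ {f.1, f.2}

/-- The underlying point set of a link. -/
def PolyLink.carrier (L : PolyLink) : Set Space := ⋃ e ∈ L.edges, DirEdge.seg e

/-- The elementary (Delta-) move: an edge `A → B` of the link is replaced by `A → C → B`, where the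
triangle `ABC` meets the link in the segment `AB` only. The triangle is either a true triangle, or
`C` lies in the interior of the segment `AB`; in the second case the edge is subdivided. -/
def DeltaMove (L L' : PolyLink) : Prop :=
  ∃ A B C : Space, (A, B) ∈ L.edges ∧
    (AffineIndependent ℝ ![A, B, C] ∨ C ∈ openSegment ℝ A B) ∧
    convexHull ℝ {A, B, C} ∩ L.carrier = segment ℝ A B ∧
    L'.edges = (L.edges \ {(A, B)}) ∪ {(A, C), (C, B)}

/-- Two oriented polygonal links are the same link (are isotopic) when they are related by a finite
sequence of elementary moves and inverses of elementary moves. -/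
def SameLink (L L' : PolyLink) : Prop := Relation.EqvGen DeltaMove L L'

/-! ### Braid words and their closures -/

/-- A letter `σ_i` (`positive = true`) or `σ_i⁻¹` (`positive = false`) of a braid word on `N`
strands, where `1 ≤ i < N`. -/
structure BraidLetter (N : ℕ) where
  idx : ℕ
  one_le : 1 ≤ idx
  lt : idx < N
  positive : Bool

/-- Braid words of index `N` (words on `N` strands); the product is concatenation. -/
abbrev BraidWord (N : ℕ) : Type := FreeMonoid (BraidLetter N)

/-- The word `W(n) = σ_{n-1} σ_{n-2} ⋯ σ_1` as a braid word of index `N ≥ n`. -/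
def braidW {N n : ℕ} (h : n ≤ N) : BraidWord N :=
  FreeMonoid.ofList <| (List.finRange (n - 1)).reverse.map fun i : Fin (n - 1) =>
    { idx := (i : ℕ) + 1
      one_le := Nat.le_add_left 1 i
      lt := by have := i.isLt; omega
      positive := true }

namespace BraidLetter

variable {N : ℕ}

/-- The height at which the strand that starts at place `i` passes the crossing `σ_i^{±1}`. -/
noncomputable def height (l : BraidLetter N) : ℝ := if l.positive then 1 / 2 else -1 / 2

/-- The middle point of the strand that goes from place `i` to place `i + 1` in the crossing. -/
noncomputable def mid (l : BraidLetter N) (k : ℕ) : Space :=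
  ((l.idx : ℝ) + 1 / 2, (k : ℝ) + 1 / 2, l.height)

/-- The part of the geometric braid between `y = k` and `y = k + 1` which realises the letter
`σ_i^{±1}`. The strands are at the places `x = 1, …, N` and run upwards (in the direction of
increasing `y`). The strand from place `i` to place `i + 1` passes in front of (above, in the
direction of `z`) the strand from `i + 1` to `i` if the letter is `σ_i`, a positive crossing, and
behind it if the letter is `σ_i⁻¹`; all other strands go straight up. -/
def levelEdges (l : BraidLetter N) (k : ℕ) : Set DirEdge :=
  {(((l.idx : ℝ), (k : ℝ), 0), l.mid k),
   (l.mid k, ((l.idx : ℝ) + 1, (k : ℝ) + 1, 0)),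
   (((l.idx : ℝ) + 1, (k : ℝ), 0), ((l.idx : ℝ), (k : ℝ) + 1, 0))} ∪
  {e | ∃ j : ℕ, 1 ≤ j ∧ j ≤ N ∧ j ≠ l.idx ∧ j ≠ l.idx + 1 ∧
    e = (((j : ℝ), (k : ℝ), 0), ((j : ℝ), (k : ℝ) + 1, 0))}

end BraidLetter

/-- The closing strands of a braid on `N` strands with `m` letters: the end point at place `j` of
the top `y = m` is joined to the starting point at place `j` of the bottom `y = 0` by an arc in the
plane `x = j` which runs behind the braid. Thus the braid is wrapped around a cylinder whose axis is
parallel to the `x`-axis. -/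
def closingEdges (N m : ℕ) : Set DirEdge :=
  {e | ∃ j : ℕ, 1 ≤ j ∧ j ≤ N ∧
    (e = (((j : ℝ), (m : ℝ), 0), ((j : ℝ), (m : ℝ) + 1, -1)) ∨
     e = (((j : ℝ), (m : ℝ) + 1, -1), ((j : ℝ), -1, -1)) ∨
     e = (((j : ℝ), -1, -1), ((j : ℝ), 0, 0)))}

/-- The directed edges of the closure of a braid word. -/
def closureEdges {N : ℕ} (w : BraidWord N) : Set DirEdge :=
  {e | ∃ (k : ℕ) (l : BraidLetter N), w.toList[k]? = some l ∧ e ∈ l.levelEdges k} ∪ closingEdges N w.toList.length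

theorem mem_seg_iff {A B p : Space} : p ∈ DirEdge.seg (A, B) ↔ ∃ s : ℝ, 0 ≤ s ∧ s ≤ 1 ∧
    p.1 = A.1 + s * (B.1 - A.1) ∧ p.2.1 = A.2.1 + s * (B.2.1 - A.2.1) ∧
    p.2.2 = A.2.2 + s * (B.2.2 - A.2.2) := by
  unfold DirEdge.seg
  rw [segment_eq_image']
  constructor
  · rintro ⟨s, ⟨h0, h1⟩, rfl⟩
    exact ⟨s, h0, h1, by simp, by simp, by simp⟩
  · rintro ⟨s, h0, h1, hx, hy, hz⟩
    refine ⟨s, ⟨h0, h1⟩, ?_⟩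
    ext <;> simp [hx, hy, hz]

theorem level_bounds {N : ℕ} (l : BraidLetter N) (k : ℕ) {e : DirEdge} (he : e ∈ l.levelEdges k)
    {p : Space} (hp : p ∈ e.seg) : (k : ℝ) ≤ p.2.1 ∧ p.2.1 ≤ k + 1 ∧ -1 / 2 ≤ p.2.2 ∧
      (p.2.1 = k → p = e.1) ∧ (p.2.1 = k + 1 → p = e.2) := by
  have hh : l.height = 1 / 2 ∨ l.height = -1 / 2 := by
    unfold BraidLetter.height; split_ifs <;> simp
  rcases he with (rfl | rfl | rfl) | ⟨j, -, -, -, -, rfl⟩ <;>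
  · obtain ⟨s, h0, h1, hx, hy, hz⟩ := mem_seg_iff.1 hp
    simp only [BraidLetter.mid] at *
    refine ⟨by linarith, by linarith, by rcases hh with h | h <;> (try simp only [h] at hz) <;> linarith,
      fun h => ?_, fun h => ?_⟩
    · first
      | (exfalso; linarith)
      | (have hs : s = 0 := by linarith
         subst hs
         ext <;> simp_all)
    · first
      | (exfalso; linarith)
      | (have hs : s = 1 := by linarith
         subst hs
         ext <;> simp_all <;> ring)

theorem level_level {N : ℕ} (l : BraidLetter N) (k : ℕ) {e f : DirEdge}
    (he : e ∈ l.levelEdges k) (hf : f ∈ l.levelEdges k) (hne : e ≠ f) {p : Space}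
    (hp : p ∈ e.seg) (hq : p ∈ f.seg) : p = e.1 ∨ p = e.2 := by
  have hh : l.height = 1 / 2 ∨ l.height = -1 / 2 := by
    unfold BraidLetter.height; split_ifs <;> simp
  have key : ∀ a b : ℕ, a ≠ b → (a : ℝ) + 1 ≤ b ∨ (b : ℝ) + 1 ≤ a := by
    intro a b hab
    rcases lt_or_gt_of_ne hab with h | h
    · left; exact_mod_cast h
    · right; exact_mod_cast h
  have key2 : ∀ j : ℕ, j ≠ l.idx → j ≠ l.idx + 1 →
      (j : ℝ) + 1 ≤ l.idx ∨ (l.idx : ℝ) + 2 ≤ j := by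
    intro j h1 h2
    rcases lt_or_gt_of_ne h1 with h | h
    · left; exact_mod_cast h
    · right
      have : l.idx + 2 ≤ j := by omega
      exact_mod_cast this
  rcases he with (rfl | rfl | rfl) | ⟨j, -, -, hj1, hj2, rfl⟩ <;>
  rcases hf with (rfl | rfl | rfl) | ⟨j', -, -, hj1', hj2', rfl⟩ <;>
  first
  | exact absurd rfl hne
  | (obtain ⟨s, h0, h1, hx, hy, hz⟩ := mem_seg_iff.1 hp
     obtain ⟨t, g0, g1, gx, gy, gz⟩ := mem_seg_iff.1 hq
     simp only [BraidLetter.mid] at *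
     first
     | (exfalso; rcases key2 j hj1 hj2 with h | h <;> linarith)
     | (exfalso; rcases key2 j' hj1' hj2' with h | h <;> linarith)
     | (exfalso
        have : j ≠ j' := by rintro rfl; exact hne rfl
        rcases key j j' this with h | h <;> linarith)
     | (exfalso; rcases hh with h | h <;> rw [h] at hz gz <;> linarith)
     | (exfalso; rcases hh with h | h <;> rw [h] at hz <;> linarith)
     | (exfalso; rcases hh with h | h <;> rw [h] at gz <;> linarith)
     | (right
        have hs : s = 1 := by linarith
        subst hs
        exact Prod.ext (by dsimp only; linarith) (Prod.ext (by dsimp only; linarith) (by dsimp only; linarith)))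
     | (left
        have hs : s = 0 := by linarith
        subst hs
        exact Prod.ext (by dsimp only; linarith) (Prod.ext (by dsimp only; linarith) (by dsimp only; linarith))))

theorem closing_bounds {N m : ℕ} {e : DirEdge} (he : e ∈ closingEdges N m)
    {p : Space} (hp : p ∈ e.seg) (hz : -1 / 2 ≤ p.2.2) (hy0 : 0 ≤ p.2.1) (hym : p.2.1 ≤ m) :
    (p = e.1 ∧ p.2.1 = m) ∨ (p = e.2 ∧ p.2.1 = 0) := by
  obtain ⟨j, -, -, rfl | rfl | rfl⟩ := he <;>
  · obtain ⟨s, h0, h1, hx, hy, hz'⟩ := mem_seg_iff.1 hp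
    simp only at *
    first
    | (exfalso; linarith)
    | (left
       have hs : s = 0 := by linarith
       subst hs
       refine ⟨?_, by linarith⟩
       exact Prod.ext (by dsimp only; linarith) (Prod.ext (by dsimp only; linarith) (by dsimp only; linarith)))
    | (right
       have hs : s = 1 := by linarith
       subst hs
       refine ⟨?_, by linarith⟩
       exact Prod.ext (by dsimp only; linarith) (Prod.ext (by dsimp only; linarith) (by dsimp only; linarith)))

theorem closing_closing {N m : ℕ} {e f : DirEdge}
    (he : e ∈ closingEdges N m) (hf : f ∈ closingEdges N m) (hne : e ≠ f) {p : Space}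
    (hp : p ∈ e.seg) (hq : p ∈ f.seg) : p = e.1 ∨ p = e.2 := by
  have hm : (0 : ℝ) ≤ m := Nat.cast_nonneg m
  obtain ⟨j, -, -, hj⟩ := he
  obtain ⟨j', -, -, hj'⟩ := hf
  have hx : p.1 = j := by
    rcases hj with rfl | rfl | rfl <;>
    · obtain ⟨s, h0, h1, hx, -, -⟩ := mem_seg_iff.1 hp
      simpa using hx
  have hx' : p.1 = j' := by
    rcases hj' with rfl | rfl | rfl <;>
    · obtain ⟨s, h0, h1, hx, -, -⟩ := mem_seg_iff.1 hq
      simpa using hx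
  obtain rfl : j = j' := by exact_mod_cast hx.symm.trans hx'
  rcases hj with rfl | rfl | rfl <;> rcases hj' with rfl | rfl | rfl <;>
  first
  | exact absurd rfl hne
  | (obtain ⟨s, h0, h1, -, hy, hz⟩ := mem_seg_iff.1 hp
     obtain ⟨t, g0, g1, -, gy, gz⟩ := mem_seg_iff.1 hq
     simp only at *
     first
     | (exfalso; linarith)
     | (right
        have hs : s = 1 := by linarith
        subst hs
        exact Prod.ext (by dsimp only; linarith) (Prod.ext (by dsimp only; linarith) (by dsimp only; linarith)))
     | (left
        have hs : s = 0 := by linarith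
        subst hs
        exact Prod.ext (by dsimp only; linarith) (Prod.ext (by dsimp only; linarith) (by dsimp only; linarith)))
     | (left
        have hs : s * ((m : ℝ) + 2) = 0 := by nlinarith
        have hs : s = 0 := by
          rcases mul_eq_zero.1 hs with h | h
          · exact h
          · exfalso; linarith
        subst hs
        exact Prod.ext (by dsimp only; linarith) (Prod.ext (by dsimp only; linarith) (by dsimp only; linarith)))
     | (right
        have hs : (1 - s) * ((m : ℝ) + 2) = 0 := by nlinarith
        have hs : s = 1 := by
          rcases mul_eq_zero.1 hs with h | h
          · linarith
          · exfalso; linarith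
        subst hs
        exact Prod.ext (by dsimp only; linarith) (Prod.ext (by dsimp only; linarith) (by dsimp only; linarith))))

theorem level_finite {N : ℕ} (l : BraidLetter N) (k : ℕ) : (l.levelEdges k).Finite := by
  refine Set.Finite.union (by simp) (Set.Finite.subset
    ((Set.finite_Iic N).image fun j : ℕ => (((j : ℝ), (k : ℝ), (0 : ℝ)),
      ((j : ℝ), (k : ℝ) + 1, (0 : ℝ)))) ?_)
  rintro e ⟨j, -, hj, -, -, rfl⟩
  exact ⟨j, hj, rfl⟩

theorem closing_finite (N m : ℕ) : (closingEdges N m).Finite := by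
  have h : ∀ g : ℕ → DirEdge, (g '' Set.Iic N).Finite := fun g => (Set.finite_Iic N).image g
  refine (((h fun j => (((j : ℝ), (m : ℝ), 0), ((j : ℝ), (m : ℝ) + 1, -1))).union
    (h fun j => (((j : ℝ), (m : ℝ) + 1, -1), ((j : ℝ), -1, -1)))).union
    (h fun j => (((j : ℝ), -1, -1), ((j : ℝ), 0, 0)))).subset ?_
  rintro e ⟨j, -, hj, rfl | rfl | rfl⟩
  · exact Or.inl (Or.inl ⟨j, hj, rfl⟩)
  · exact Or.inl (Or.inr ⟨j, hj, rfl⟩)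
  · exact Or.inr ⟨j, hj, rfl⟩

theorem closureEdges_finite {N : ℕ} (w : BraidWord N) : (closureEdges w).Finite := by
  refine Set.Finite.union (Set.Finite.subset (Set.Finite.biUnion
    (Set.finite_Iio w.toList.length) (t := fun k => {e | ∃ l, w.toList[k]? = some l ∧
      e ∈ l.levelEdges k}) ?_) ?_) (closing_finite _ _)
  · intro k hk
    refine (level_finite (w.toList[k]'hk) k).subset ?_
    rintro e ⟨l, hl, he⟩
    obtain ⟨h, rfl⟩ := List.getElem?_eq_some_iff.1 hl
    exact he
  · rintro e ⟨k, l, hl, he⟩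
    obtain ⟨h, -⟩ := List.getElem?_eq_some_iff.1 hl
    exact Set.mem_biUnion (x := k) h ⟨l, hl, he⟩

theorem closureEdges_nondegenerate {N : ℕ} (w : BraidWord N) :
    ∀ e ∈ closureEdges w, e.1 ≠ e.2 := by
  rintro e (⟨k, l, -, (rfl | rfl | rfl) | ⟨j, -, -, -, -, rfl⟩⟩ | ⟨j, -, -, rfl | rfl | rfl⟩) h <;>
  · have h2 := congrArg (fun p : Space => p.2.1) h
    have hm : (0 : ℝ) ≤ (w.toList.length : ℝ) := Nat.cast_nonneg _
    simp only [BraidLetter.mid] at h2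
    linarith

theorem closureEdges_embedded {N : ℕ} (w : BraidWord N) {e f : DirEdge}
    (he : e ∈ closureEdges w) (hf : f ∈ closureEdges w) (hne : e ≠ f) {p : Space}
    (hp : p ∈ e.seg) (hq : p ∈ f.seg) : p = e.1 ∨ p = e.2 := by
  have hlt : ∀ {k : ℕ} {l : BraidLetter N}, w.toList[k]? = some l → (k : ℝ) + 1 ≤ w.toList.length := by
    intro k l h
    obtain ⟨h, -⟩ := List.getElem?_eq_some_iff.1 h
    exact_mod_cast h
  rcases he with ⟨k, l, hk, he⟩ | he <;> rcases hf with ⟨k', l', hk', hf⟩ | hf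
  · obtain ⟨a1, a2, -, a3, a4⟩ := level_bounds l k he hp
    obtain ⟨b1, b2, -, -, -⟩ := level_bounds l' k' hf hq
    rcases lt_trichotomy k k' with h | rfl | h
    · have h' : (k : ℝ) + 1 ≤ k' := by exact_mod_cast h
      exact Or.inr (a4 (by linarith))
    · obtain rfl : l = l' := by simpa using hk.symm.trans hk'
      exact level_level l k he hf hne hp hq
    · have h' : (k' : ℝ) + 1 ≤ k := by exact_mod_cast h
      exact Or.inl (a3 (by linarith))
  · obtain ⟨a1, a2, az, a3, a4⟩ := level_bounds l k he hp
    have h0 : (0 : ℝ) ≤ k := Nat.cast_nonneg k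
    have h1 := hlt hk
    rcases closing_bounds hf hq az (by linarith) (by linarith) with ⟨-, h⟩ | ⟨-, h⟩
    · exact Or.inr (a4 (by linarith))
    · exact Or.inl (a3 (by linarith))
  · obtain ⟨a1, a2, az, a3, a4⟩ := level_bounds l' k' hf hq
    have h0 : (0 : ℝ) ≤ k' := Nat.cast_nonneg k'
    have h1 := hlt hk'
    rcases closing_bounds he hp az (by linarith) (by linarith) with ⟨h, -⟩ | ⟨h, -⟩
    · exact Or.inl h
    · exact Or.inr h
  · exact closing_closing he hf hne hp hq

theorem level_initial_inj {N : ℕ} (l : BraidLetter N) (k : ℕ) :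
    Set.InjOn Prod.fst (l.levelEdges k) ∧ Set.InjOn Prod.snd (l.levelEdges k) := by
  constructor <;>
  · intro e he f hf h
    rcases he with (rfl | rfl | rfl) | ⟨j, -, -, hj1, hj2, rfl⟩ <;>
    rcases hf with (rfl | rfl | rfl) | ⟨j', -, -, hj1', hj2', rfl⟩ <;>
    first
    | rfl
    | (exfalso
       have h1 := congrArg (fun p : Space => p.2.1) h
       simp only [BraidLetter.mid] at h1
       linarith)
    | (have h1 := congrArg (fun p : Space => p.1) h
       simp only at h1
       first
       | (exfalso; linarith)
       | (exfalso; norm_cast at h1; omega)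
       | (norm_cast at h1; done)
       | (norm_cast at h1; subst h1; rfl))

theorem closing_inj (N m : ℕ) :
    Set.InjOn Prod.fst (closingEdges N m) ∧ Set.InjOn Prod.snd (closingEdges N m) := by
  have hm : (0 : ℝ) ≤ m := Nat.cast_nonneg m
  constructor <;>
  · rintro e ⟨j, -, -, hj⟩ f ⟨j', -, -, hj'⟩ h
    obtain rfl : j = j' := by
      have h1 := congrArg (fun p : Space => p.1) h
      rcases hj with rfl | rfl | rfl <;> rcases hj' with rfl | rfl | rfl <;>
        (dsimp only at h1; exact_mod_cast h1)
    have h2 := congrArg (fun p : Space => p.2.1) h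
    rcases hj with rfl | rfl | rfl <;> rcases hj' with rfl | rfl | rfl <;>
    first
    | rfl
    | (exfalso; simp only at h2; linarith)

theorem left_mem_seg (e : DirEdge) : e.1 ∈ e.seg := left_mem_segment ℝ _ _

theorem right_mem_seg (e : DirEdge) : e.2 ∈ e.seg := right_mem_segment ℝ _ _

theorem level_heights {N : ℕ} (l : BraidLetter N) (k : ℕ) {e : DirEdge}
    (he : e ∈ l.levelEdges k) : e.1.2.1 < k + 1 ∧ (k : ℝ) < e.2.2.1 := by
  rcases he with (rfl | rfl | rfl) | ⟨j, -, -, -, -, rfl⟩ <;>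
    (simp only [BraidLetter.mid]; constructor <;> linarith)

theorem closureEdges_initial_inj {N : ℕ} (w : BraidWord N) :
    Set.InjOn Prod.fst (closureEdges w) := by
  have hlt : ∀ {k : ℕ} {l : BraidLetter N}, w.toList[k]? = some l → (k : ℝ) + 1 ≤ w.toList.length := by
    intro k l h
    obtain ⟨h, -⟩ := List.getElem?_eq_some_iff.1 h
    exact_mod_cast h
  have mix : ∀ {k : ℕ} {l : BraidLetter N}, w.toList[k]? = some l → ∀ e ∈ l.levelEdges k,
      ∀ f ∈ closingEdges N w.toList.length, e.1 ≠ f.1 := by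
    intro k l hk e he f hf h
    obtain ⟨a1, -, az, -, -⟩ := level_bounds l k he (left_mem_seg e)
    have a2 := (level_heights l k he).1
    have h0 : (0 : ℝ) ≤ k := Nat.cast_nonneg k
    have h1 := hlt hk
    rw [h] at a1 a2 az
    obtain ⟨j, -, -, rfl | rfl | rfl⟩ := hf <;> simp only at a1 a2 az <;> linarith
  rintro e (⟨k, l, hk, he⟩ | he) f (⟨k', l', hk', hf⟩ | hf) h
  · obtain ⟨a1, -, -, -, -⟩ := level_bounds l k he (left_mem_seg e)
    have a2 := (level_heights l k he).1
    obtain ⟨b1, -, -, -, -⟩ := level_bounds l' k' hf (left_mem_seg f)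
    have b2 := (level_heights l' k' hf).1
    rw [h] at a1 a2
    obtain rfl : k = k' := by
      have c1 : (k : ℝ) < k' + 1 := by linarith
      have c2 : (k' : ℝ) < k + 1 := by linarith
      norm_cast at c1 c2
      omega
    obtain rfl : l = l' := by simpa using hk.symm.trans hk'
    exact (level_initial_inj l k).1 he hf h
  · exact absurd h (mix hk e he f hf)
  · exact absurd h.symm (mix hk' f hf e he)
  · exact (closing_inj _ _).1 he hf h

theorem closureEdges_terminal_inj {N : ℕ} (w : BraidWord N) :
    Set.InjOn Prod.snd (closureEdges w) := by
  have hlt : ∀ {k : ℕ} {l : BraidLetter N}, w.toList[k]? = some l → (k : ℝ) + 1 ≤ w.toList.length := by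
    intro k l h
    obtain ⟨h, -⟩ := List.getElem?_eq_some_iff.1 h
    exact_mod_cast h
  have mix : ∀ {k : ℕ} {l : BraidLetter N}, w.toList[k]? = some l → ∀ e ∈ l.levelEdges k,
      ∀ f ∈ closingEdges N w.toList.length, e.2 ≠ f.2 := by
    intro k l hk e he f hf h
    obtain ⟨-, a1, az, -, -⟩ := level_bounds l k he (right_mem_seg e)
    have a2 := (level_heights l k he).2
    have h0 : (0 : ℝ) ≤ k := Nat.cast_nonneg k
    have h1 := hlt hk
    rw [h] at a1 a2 az
    obtain ⟨j, -, -, rfl | rfl | rfl⟩ := hf <;> simp only at a1 a2 az <;> linarith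
  rintro e (⟨k, l, hk, he⟩ | he) f (⟨k', l', hk', hf⟩ | hf) h
  · obtain ⟨-, a1, -, -, -⟩ := level_bounds l k he (right_mem_seg e)
    have a2 := (level_heights l k he).2
    obtain ⟨-, b1, -, -, -⟩ := level_bounds l' k' hf (right_mem_seg f)
    have b2 := (level_heights l' k' hf).2
    rw [h] at a1 a2
    obtain rfl : k = k' := by
      have c1 : (k : ℝ) < k' + 1 := by linarith
      have c2 : (k' : ℝ) < k + 1 := by linarith
      norm_cast at c1 c2
      omega
    obtain rfl : l = l' := by simpa using hk.symm.trans hk'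
    exact (level_initial_inj l k).2 he hf h
  · exact absurd h (mix hk e he f hf)
  · exact absurd h.symm (mix hk' f hf e he)
  · exact (closing_inj _ _).2 he hf h

/-- Every place at the bottom of a level starts an edge of the level, and every place at the top
ends one. -/
theorem level_places {N : ℕ} (l : BraidLetter N) (k j : ℕ) (h1 : 1 ≤ j) (hN : j ≤ N) :
    (∃ e ∈ l.levelEdges k, e.1 = ((j : ℝ), (k : ℝ), 0)) ∧
    (∃ e ∈ l.levelEdges k, e.2 = ((j : ℝ), (k : ℝ) + 1, 0)) := by
  by_cases hj : j = l.idx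
  · subst hj
    exact ⟨⟨_, Or.inl (Or.inl rfl), rfl⟩, ⟨_, Or.inl (Or.inr (Or.inr rfl)), rfl⟩⟩
  by_cases hj' : j = l.idx + 1
  · subst hj'
    exact ⟨⟨_, Or.inl (Or.inr (Or.inr rfl)), by simp⟩, ⟨_, Or.inl (Or.inr (Or.inl rfl)), by simp⟩⟩
  · exact ⟨⟨_, Or.inr ⟨j, h1, hN, hj, hj', rfl⟩, rfl⟩, ⟨_, Or.inr ⟨j, h1, hN, hj, hj', rfl⟩, rfl⟩⟩

theorem level_ends {N : ℕ} (l : BraidLetter N) (k : ℕ) {e : DirEdge} (he : e ∈ l.levelEdges k) :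
    ((∃ j : ℕ, 1 ≤ j ∧ j ≤ N ∧ e.1 = ((j : ℝ), (k : ℝ), 0)) ∨
      ∃ f ∈ l.levelEdges k, f.2 = e.1) ∧
    ((∃ j : ℕ, 1 ≤ j ∧ j ≤ N ∧ e.2 = ((j : ℝ), (k : ℝ) + 1, 0)) ∨
      ∃ f ∈ l.levelEdges k, f.1 = e.2) := by
  have h1 := l.one_le
  have h2 := l.lt
  rcases he with (rfl | rfl | rfl) | ⟨j, hj, hj', -, -, rfl⟩
  · exact ⟨Or.inl ⟨l.idx, h1, h2.le, rfl⟩, Or.inr ⟨_, Or.inl (Or.inr (Or.inl rfl)), rfl⟩⟩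
  · exact ⟨Or.inr ⟨_, Or.inl (Or.inl rfl), rfl⟩, Or.inl ⟨l.idx + 1, by omega, h2, by simp⟩⟩
  · exact ⟨Or.inl ⟨l.idx + 1, by omega, h2, by simp⟩, Or.inl ⟨l.idx, h1, h2.le, rfl⟩⟩
  · exact ⟨Or.inl ⟨j, hj, hj', rfl⟩, Or.inl ⟨j, hj, hj', rfl⟩⟩

/-- At every place and every height `0 ≤ k ≤ m` one edge of the closure starts and one ends. -/
theorem closureEdges_places {N : ℕ} (w : BraidWord N) (k j : ℕ) (h1 : 1 ≤ j) (hN : j ≤ N)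
    (hk : k ≤ w.toList.length) :
    (∃ e ∈ closureEdges w, e.1 = ((j : ℝ), (k : ℝ), 0)) ∧
    (∃ e ∈ closureEdges w, e.2 = ((j : ℝ), (k : ℝ), 0)) := by
  constructor
  · rcases hk.lt_or_eq with h | h
    · obtain ⟨e, he, h'⟩ := (level_places (w.toList[k]) k j h1 hN).1
      exact ⟨e, Or.inl ⟨k, _, List.getElem?_eq_getElem h, he⟩, h'⟩
    · exact ⟨_, Or.inr ⟨j, h1, hN, Or.inl rfl⟩, by simp [h]⟩
  · rcases k with _ | k
    · exact ⟨_, Or.inr ⟨j, h1, hN, Or.inr (Or.inr rfl)⟩, by simp⟩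
    · obtain ⟨e, he, h'⟩ := (level_places (w.toList[k]) k j h1 hN).2
      exact ⟨e, Or.inl ⟨k, _, List.getElem?_eq_getElem hk, he⟩, by simpa using h'⟩

theorem closureEdges_closed {N : ℕ} (w : BraidWord N) :
    Prod.fst '' closureEdges w = Prod.snd '' closureEdges w := by
  apply Set.Subset.antisymm
  · rintro _ ⟨e, ⟨k, l, hk, he⟩ | ⟨j, h1, hN, rfl | rfl | rfl⟩, rfl⟩
    · obtain ⟨h, -⟩ := List.getElem?_eq_some_iff.1 hk
      rcases (level_ends l k he).1 with ⟨j, h1, hN, hj⟩ | ⟨f, hf, hfe⟩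
      · obtain ⟨f, hf, hfe⟩ := (closureEdges_places w k j h1 hN h.le).2
        exact ⟨f, hf, hfe.trans hj.symm⟩
      · exact ⟨f, Or.inl ⟨k, l, hk, hf⟩, hfe⟩
    · exact (closureEdges_places w _ j h1 hN le_rfl).2
    · exact ⟨_, Or.inr ⟨j, h1, hN, Or.inl rfl⟩, rfl⟩
    · exact ⟨_, Or.inr ⟨j, h1, hN, Or.inr (Or.inl rfl)⟩, rfl⟩
  · rintro _ ⟨e, ⟨k, l, hk, he⟩ | ⟨j, h1, hN, rfl | rfl | rfl⟩, rfl⟩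
    · obtain ⟨h, -⟩ := List.getElem?_eq_some_iff.1 hk
      rcases (level_ends l k he).2 with ⟨j, h1, hN, hj⟩ | ⟨f, hf, hfe⟩
      · obtain ⟨f, hf, hfe⟩ := (closureEdges_places w (k + 1) j h1 hN h).1
        exact ⟨f, hf, by rw [hfe, hj]; simp⟩
      · exact ⟨f, Or.inl ⟨k, l, hk, hf⟩, hfe⟩
    · exact ⟨_, Or.inr ⟨j, h1, hN, Or.inr (Or.inl rfl)⟩, rfl⟩
    · exact ⟨_, Or.inr ⟨j, h1, hN, Or.inr (Or.inr rfl)⟩, rfl⟩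
    · obtain ⟨f, hf, hfe⟩ := (closureEdges_places w 0 j h1 hN (Nat.zero_le _)).1
      exact ⟨f, hf, by rw [hfe]; simp⟩

/-- The closure of a braid word of index `N`, as an oriented polygonal link. -/
def braidClosure {N : ℕ} (w : BraidWord N) : PolyLink where
  edges := closureEdges w
  finite := closureEdges_finite w
  nondegenerate := closureEdges_nondegenerate w
  initial_inj := closureEdges_initial_inj w
  terminal_inj := closureEdges_terminal_inj w
  closed := closureEdges_closed w
  embedded := fun _ he _ hf hne _ hp =>
    ⟨closureEdges_embedded w he hf hne hp.1 hp.2,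
      closureEdges_embedded w hf he hne.symm hp.2 hp.1⟩

/-!
# A symmetry of closures of twisted braids, extending `T(a, b) = T(b, a)`

Both braids are positive, and the two closures are related by moves between positive words only:
far commutation, the braid relation, conjugation, and removal of a last strand that takes part in a
single crossing. Hence no inverse generators and no cancellations are needed.

*Geometry.* Each of these moves preserves the polygonal link up to isotopy. A closure is described
by a list of sets of indices, one set for each level (`levelClosure`); a level may be empty or hold
several distant crossings. A single Delta-move is admissible as soon as the triangle misses the rest
of the link (`condIso_triangle`). Straight and closing strands are changed by single large
triangles. The moves of crossings are sequences of triangle moves inside a small tangle, which up to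
an affine map consists of edges between integer points in a convex region that the other edges meet
at most in prescribed end points. For integer tangles the conditions are decidable, by separating
functionals, and they are checked by kernel computation (`Transforms`, `Transforms.condIso`). This
gives the sliding of a crossing to the next level (`condIso_slide`), the braid relation
(`condIso_braid`), the passage of a crossing around the closing strands (`condIso_rotate`), the
removal of the last strand (`condIso_destabilize`) and the removal of an empty level
(`condIso_absorb`).

*Algebra.* The moves turn into statements about the monoid of positive braids on an unlimited number
of strands (`PosBraid`), with the relation `PosBraid.SameClosure`. Write `W(n) = σ_{n-1} ⋯ σ_1` and
`V(n) = σ_1 ⋯ σ_{n-1}`.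
* If `c < n` and `Y` is a braid on `n` strands, then the closure of `W(n + k) ^ (c + 1) * Y` on
  `n + k` strands is that of `W(n) ^ (c + 1) * V(c + 1) ^ k * Y` on `n` strands
  (`PosBraid.sameClosure_w_add`), and similarly with `V` and `W` exchanged.
* `W(n) ^ n = V(n) ^ n`, the full twist (`PosBraid.w_pow_eq_v_pow`).
* For `a < p` the braids `V(p) ^ (c + 1) * V(a) ^ k` and `W(p) ^ (c + 1) * W(a) ^ k` are conjugate
  by positive braids (`PosBraid.sameClosure_v_w`).

By symmetry let `a₁ ≤ b₁`, and put `k = b₂ - b₁`. The first link is the closure of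
`W(b₁) ^ a₂ * V(a₁) ^ k` on `b₁` strands, by the first fact. The second link is the closure of
`V(a₂) ^ b₁ * V(a₁) ^ k` on `a₂` strands, by the third one. Now the first fact is applied to the
braid with more strands, and the second one turns the result into the other braid.
-/

/-! ### Edge sets of links and the triangle move -/

/-- The set `X` is the set of edges of an oriented polygonal link. -/
def IsLink (X : Set DirEdge) : Prop := ∃ L : PolyLink, L.edges = X

/-- The sets `X` and `Y` are the sets of edges of two isotopic oriented polygonal links. -/
def Iso (X Y : Set DirEdge) : Prop :=
  ∃ L L' : PolyLink, L.edges = X ∧ L'.edges = Y ∧ SameLink L L'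

theorem Iso.refl {X : Set DirEdge} (h : IsLink X) : Iso X X := by
  obtain ⟨L, hL⟩ := h
  exact ⟨L, L, hL, hL, Relation.EqvGen.refl L⟩

theorem Iso.symm {X Y : Set DirEdge} (h : Iso X Y) : Iso Y X := by
  obtain ⟨L, L', hL, hL', h⟩ := h
  exact ⟨L', L, hL', hL, Relation.EqvGen.symm _ _ h⟩

theorem Iso.trans {X Y Z : Set DirEdge} (h : Iso X Y) (h' : Iso Y Z) : Iso X Z := by
  obtain ⟨L, L', hL, hL', h⟩ := h
  obtain ⟨M, M', hM, hM', h'⟩ := h'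
  obtain rfl : L' = M := PolyLink.ext (hL'.trans hM.symm)
  exact ⟨L, M', hL, hM', Relation.EqvGen.trans _ _ _ h h'⟩

theorem Iso.left {X Y : Set DirEdge} (h : Iso X Y) : IsLink X :=
  let ⟨L, _, hL, _, _⟩ := h
  ⟨L, hL⟩

theorem Iso.right {X Y : Set DirEdge} (h : Iso X Y) : IsLink Y := h.symm.left

/-- `X` and `Y` are isotopic as soon as one of them is a link. This form of `Iso` can be composed
and reversed before it is known that the edge sets are links. -/
def CondIso (X Y : Set DirEdge) : Prop := IsLink X ∨ IsLink Y → Iso X Y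

theorem CondIso.refl (X : Set DirEdge) : CondIso X X := fun h => Iso.refl (h.elim id id)

theorem CondIso.symm {X Y : Set DirEdge} (h : CondIso X Y) : CondIso Y X :=
  fun h' => (h h'.symm).symm

theorem CondIso.trans {X Y Z : Set DirEdge} (h : CondIso X Y) (h' : CondIso Y Z) :
    CondIso X Z := by
  rintro (hX | hZ)
  · have h1 := h (Or.inl hX)
    exact h1.trans (h' (Or.inl h1.right))
  · have h1 := h' (Or.inr hZ)
    exact (h (Or.inr h1.left)).trans h1

theorem CondIso.trans_eq {X Y Y' Z : Set DirEdge} (h : CondIso X Y) (e : Y = Y')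
    (h' : CondIso Y' Z) : CondIso X Z := h.trans (e ▸ h')

/-- `C` can be inserted as a new vertex into the segment from `A` to `B`: either `ABC` is a true
triangle, or `C` is an interior point of the segment. -/
def Insertable (A B C : Space) : Prop :=
  A ≠ B ∧ (AffineIndependent ℝ ![A, B, C] ∨ C ∈ openSegment ℝ A B)

theorem Insertable.eq_of_mem {A B C p : Space} (h : Insertable A B C)
    (h1 : p ∈ segment ℝ A C) (h2 : p ∈ segment ℝ C B) : p = C := by
  rw [segment_eq_image'] at h1 h2
  obtain ⟨s, ⟨hs0, hs1⟩, rfl⟩ := h1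
  obtain ⟨t, ⟨ht0, ht1⟩, h2⟩ := h2
  obtain ⟨hAB, h | h⟩ := h
  · have hl := (affineIndependent_iff_linearIndependent_vsub ℝ ![A, B, C] 0).1 h
    have hl' : LinearIndependent ℝ ![B - A, C - A] := by
      have := hl.comp (fun i : Fin 2 => (⟨i.succ, Fin.succ_ne_zero i⟩ : {x : Fin 3 // x ≠ 0}))
        (by intro i j hij; simpa using hij)
      have e : ![B - A, C - A] = (fun i : {x : Fin 3 // x ≠ 0} => ![A, B, C] i -ᵥ ![A, B, C] 0) ∘
          fun i : Fin 2 => (⟨i.succ, Fin.succ_ne_zero i⟩ : {x : Fin 3 // x ≠ 0}) := by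
        ext i : 1
        fin_cases i <;> simp
      rw [e]
      exact this
    rw [LinearIndependent.pair_iff] at hl'
    have key := hl' t (1 - t - s) (by
      have : C + t • (B - C) - (A + s • (C - A)) = 0 := sub_eq_zero.2 h2
      rw [← this]
      module)
    have : s = 1 := by linarith [key.1, key.2]
    subst this
    simp
  · rw [openSegment_eq_image'] at h
    obtain ⟨r, ⟨hr0, hr1⟩, rfl⟩ := h
    have h3 : (r + t * (1 - r) - s * r) • (B - A) = 0 := by
      have : A + r • (B - A) + t • (B - (A + r • (B - A))) -
        (A + s • (A + r • (B - A) - A)) = 0 := sub_eq_zero.2 h2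
      rw [← this]
      module
    rcases smul_eq_zero.1 h3 with h4 | h4
    · have : (1 - s) * r = 0 := by
        have h5 := mul_nonneg ht0 (sub_nonneg.2 hr1.le)
        have h6 := mul_nonneg (sub_nonneg.2 hs1) hr0.le
        linarith
      have : s = 1 := by
        rcases mul_eq_zero.1 this with h | h <;> linarith
      subst this
      simp
    · exact absurd (sub_eq_zero.1 h4).symm hAB

theorem Insertable.ne_left {A B C : Space} (h : Insertable A B C) : A ≠ C := by
  rintro rfl
  rcases h with ⟨hAB, h | h⟩
  · have := h.injective.ne (show (0 : Fin 3) ≠ 2 by decide)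
    simp at this
  · exact hAB (left_mem_openSegment_iff.1 h)

theorem Insertable.ne_right {A B C : Space} (h : Insertable A B C) : C ≠ B := by
  rintro rfl
  rcases h with ⟨hAB, h | h⟩
  · have := h.injective.ne (show (1 : Fin 3) ≠ 2 by decide)
    simp at this
  · exact hAB (right_mem_openSegment_iff.1 h)

theorem segment_subset_triangle (A B C : Space) :
    segment ℝ A B ⊆ convexHull ℝ {A, B, C} ∧ segment ℝ A C ⊆ convexHull ℝ {A, B, C} ∧
      segment ℝ C B ⊆ convexHull ℝ {A, B, C} := by
  refine ⟨segment_subset_convexHull ?_ ?_, segment_subset_convexHull ?_ ?_,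
    segment_subset_convexHull ?_ ?_⟩ <;> simp

section TriangleMove

variable {S : Set DirEdge} {A B C : Space}

/-- The triangle `ABC` meets the edges in `S` at most in the points `A` and `B`. -/
def AvoidsTriangle (S : Set DirEdge) (A B C : Space) : Prop :=
  ∀ f ∈ S, ∀ p ∈ f.seg, p ∈ convexHull ℝ {A, B, C} → p = A ∨ p = B

theorem AvoidsTriangle.notMem (hS : AvoidsTriangle S A B C) (h : Insertable A B C) :
    ∀ f ∈ S, f.1 ≠ C ∧ f.2 ≠ C := by
  have hC : C ∈ convexHull ℝ {A, B, C} := subset_convexHull ℝ _ (by simp)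
  intro f hf
  constructor <;> intro hfC
  · rcases hS f hf C (hfC ▸ left_mem_seg f) hC with h' | h'
    · exact h.ne_left h'.symm
    · exact h.ne_right h'
  · rcases hS f hf C (hfC ▸ right_mem_seg f) hC with h' | h'
    · exact h.ne_left h'.symm
    · exact h.ne_right h'

theorem AvoidsTriangle.notMem_edge (hS : AvoidsTriangle S A B C) (h : Insertable A B C) :
    (A, B) ∉ S := by
  intro hf
  have hm : midpoint ℝ A B ∈ segment ℝ A B := midpoint_mem_segment A B
  rcases hS _ hf _ hm ((segment_subset_triangle A B C).1 hm) with h' | h'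
  · exact h.1 ((midpoint_eq_left_iff (R := ℝ)).1 h')
  · exact h.1 ((midpoint_eq_right_iff (R := ℝ)).1 h')

/-- Inserting a vertex keeps the conditions on a link: an edge in `S` that meets a new edge does so
in `A` or `B`, where it already met the old edge `AB`, hence in an end point. -/
theorem isLink_insert_vertex (h : Insertable A B C) (hS : AvoidsTriangle S A B C)
    (hL : IsLink (S ∪ {(A, B)})) : IsLink (S ∪ {(A, C), (C, B)}) := by
  obtain ⟨L, hL⟩ := hL
  have hAB : (A, B) ∈ L.edges := by simp [hL]
  have hSL : ∀ f ∈ S, f ∈ L.edges := fun f hf => by simp [hL, hf]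
  have hne := hS.notMem_edge h
  have hC := hS.notMem h
  have hA1 : ∀ f ∈ S, f.1 ≠ A := fun f hf hfA =>
    hne (by rw [← L.initial_inj (hSL f hf) hAB hfA]; exact hf)
  have hB2 : ∀ f ∈ S, f.2 ≠ B := fun f hf hfB =>
    hne (by rw [← L.terminal_inj (hSL f hf) hAB hfB]; exact hf)
  have hcl : ∀ x, x ∈ Prod.fst '' L.edges ↔ x ∈ Prod.snd '' L.edges := fun x => by rw [L.closed]
  obtain ⟨t1, t2, t3⟩ := segment_subset_triangle A B C
  -- a point of a new edge on an old edge is `A` or `B`, hence an end point of the old edge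
  have key : ∀ f ∈ S, ∀ p ∈ f.seg, p ∈ convexHull ℝ {A, B, C} →
      (p = A ∨ p = B) ∧ (p = f.1 ∨ p = f.2) := by
    intro f hf p hp hpt
    have h1 := hS f hf p hp hpt
    refine ⟨h1, ?_⟩
    have h2 := (L.embedded f (hSL f hf) _ hAB (fun h => hne (h ▸ hf)) ⟨hp, by
      rcases h1 with rfl | rfl
      · exact left_mem_seg (p, B)
      · exact right_mem_seg (A, p)⟩).1
    simpa using h2
  have hBAC : B ∉ segment ℝ A C := fun hB =>
    h.ne_right (h.eq_of_mem hB (right_mem_segment ℝ C B)).symm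
  have hACB : A ∉ segment ℝ C B := fun hA =>
    h.ne_left (h.eq_of_mem (left_mem_segment ℝ A C) hA)
  refine ⟨⟨S ∪ {(A, C), (C, B)}, ?_, ?_, ?_, ?_, ?_, ?_⟩, rfl⟩
  · exact (L.finite.subset hSL).union (by simp)
  · rintro e (he | rfl | rfl)
    · exact L.nondegenerate e (hSL e he)
    · exact h.ne_left
    · exact h.ne_right
  · rintro e (he | rfl | rfl) f (hf | rfl | rfl) hef
    · exact L.initial_inj (hSL e he) (hSL f hf) hef
    · exact absurd hef (hA1 e he)
    · exact absurd hef (hC e he).1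
    · exact absurd hef.symm (hA1 f hf)
    · rfl
    · exact absurd hef h.ne_left
    · exact absurd hef.symm (hC f hf).1
    · exact absurd hef.symm h.ne_left
    · rfl
  · rintro e (he | rfl | rfl) f (hf | rfl | rfl) hef
    · exact L.terminal_inj (hSL e he) (hSL f hf) hef
    · exact absurd hef (hC e he).2
    · exact absurd hef (hB2 e he)
    · exact absurd hef.symm (hC f hf).2
    · rfl
    · exact absurd hef h.ne_right
    · exact absurd hef.symm (hB2 f hf)
    · exact absurd hef.symm h.ne_right
    · rfl
  · ext x
    have := hcl x
    rw [hL] at this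
    simp only [Set.image_union, Set.image_insert_eq, Set.image_singleton, Set.mem_union,
      Set.mem_insert_iff, Set.mem_singleton_iff] at this ⊢
    tauto
  · rintro e (he | rfl | rfl) f (hf | rfl | rfl) hef p ⟨hpe, hpf⟩
    · exact L.embedded e (hSL e he) f (hSL f hf) hef ⟨hpe, hpf⟩
    · obtain ⟨h1 | h1, h2⟩ := key e he p hpe (t2 hpf)
      · exact ⟨h2, Or.inl h1⟩
      · exact absurd (h1 ▸ hpf) hBAC
    · obtain ⟨h1 | h1, h2⟩ := key e he p hpe (t3 hpf)
      · exact absurd (h1 ▸ hpf) hACB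
      · exact ⟨h2, Or.inr h1⟩
    · obtain ⟨h1 | h1, h2⟩ := key f hf p hpf (t2 hpe)
      · exact ⟨Or.inl h1, h2⟩
      · exact absurd (h1 ▸ hpe) hBAC
    · exact absurd rfl hef
    · have := h.eq_of_mem hpe hpf
      exact ⟨Or.inr this, Or.inl this⟩
    · obtain ⟨h1 | h1, h2⟩ := key f hf p hpf (t3 hpe)
      · exact absurd (h1 ▸ hpe) hACB
      · exact ⟨Or.inr h1, h2⟩
    · have := h.eq_of_mem hpf hpe
      exact ⟨Or.inl this, Or.inr this⟩
    · exact absurd rfl hef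

theorem isLink_erase_vertex (h : Insertable A B C) (hS : AvoidsTriangle S A B C)
    (hL : IsLink (S ∪ {(A, C), (C, B)})) : IsLink (S ∪ {(A, B)}) := by
  obtain ⟨L, hL⟩ := hL
  have hAC : (A, C) ∈ L.edges := by simp [hL]
  have hCB : (C, B) ∈ L.edges := by simp [hL]
  have hSL : ∀ f ∈ S, f ∈ L.edges := fun f hf => by simp [hL, hf]
  have hC := hS.notMem h
  have hne1 : ∀ f ∈ S, f ≠ (A, C) := fun f hf hfe => (hC f hf).2 (by rw [hfe])
  have hne2 : ∀ f ∈ S, f ≠ (C, B) := fun f hf hfe => (hC f hf).1 (by rw [hfe])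
  have hA1 : ∀ f ∈ S, f.1 ≠ A := fun f hf hfA =>
    hne1 f hf (L.initial_inj (hSL f hf) hAC hfA)
  have hB2 : ∀ f ∈ S, f.2 ≠ B := fun f hf hfB =>
    hne2 f hf (L.terminal_inj (hSL f hf) hCB hfB)
  have hcl : ∀ x, x ∈ Prod.fst '' L.edges ↔ x ∈ Prod.snd '' L.edges := fun x => by rw [L.closed]
  have key : ∀ f ∈ S, ∀ p ∈ f.seg, p ∈ segment ℝ A B →
      (p = A ∨ p = B) ∧ (p = f.1 ∨ p = f.2) := by
    intro f hf p hp hpt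
    have h1 := hS f hf p hp ((segment_subset_triangle A B C).1 hpt)
    refine ⟨h1, ?_⟩
    rcases h1 with rfl | rfl
    · simpa using (L.embedded f (hSL f hf) _ hAC (hne1 f hf) ⟨hp, left_mem_seg (p, C)⟩).1
    · simpa using (L.embedded f (hSL f hf) _ hCB (hne2 f hf) ⟨hp, right_mem_seg (C, p)⟩).1
  refine ⟨⟨S ∪ {(A, B)}, ?_, ?_, ?_, ?_, ?_, ?_⟩, rfl⟩
  · exact (L.finite.subset hSL).union (by simp)
  · rintro e (he | rfl)
    · exact L.nondegenerate e (hSL e he)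
    · exact h.1
  · rintro e (he | rfl) f (hf | rfl) hef
    · exact L.initial_inj (hSL e he) (hSL f hf) hef
    · exact absurd hef (hA1 e he)
    · exact absurd hef.symm (hA1 f hf)
    · rfl
  · rintro e (he | rfl) f (hf | rfl) hef
    · exact L.terminal_inj (hSL e he) (hSL f hf) hef
    · exact absurd hef (hB2 e he)
    · exact absurd hef.symm (hB2 f hf)
    · rfl
  · ext x
    have := hcl x
    rw [hL] at this
    have c1 : ∀ f ∈ S, x = C → f.1 ≠ x := fun f hf hx => hx ▸ (hC f hf).1
    have c2 : ∀ f ∈ S, x = C → f.2 ≠ x := fun f hf hx => hx ▸ (hC f hf).2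
    by_cases hx : x = C
    · have d1 : x ∉ Prod.fst '' S := by rintro ⟨f, hf, hfx⟩; exact c1 f hf hx hfx
      have d2 : x ∉ Prod.snd '' S := by rintro ⟨f, hf, hfx⟩; exact c2 f hf hx hfx
      have d3 : x ≠ A := hx ▸ h.ne_left.symm
      have d4 : x ≠ B := hx ▸ h.ne_right
      simp only [Set.image_union, Set.image_singleton, Set.mem_union, Set.mem_singleton_iff]
      tauto
    · simp only [Set.image_union, Set.image_insert_eq, Set.image_singleton, Set.mem_union,
        Set.mem_insert_iff, Set.mem_singleton_iff] at this ⊢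
      tauto
  · rintro e (he | rfl) f (hf | rfl) hef p ⟨hpe, hpf⟩
    · exact L.embedded e (hSL e he) f (hSL f hf) hef ⟨hpe, hpf⟩
    · obtain ⟨h1, h2⟩ := key e he p hpe hpf
      exact ⟨h2, h1⟩
    · obtain ⟨h1, h2⟩ := key f hf p hpf hpe
      exact ⟨h1, h2⟩
    · exact absurd rfl hef

/-- The triangle move in both directions: a vertex `C` may be inserted into, or removed from, a
link when the triangle it spans is free. -/
theorem condIso_triangle (h : Insertable A B C) (hS : AvoidsTriangle S A B C) :
    CondIso (S ∪ {(A, C), (C, B)}) (S ∪ {(A, B)}) := by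
  suffices hh : IsLink (S ∪ {(A, B)}) → Iso (S ∪ {(A, B)}) (S ∪ {(A, C), (C, B)}) by
    rintro (h1 | h1)
    · exact (hh (isLink_erase_vertex h hS h1)).symm
    · exact (hh h1).symm
  intro hL
  obtain ⟨L', hL'⟩ := isLink_insert_vertex h hS hL
  obtain ⟨L, hL⟩ := hL
  refine ⟨L, L', hL, hL', Relation.EqvGen.rel _ _ ⟨A, B, C, by simp [hL], h.2, ?_, ?_⟩⟩
  · apply Set.Subset.antisymm
    · rintro p ⟨hp, hp'⟩
      simp only [PolyLink.carrier, hL, Set.mem_iUnion] at hp'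
      obtain ⟨f, hf | rfl, hpf⟩ := hp'
      · rcases hS f hf p hpf hp with rfl | rfl
        · exact left_mem_segment ℝ _ _
        · exact right_mem_segment ℝ _ _
      · exact hpf
    · intro p hp
      refine ⟨(segment_subset_triangle A B C).1 hp, ?_⟩
      simp only [PolyLink.carrier, hL, Set.mem_iUnion]
      exact ⟨(A, B), Or.inr rfl, hp⟩
  · rw [hL, hL']
    congr 1
    ext e
    have := hS.notMem_edge h
    simp only [Set.union_singleton, Set.mem_sdiff, Set.mem_insert_iff, Set.mem_singleton_iff]
    constructor
    · intro he
      exact ⟨Or.inr he, fun h => this (h ▸ he)⟩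
    · rintro ⟨he | he, h⟩
      · exact absurd he h
      · exact he

end TriangleMove

/-! ### Separating a triangle from an edge -/

theorem mem_triangle {A B C p : Space} (h : p ∈ convexHull ℝ {A, B, C}) :
    ∃ a b c : ℝ, 0 ≤ a ∧ 0 ≤ b ∧ 0 ≤ c ∧ a + b + c = 1 ∧ p = a • A + b • B + c • C := by
  rw [convexHull_insert (by simp), convexHull_pair] at h
  simp only [convexJoin_singleton_left, Set.mem_iUnion] at h
  obtain ⟨q, ⟨b, c, hb, hc, hbc, rfl⟩, a, d, ha, hd, had, rfl⟩ := h
  refine ⟨a, d * b, d * c, ha, mul_nonneg hd hb, mul_nonneg hd hc, ?_, ?_⟩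
  · rw [add_assoc, ← mul_add, hbc, mul_one, had]
  · module

theorem le_of_mem_triangle {g : Space →ₗ[ℝ] ℝ} {A B C p : Space} {m : ℝ} (hA : g A ≤ m)
    (hB : g B ≤ m) (hC : g C ≤ m) (hp : p ∈ convexHull ℝ {A, B, C}) : g p ≤ m := by
  obtain ⟨a, b, c, ha, hb, hc, habc, rfl⟩ := mem_triangle hp
  simp only [map_add, map_smul, smul_eq_mul]
  calc a * g A + b * g B + c * g C ≤ a * m + b * m + c * m := by gcongr
    _ = m := by rw [← add_mul, ← add_mul, habc, one_mul]

theorem le_of_mem_seg {g : Space →ₗ[ℝ] ℝ} {e : DirEdge} {p : Space} {m : ℝ} (h1 : m ≤ g e.1)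
    (h2 : m ≤ g e.2) (hp : p ∈ e.seg) : m ≤ g p := by
  obtain ⟨a, b, ha, hb, hab, rfl⟩ := hp
  simp only [map_add, map_smul, smul_eq_mul]
  calc m = a * m + b * m := by rw [← add_mul, hab, one_mul]
    _ ≤ _ := by gcongr

/-- A triangle lying weakly below a level of a linear functional, with at most one of `A`, `B`
and never `C` on this level. -/
theorem touch_of_face {g : Space →ₗ[ℝ] ℝ} {A B C p : Space} {m : ℝ} (hA : g A ≤ m)
    (hB : g B ≤ m) (hAB : g A < m ∨ g B < m) (hC : g C < m) (hp : p ∈ convexHull ℝ {A, B, C})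
    (hm : m ≤ g p) : p = A ∨ p = B := by
  obtain ⟨a, b, c, ha, hb, hc, habc, rfl⟩ := mem_triangle hp
  simp only [map_add, map_smul, smul_eq_mul] at hm
  have e : a * (m - g A) + b * (m - g B) + c * (m - g C) ≤ 0 := by
    have : (a + b + c) * m = m := by rw [habc, one_mul]
    linarith
  have eA := mul_nonneg ha (sub_nonneg.2 hA)
  have eB := mul_nonneg hb (sub_nonneg.2 hB)
  have eC := mul_nonneg hc (sub_nonneg.2 hC.le)
  have hc0 : c = 0 := by
    rcases mul_eq_zero.1 (show c * (m - g C) = 0 by linarith) with h | h <;> linarith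
  subst hc0
  rcases hAB with h | h
  · have ha0 : a = 0 := by
      rcases mul_eq_zero.1 (show a * (m - g A) = 0 by linarith) with h | h <;> linarith
    subst ha0
    right
    simp [show b = 1 by linarith]
  · have hb0 : b = 0 := by
      rcases mul_eq_zero.1 (show b * (m - g B) = 0 by linarith) with h | h <;> linarith
    subst hb0
    left
    simp [show a = 1 by linarith]

/-- An edge whose initial point is its only point on a level of a linear functional. -/
theorem touch_of_initial {g : Space →ₗ[ℝ] ℝ} {D E p : Space} (h : g D < g E)
    (hp : p ∈ segment ℝ D E) (hm : g p ≤ g D) : p = D := by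
  obtain ⟨a, b, ha, hb, hab, rfl⟩ := hp
  simp only [map_add, map_smul, smul_eq_mul] at hm
  have hb0 : b = 0 := by
    have : (a + b) * g D = g D := by rw [hab, one_mul]
    rcases mul_eq_zero.1 (show b * (g E - g D) = 0 by
      have := mul_nonneg hb (sub_nonneg.2 h.le)
      linarith) with h | h <;> linarith
  subst hb0
  simp [show a = 1 by linarith]

/-- The linear functional with the given coefficients. -/
def functional (a b c : ℝ) : Space →ₗ[ℝ] ℝ where
  toFun p := a * p.1 + b * p.2.1 + c * p.2.2
  map_add' p q := by simp only [Prod.fst_add, Prod.snd_add]; ring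
  map_smul' r p := by simp only [Prod.smul_fst, Prod.smul_snd, smul_eq_mul, RingHom.id_apply]; ring

@[simp] theorem functional_apply (a b c : ℝ) (p : Space) :
    functional a b c p = a * p.1 + b * p.2.1 + c * p.2.2 := rfl

/-- Three points are affinely independent if one of the coordinate minors of the triangle does not
vanish. -/
theorem affineIndependent_of_minor {A B C : Space}
    (h : (B.1 - A.1) * (C.2.1 - A.2.1) ≠ (B.2.1 - A.2.1) * (C.1 - A.1) ∨
      (B.1 - A.1) * (C.2.2 - A.2.2) ≠ (B.2.2 - A.2.2) * (C.1 - A.1) ∨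
      (B.2.1 - A.2.1) * (C.2.2 - A.2.2) ≠ (B.2.2 - A.2.2) * (C.2.1 - A.2.1)) :
    AffineIndependent ℝ ![A, B, C] := by
  rw [affineIndependent_iff_not_collinear_set]
  intro hc
  rw [collinear_iff_of_mem (p₀ := A) (by simp)] at hc
  obtain ⟨v, hv⟩ := hc
  obtain ⟨s, hs⟩ := hv B (by simp)
  obtain ⟨t, ht⟩ := hv C (by simp)
  simp only [vadd_eq_add] at hs ht
  subst hs ht
  simp only [Prod.fst_add, Prod.snd_add, Prod.smul_fst, Prod.smul_snd, smul_eq_mul,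
    add_sub_cancel_right] at h
  rcases h with h | h | h <;> exact h (by ring)

/-! ### Local moves of integer tangles -/

/-- A point with integer coordinates. -/
abbrev IntPoint : Type := ℤ × ℤ × ℤ

/-- A directed edge with integer end points. -/
abbrev IntEdge : Type := IntPoint × IntPoint

/-- A point with integer coordinates as a point of three-space. -/
def IntPoint.toSpace (p : IntPoint) : Space := ((p.1 : ℝ), (p.2.1 : ℝ), (p.2.2 : ℝ))

/-- The value at `p` of the linear functional with coefficients `g`. -/
def IntPoint.dot (g p : IntPoint) : ℤ := g.1 * p.1 + g.2.1 * p.2.1 + g.2.2 * p.2.2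

theorem IntPoint.functional_toSpace (g p : IntPoint) :
    functional g.1 g.2.1 g.2.2 p.toSpace = (g.dot p : ℝ) := by
  simp [toSpace, dot]

/-- The image of an integer edge under an affine map. -/
def IntEdge.map (φ : Space →ᵃ[ℝ] Space) (f : IntEdge) : DirEdge := (φ f.1.toSpace, φ f.2.toSpace)

/-- The image of an integer tangle under an affine map. -/
def tangle (φ : Space →ᵃ[ℝ] Space) (E : List IntEdge) : Set DirEdge := {e | ∃ f ∈ E, e = f.map φ}

/-- The functional `g` shows that the triangle `ABC` meets the edge `f` at most in `A` or `B`.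
Either the triangle lies weakly below the edge and touches its lower level at most in one of the
points `A`, `B`, or the triangle lies weakly below one end point of the edge, which is the strict
minimum of `g` on the edge and is `A` or `B`. -/
def SeparatedBy (g A B C : IntPoint) (f : IntEdge) : Prop :=
  (g.dot C < min (g.dot f.1) (g.dot f.2) ∧ g.dot A ≤ min (g.dot f.1) (g.dot f.2) ∧
    g.dot B ≤ min (g.dot f.1) (g.dot f.2) ∧ (g.dot A < min (g.dot f.1) (g.dot f.2) ∨
      g.dot B < min (g.dot f.1) (g.dot f.2))) ∨
  (max (g.dot A) (max (g.dot B) (g.dot C)) ≤ g.dot f.1 ∧ g.dot f.1 < g.dot f.2 ∧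
    (f.1 = A ∨ f.1 = B)) ∨
  (max (g.dot A) (max (g.dot B) (g.dot C)) ≤ g.dot f.2 ∧ g.dot f.2 < g.dot f.1 ∧
    (f.2 = A ∨ f.2 = B))

instance (g A B C : IntPoint) (f : IntEdge) : Decidable (SeparatedBy g A B C f) := by
  unfold SeparatedBy; infer_instance

theorem SeparatedBy.touch {g A B C : IntPoint} {f : IntEdge} (h : SeparatedBy g A B C f)
    {p : Space} (hp : p ∈ segment ℝ f.1.toSpace f.2.toSpace)
    (hp' : p ∈ convexHull ℝ {A.toSpace, B.toSpace, C.toSpace}) :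
    p = A.toSpace ∨ p = B.toSpace := by
  have key := g.functional_toSpace
  set G := functional (g.1 : ℝ) g.2.1 g.2.2
  rcases h with ⟨hC, hA, hB, hAB⟩ | ⟨hm, hf, hfe⟩ | ⟨hm, hf, hfe⟩
  · refine touch_of_face (g := G) (m := ((min (g.dot f.1) (g.dot f.2) : ℤ) : ℝ)) ?_ ?_ ?_ ?_ hp' ?_
    · rw [key]; exact_mod_cast hA
    · rw [key]; exact_mod_cast hB
    · rw [key, key]; exact_mod_cast hAB
    · rw [key]; exact_mod_cast hC
    · refine le_of_mem_seg (e := (f.1.toSpace, f.2.toSpace)) ?_ ?_ hp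
      · rw [key]; exact_mod_cast min_le_left _ _
      · rw [key]; exact_mod_cast min_le_right _ _
  · have : p = f.1.toSpace := by
      refine touch_of_initial (g := G) (E := f.2.toSpace) ?_ hp
        (le_of_mem_triangle ?_ ?_ ?_ hp')
      · rw [key, key]; exact_mod_cast hf
      all_goals rw [key, key]; norm_cast; omega
    rw [this]
    rcases hfe with h | h <;> simp [h]
  · have : p = f.2.toSpace := by
      refine touch_of_initial (g := G) (E := f.1.toSpace) ?_ (segment_symm ℝ f.1.toSpace _ ▸ hp)
        (le_of_mem_triangle ?_ ?_ ?_ hp')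
      · rw [key, key]; exact_mod_cast hf
      all_goals rw [key, key]; norm_cast; omega
    rw [this]
    rcases hfe with h | h <;> simp [h]

/-- A supply of linear functionals which is rich enough to separate every triangle from every other
edge in the four integer tangles considered below. -/
def separators : List IntPoint :=
  [(-3, -2, -4), (2, 1, -2), (1, 1, 1), (-1, -1, 1), (-3, 1, -1), (3, -1, 0), (0, 0, -1),
    (-1, -1, 3), (1, 0, 1), (-2, -1, 0), (0, 2, 1)]

/-- A triangle move of an integer tangle: the vertex `mid` is inserted into the edge from `fst` to
`snd` if `ins` is true, and it is removed from the path from `fst` via `mid` to `snd` otherwise. -/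
structure VertexMove where
  ins : Bool
  fst : IntPoint
  snd : IntPoint
  mid : IntPoint

namespace VertexMove

/-- The edges which are removed by the move. -/
def old (o : VertexMove) : List IntEdge :=
  if o.ins then [(o.fst, o.snd)] else [(o.fst, o.mid), (o.mid, o.snd)]

/-- The edges which are created by the move. -/
def new (o : VertexMove) : List IntEdge :=
  if o.ins then [(o.fst, o.mid), (o.mid, o.snd)] else [(o.fst, o.snd)]

/-- The edges which are not affected by the move. -/
def rest (o : VertexMove) (E : List IntEdge) : List IntEdge := E.filter (· ∉ o.old)

/-- The move is possible in the tangle `E` inside of the region given by the inequalities `K`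
(where `(g, c)` stands for `g ≤ c`), and it does not move the end points `P` of the tangle. -/
def Ok (K : List (IntPoint × ℤ)) (P : List IntPoint) (E : List IntEdge) (o : VertexMove) : Prop :=
  (∀ f ∈ o.old, f ∈ E) ∧
  ((o.snd.1 - o.fst.1) * (o.mid.2.1 - o.fst.2.1) ≠ (o.snd.2.1 - o.fst.2.1) * (o.mid.1 - o.fst.1) ∨
    (o.snd.1 - o.fst.1) * (o.mid.2.2 - o.fst.2.2) ≠ (o.snd.2.2 - o.fst.2.2) * (o.mid.1 - o.fst.1) ∨
    (o.snd.2.1 - o.fst.2.1) * (o.mid.2.2 - o.fst.2.2) ≠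
      (o.snd.2.2 - o.fst.2.2) * (o.mid.2.1 - o.fst.2.1)) ∧
  (∀ f ∈ o.rest E, ∃ g ∈ separators, SeparatedBy g o.fst o.snd o.mid f) ∧
  (∀ q ∈ P, q = o.fst ∨ q = o.snd ∨ ∃ f ∈ o.rest E, q = f.1 ∨ q = f.2) ∧
  (∀ k ∈ K, k.1.dot o.fst ≤ k.2 ∧ k.1.dot o.snd ≤ k.2 ∧ k.1.dot o.mid ≤ k.2)

instance (K : List (IntPoint × ℤ)) (P : List IntPoint) (E : List IntEdge) (o : VertexMove) :
    Decidable (o.Ok K P E) := by unfold Ok; infer_instance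

end VertexMove

/-- The list of moves transforms the tangle `E` to the tangle `E'`. -/
def Transforms (K : List (IntPoint × ℤ)) (P : List IntPoint) :
    List VertexMove → List IntEdge → List IntEdge → Prop
  | [], E, E' => E ⊆ E' ∧ E' ⊆ E
  | o :: os, E, E' => o.Ok K P E ∧ Transforms K P os (o.new ++ o.rest E) E'

instance decidableTransforms (K : List (IntPoint × ℤ)) (P : List IntPoint) :
    ∀ (os : List VertexMove) (E E' : List IntEdge), Decidable (Transforms K P os E E')
  | [], E, E' => by unfold Transforms; infer_instance
  | o :: os, E, E' => by
    unfold Transforms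
    have := decidableTransforms K P os (o.new ++ o.rest E) E'
    infer_instance

/-- The edges in `S` meet the region given by `K` at most in the end points `P` of the tangle; all
this is transported by the affine map `φ`. -/
def Outside (φ : Space →ᵃ[ℝ] Space) (K : List (IntPoint × ℤ)) (P : List IntPoint)
    (S : Set DirEdge) : Prop :=
  ∀ f ∈ S, ∀ q : Space, φ q ∈ f.seg →
    (∀ k ∈ K, functional k.1.1 k.1.2.1 k.1.2.2 q ≤ k.2) → ∃ r ∈ P, q = r.toSpace

theorem tangle_append (φ : Space →ᵃ[ℝ] Space) (E F : List IntEdge) :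
    tangle φ (E ++ F) = tangle φ E ∪ tangle φ F := by
  ext e
  simp only [tangle, List.mem_append, Set.mem_ofPred_eq, Set.mem_union]
  constructor
  · rintro ⟨f, h | h, rfl⟩
    · exact Or.inl ⟨f, h, rfl⟩
    · exact Or.inr ⟨f, h, rfl⟩
  · rintro (⟨f, h, rfl⟩ | ⟨f, h, rfl⟩)
    · exact ⟨f, Or.inl h, rfl⟩
    · exact ⟨f, Or.inr h, rfl⟩

theorem tangle_mono {φ : Space →ᵃ[ℝ] Space} {E F : List IntEdge} (h : E ⊆ F) :
    tangle φ E ⊆ tangle φ F := by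
  rintro e ⟨f, hf, rfl⟩
  exact ⟨f, h hf, rfl⟩

theorem map_triangle (φ : Space →ᵃ[ℝ] Space) (A B C : Space) :
    convexHull ℝ {φ A, φ B, φ C} = φ '' convexHull ℝ {A, B, C} := by
  rw [AffineMap.image_convexHull, Set.image_insert_eq, Set.image_insert_eq, Set.image_singleton]

theorem VertexMove.condIso {φ : Space →ᵃ[ℝ] Space} (hφ : Function.Injective φ)
    {K : List (IntPoint × ℤ)} {P : List IntPoint} {S : Set DirEdge} (hS : Outside φ K P S)
    {E : List IntEdge} {o : VertexMove} (h : o.Ok K P E) :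
    CondIso (S ∪ tangle φ E) (S ∪ tangle φ (o.new ++ o.rest E)) := by
  obtain ⟨hold, hind, hsep, hP, hK⟩ := h
  have hE : tangle φ E = tangle φ (o.rest E) ∪ tangle φ o.old := by
    rw [← tangle_append]
    apply Set.Subset.antisymm <;> refine tangle_mono fun f hf => ?_
    · by_cases hfo : f ∈ o.old
      · exact List.mem_append_right _ hfo
      · exact List.mem_append_left _ (List.mem_filter.2 ⟨hf, by simpa using hfo⟩)
    · rcases List.mem_append.1 hf with hf | hf
      · exact List.mem_of_mem_filter hf
      · exact hold f hf
  have hnd : AffineIndependent ℝ ![o.fst.toSpace, o.snd.toSpace, o.mid.toSpace] := by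
    apply affineIndependent_of_minor
    simp only [IntPoint.toSpace]
    exact_mod_cast hind
  have hins : Insertable (φ o.fst.toSpace) (φ o.snd.toSpace) (φ o.mid.toSpace) := by
    constructor
    · have := hnd.injective.ne (show (0 : Fin 3) ≠ 1 by decide)
      exact hφ.ne (by simpa using this)
    · left
      convert hnd.map' φ hφ using 1
      ext i : 1
      fin_cases i <;> rfl
  have hav : AvoidsTriangle (S ∪ tangle φ (o.rest E)) (φ o.fst.toSpace) (φ o.snd.toSpace)
      (φ o.mid.toSpace) := by
    rintro f hf p hp hpt
    rw [map_triangle] at hpt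
    obtain ⟨q, hq, rfl⟩ := hpt
    suffices hh : q = o.fst.toSpace ∨ q = o.snd.toSpace by
      rcases hh with rfl | rfl <;> simp
    rcases hf with hf | ⟨f, hf, rfl⟩
    · obtain ⟨r, hr, rfl⟩ := hS f hf q hp fun k hk => by
        obtain ⟨h1, h2, h3⟩ := hK k hk
        refine le_of_mem_triangle ?_ ?_ ?_ hq <;> rw [IntPoint.functional_toSpace] <;>
          exact_mod_cast ‹_›
      rcases hP r hr with rfl | rfl | ⟨f, hf, hrf⟩
      · exact Or.inl rfl
      · exact Or.inr rfl
      · obtain ⟨g, -, hg⟩ := hsep f hf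
        refine hg.touch ?_ hq
        rcases hrf with rfl | rfl
        · exact left_mem_segment ℝ _ _
        · exact right_mem_segment ℝ _ _
    · obtain ⟨g, -, hg⟩ := hsep f hf
      refine hg.touch ?_ hq
      unfold DirEdge.seg IntEdge.map at hp
      rw [← image_segment] at hp
      obtain ⟨q', hq', h⟩ := hp
      rwa [← hφ h]
  have hT := condIso_triangle hins hav
  have e1 : tangle φ [(o.fst, o.snd)] = {(φ o.fst.toSpace, φ o.snd.toSpace)} := by
    ext; simp [tangle, IntEdge.map]
  have e2 : tangle φ [(o.fst, o.mid), (o.mid, o.snd)] =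
      {(φ o.fst.toSpace, φ o.mid.toSpace), (φ o.mid.toSpace, φ o.snd.toSpace)} := by
    ext; simp [tangle, IntEdge.map]
  rw [tangle_append, hE, Set.union_comm (tangle φ o.new), ← Set.union_assoc, ← Set.union_assoc]
  unfold VertexMove.old VertexMove.new
  cases o.ins
  · simpa [e1, e2] using hT
  · simpa [e1, e2] using hT.symm

/-- A local move of an integer tangle, transported by an affine map, can be carried out inside of
any link. -/
theorem Transforms.condIso {φ : Space →ᵃ[ℝ] Space} (hφ : Function.Injective φ)
    {K : List (IntPoint × ℤ)} {P : List IntPoint} {S : Set DirEdge} (hS : Outside φ K P S)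
    {os : List VertexMove} {E E' : List IntEdge} (h : Transforms K P os E E') :
    CondIso (S ∪ tangle φ E) (S ∪ tangle φ E') := by
  induction os generalizing E with
  | nil =>
    rw [show tangle φ E = tangle φ E' from
      Set.Subset.antisymm (tangle_mono h.1) (tangle_mono h.2)]
    exact CondIso.refl _
  | cons o os ih => exact (VertexMove.condIso hφ hS h.1).trans (ih h.2)

/-! ### The local moves -/

/-- A crossing is moved down along two parallel strands. The front strand first leaves its
straight piece; then the back strand is moved down, and at last the bend of the front strand. -/
theorem transforms_slide :
    Transforms [((-1, 0, 0), 0), ((1, 0, 0), 2), ((0, -1, 0), 0), ((0, 1, 0), 4), ((0, 0, -1), 0)]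
      [(0, 0, 0), (2, 0, 0), (0, 4, 0), (2, 4, 0)]
      [⟨false, (0, 0, 0), (1, 3, 1), (0, 2, 0)⟩, ⟨true, (2, 2, 0), (0, 4, 0), (0, 2, 0)⟩,
        ⟨false, (2, 0, 0), (0, 2, 0), (2, 2, 0)⟩, ⟨true, (1, 3, 1), (2, 4, 0), (1, 1, 1)⟩,
        ⟨false, (0, 0, 0), (1, 1, 1), (1, 3, 1)⟩, ⟨true, (1, 1, 1), (2, 4, 0), (2, 2, 0)⟩]
      [((0, 0, 0), (0, 2, 0)), ((2, 0, 0), (2, 2, 0)),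
        ((0, 2, 0), (1, 3, 1)), ((1, 3, 1), (2, 4, 0)), ((2, 2, 0), (0, 4, 0))]
      [((0, 0, 0), (1, 1, 1)), ((1, 1, 1), (2, 2, 0)), ((2, 0, 0), (0, 2, 0)),
        ((0, 2, 0), (0, 4, 0)), ((2, 2, 0), (2, 4, 0))] := by
  decide +kernel

/-- A crossing of two parallel strands is moved around a corner. The first coordinate is the
direction across the strands, the other two span the plane of the corner, which lies at its
origin. -/
theorem transforms_corner :
    Transforms [((-1, 0, 0), 0), ((1, 0, 0), 2), ((0, -1, 1), 2), ((0, -1, -2), 2), ((0, 1, -1), 1),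
        ((0, 2, 1), 2)]
      [(0, -2, 0), (2, -2, 0), (0, 0, 2), (2, 0, 2)]
      [⟨false, (1, 0, -1), (2, 0, 2), (2, 0, 0)⟩, ⟨true, (1, 0, -1), (2, 0, 2), (1, 1, 0)⟩,
        ⟨false, (2, -2, 0), (0, 0, 2), (0, 0, 0)⟩, ⟨true, (2, -2, 0), (0, 0, 2), (2, 0, 0)⟩,
        ⟨false, (0, -2, 0), (1, 1, 0), (1, 0, -1)⟩, ⟨true, (0, -2, 0), (1, 1, 0), (0, 0, 0)⟩]
      [((0, -2, 0), (1, 0, -1)), ((1, 0, -1), (2, 0, 0)), ((2, -2, 0), (0, 0, 0)),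
        ((0, 0, 0), (0, 0, 2)), ((2, 0, 0), (2, 0, 2))]
      [((0, -2, 0), (0, 0, 0)), ((2, -2, 0), (2, 0, 0)),
        ((0, 0, 0), (1, 1, 0)), ((1, 1, 0), (2, 0, 2)), ((2, 0, 0), (0, 0, 2))] := by
  decide +kernel

/-- A loop with one crossing is removed: its vertices are cut off one after the other. -/
theorem transforms_loop :
    Transforms [((-1, 0, 1), 0), ((-1, 0, -1), 0), ((0, -1, 0), 0)]
      [(0, 0, 0), (0, 2, 0)]
      [⟨false, (1, 1, 1), (2, 4, -2), (2, 2, 0)⟩, ⟨false, (1, 1, 1), (2, 0, 0), (2, 4, -2)⟩,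
        ⟨false, (1, 1, 1), (0, 2, 0), (2, 0, 0)⟩, ⟨false, (0, 0, 0), (0, 2, 0), (1, 1, 1)⟩]
      [((0, 0, 0), (1, 1, 1)), ((1, 1, 1), (2, 2, 0)), ((2, 2, 0), (2, 4, -2)),
        ((2, 4, -2), (2, 0, 0)), ((2, 0, 0), (0, 2, 0))]
      [((0, 0, 0), (0, 2, 0))] := by
  decide +kernel

/-- The braid relation. The top strand is moved to the front, the bottom strand is straightened
behind the middle strand, and then all is done backwards on the other side. -/
theorem transforms_braid :
    Transforms [((-1, 0, 0), 0), ((1, 0, 0), 4), ((0, -1, 0), 0), ((0, 1, 0), 6), ((0, 0, -1), 0)]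
      [(0, 0, 0), (2, 0, 0), (4, 0, 0), (0, 6, 0), (2, 6, 0), (4, 6, 0)]
      [⟨false, (1, 1, 1), (3, 3, 1), (2, 2, 0)⟩, ⟨false, (3, 3, 1), (4, 6, 0), (4, 4, 0)⟩,
        ⟨false, (1, 1, 1), (4, 6, 0), (3, 3, 1)⟩, ⟨true, (1, 1, 1), (4, 6, 0), (2, 3, 4)⟩,
        ⟨false, (0, 0, 0), (2, 3, 4), (1, 1, 1)⟩, ⟨false, (4, 0, 0), (2, 4, 0), (4, 2, 0)⟩,
        ⟨false, (4, 0, 0), (0, 6, 0), (2, 4, 0)⟩, ⟨false, (2, 0, 0), (0, 4, 0), (0, 2, 0)⟩,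
        ⟨false, (2, 0, 0), (1, 5, 1), (0, 4, 0)⟩, ⟨true, (1, 5, 1), (2, 6, 0), (2, 3, 1)⟩,
        ⟨false, (2, 0, 0), (2, 3, 1), (1, 5, 1)⟩, ⟨true, (2, 0, 0), (2, 3, 1), (3, 1, 1)⟩,
        ⟨false, (3, 1, 1), (2, 6, 0), (2, 3, 1)⟩, ⟨true, (3, 1, 1), (2, 6, 0), (4, 4, 0)⟩,
        ⟨true, (3, 1, 1), (4, 4, 0), (4, 2, 0)⟩, ⟨true, (4, 0, 0), (0, 6, 0), (2, 2, 0)⟩,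
        ⟨true, (2, 2, 0), (0, 6, 0), (0, 4, 0)⟩, ⟨true, (0, 0, 0), (2, 3, 4), (0, 2, 0)⟩,
        ⟨true, (0, 2, 0), (2, 3, 4), (1, 3, 1)⟩, ⟨false, (1, 3, 1), (4, 6, 0), (2, 3, 4)⟩,
        ⟨true, (1, 3, 1), (4, 6, 0), (3, 5, 1)⟩, ⟨true, (1, 3, 1), (3, 5, 1), (2, 4, 0)⟩]
      [((0, 0, 0), (1, 1, 1)), ((1, 1, 1), (2, 2, 0)), ((2, 0, 0), (0, 2, 0)),
        ((4, 0, 0), (4, 2, 0)),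
        ((2, 2, 0), (3, 3, 1)), ((3, 3, 1), (4, 4, 0)), ((4, 2, 0), (2, 4, 0)),
        ((0, 2, 0), (0, 4, 0)),
        ((0, 4, 0), (1, 5, 1)), ((1, 5, 1), (2, 6, 0)), ((2, 4, 0), (0, 6, 0)),
        ((4, 4, 0), (4, 6, 0))]
      [((2, 0, 0), (3, 1, 1)), ((3, 1, 1), (4, 2, 0)), ((4, 0, 0), (2, 2, 0)),
        ((0, 0, 0), (0, 2, 0)),
        ((0, 2, 0), (1, 3, 1)), ((1, 3, 1), (2, 4, 0)), ((2, 2, 0), (0, 4, 0)),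
        ((4, 2, 0), (4, 4, 0)),
        ((2, 4, 0), (3, 5, 1)), ((3, 5, 1), (4, 6, 0)), ((4, 4, 0), (2, 6, 0)),
        ((0, 4, 0), (0, 6, 0))] := by
  decide +kernel

/-! ### Closures of words with several crossings in a level -/

/-- The affine map with linear part `(x, s, t) ↦ (x / 2, s • u + t • v)` which maps the origin
to `O`. -/
noncomputable def frame (O : Space) (u v : ℝ × ℝ) : Space →ᵃ[ℝ] Space where
  toFun p := (O.1 + p.1 / 2, O.2.1 + p.2.1 * u.1 + p.2.2 * v.1, O.2.2 + p.2.1 * u.2 + p.2.2 * v.2)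
  linear :=
    { toFun := fun p => (p.1 / 2, p.2.1 * u.1 + p.2.2 * v.1, p.2.1 * u.2 + p.2.2 * v.2)
      map_add' := fun p q => by
        simp only [Prod.fst_add, Prod.snd_add, Prod.mk_add_mk, Prod.mk.injEq]
        refine ⟨?_, ?_, ?_⟩ <;> ring
      map_smul' := fun r p => by
        simp only [Prod.smul_fst, Prod.smul_snd, smul_eq_mul, RingHom.id_apply, Prod.smul_mk,
          Prod.mk.injEq]
        refine ⟨?_, ?_, ?_⟩ <;> ring }
  map_vadd' := fun p q => by
    simp only [vadd_eq_add, Prod.fst_add, Prod.snd_add, LinearMap.coe_mk, AddHom.coe_mk,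
      Prod.mk_add_mk, Prod.ext_iff]
    refine ⟨?_, ?_, ?_⟩ <;> ring

theorem frame_apply (O : Space) (u v : ℝ × ℝ) (p : Space) : frame O u v p =
    (O.1 + p.1 / 2, O.2.1 + p.2.1 * u.1 + p.2.2 * v.1, O.2.2 + p.2.1 * u.2 + p.2.2 * v.2) := rfl

theorem frame_injective {O : Space} {u v : ℝ × ℝ} (h : u.1 * v.2 - u.2 * v.1 ≠ 0) :
    Function.Injective (frame O u v) := by
  intro p q hpq
  simp only [frame_apply, Prod.mk.injEq] at hpq
  obtain ⟨h1, h2, h3⟩ := hpq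
  refine Prod.ext (by linarith) (Prod.ext ?_ ?_)
  · apply mul_right_cancel₀ h
    linear_combination v.2 * h2 - v.1 * h3
  · apply mul_right_cancel₀ h
    linear_combination u.1 * h3 - u.2 * h2

/-- The two strands of a positive crossing at the places `i`, `i + 1` in the level `k`. -/
def crossEdges (i k : ℕ) : Set DirEdge :=
  {(((i : ℝ), (k : ℝ), 0), ((i : ℝ) + 1 / 2, (k : ℝ) + 1 / 2, 1 / 2)),
    (((i : ℝ) + 1 / 2, (k : ℝ) + 1 / 2, 1 / 2), ((i : ℝ) + 1, (k : ℝ) + 1, 0)),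
    (((i : ℝ) + 1, (k : ℝ), 0), ((i : ℝ), (k : ℝ) + 1, 0))}

/-- The strand which goes straight up at the place `j` in the level `k`. -/
def straightEdge (j k : ℕ) : DirEdge := (((j : ℝ), (k : ℝ), 0), ((j : ℝ), (k : ℝ) + 1, 0))

/-- The level `k` of a geometric braid on `N` strands, with positive crossings at the places in the
set `c`. In a meaningful level no two elements of `c` are equal or adjacent. -/
def lev (N : ℕ) (c : Set ℕ) (k : ℕ) : Set DirEdge :=
  {e | ∃ i ∈ c, e ∈ crossEdges i k} ∪
    {e | ∃ j, 1 ≤ j ∧ j ≤ N ∧ j ∉ c ∧ (∀ i ∈ c, j ≠ i + 1) ∧ e = straightEdge j k}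

/-- The part of the level `k` outside of the places `lo, …, hi`. -/
def levOff (N : ℕ) (c : Set ℕ) (lo hi k : ℕ) : Set DirEdge :=
  {e | ∃ i ∈ c, (i + 1 < lo ∨ hi < i) ∧ e ∈ crossEdges i k} ∪
    {e | ∃ j, 1 ≤ j ∧ j ≤ N ∧ (j < lo ∨ hi < j) ∧ j ∉ c ∧ (∀ i ∈ c, j ≠ i + 1) ∧
      e = straightEdge j k}

/-- The levels of a geometric braid, from the level `k` on. -/
def levels (N : ℕ) : ℕ → List (Set ℕ) → Set DirEdge
  | _, [] => ∅
  | k, c :: w => lev N c k ∪ levels N (k + 1) w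

/-- The closure of a braid on `N` strands whose levels have positive crossings at the places in the
members of the list. -/
def levelClosure (N : ℕ) (w : List (Set ℕ)) : Set DirEdge :=
  levels N 0 w ∪ closingEdges N w.length

theorem levels_append (N k : ℕ) (u v : List (Set ℕ)) :
    levels N k (u ++ v) = levels N k u ∪ levels N (k + u.length) v := by
  induction u generalizing k with
  | nil => simp [levels]
  | cons c u ih =>
    simp only [List.cons_append, levels, ih, List.length_cons, Set.union_assoc]
    rw [Nat.add_assoc, Nat.add_comm 1]

theorem crossEdges_bounds {i k : ℕ} {e : DirEdge} (he : e ∈ crossEdges i k) {p : Space}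
    (hp : p ∈ e.seg) : (i : ℝ) ≤ p.1 ∧ p.1 ≤ i + 1 ∧ (k : ℝ) ≤ p.2.1 ∧ p.2.1 ≤ k + 1 ∧
      0 ≤ p.2.2 ∧ p.2.2 ≤ 1 / 2 ∧ (p.2.1 = k → ∃ j : ℕ, p = ((j : ℝ), (k : ℝ), 0)) ∧
      (p.2.1 = k + 1 → ∃ j : ℕ, p = ((j : ℝ), (k : ℝ) + 1, 0)) := by
  rcases he with rfl | rfl | rfl
  · obtain ⟨s, h0, h1, hx, hy, hz⟩ := mem_seg_iff.1 hp
    simp only at hx hy hz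
    refine ⟨by linarith, by linarith, by linarith, by linarith, by linarith, by linarith,
      fun h => ⟨i, ?_⟩, fun h => by linarith⟩
    obtain rfl : s = 0 := by linarith
    exact Prod.ext (by simp [hx]) (Prod.ext (by simp [hy]) (by simp [hz]))
  · obtain ⟨s, h0, h1, hx, hy, hz⟩ := mem_seg_iff.1 hp
    simp only at hx hy hz
    refine ⟨by linarith, by linarith, by linarith, by linarith, by linarith, by linarith,
      fun h => by linarith, fun h => ⟨i + 1, ?_⟩⟩
    obtain rfl : s = 1 := by linarith
    exact Prod.ext (by simp [hx]) (Prod.ext (by simp [hy]) (by simp [hz]))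
  · obtain ⟨s, h0, h1, hx, hy, hz⟩ := mem_seg_iff.1 hp
    simp only at hx hy hz
    refine ⟨by linarith, by linarith, by linarith, by linarith, by linarith, by linarith,
      fun h => ⟨i + 1, ?_⟩, fun h => ⟨i, ?_⟩⟩
    · obtain rfl : s = 0 := by linarith
      exact Prod.ext (by simp [hx]) (Prod.ext (by simp [hy]) (by simp [hz]))
    · obtain rfl : s = 1 := by linarith
      exact Prod.ext (by simp [hx]) (Prod.ext (by simp [hy]) (by simp [hz]))

theorem straightEdge_bounds {j k : ℕ} {p : Space} (hp : p ∈ (straightEdge j k).seg) :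
    p.1 = j ∧ (k : ℝ) ≤ p.2.1 ∧ p.2.1 ≤ k + 1 ∧ p.2.2 = 0 := by
  obtain ⟨s, h0, h1, hx, hy, hz⟩ := mem_seg_iff.1 hp
  simp only at hx hy hz
  refine ⟨by linarith, by linarith, by linarith, by linarith⟩

theorem lev_bounds {N : ℕ} {c : Set ℕ} {k : ℕ} {e : DirEdge} (he : e ∈ lev N c k) {p : Space}
    (hp : p ∈ e.seg) : (k : ℝ) ≤ p.2.1 ∧ p.2.1 ≤ k + 1 ∧
      0 ≤ p.2.2 ∧ p.2.2 ≤ 1 / 2 ∧ (p.2.1 = k → ∃ j : ℕ, p = ((j : ℝ), (k : ℝ), 0)) ∧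
      (p.2.1 = k + 1 → ∃ j : ℕ, p = ((j : ℝ), (k : ℝ) + 1, 0)) := by
  rcases he with ⟨i, -, he⟩ | ⟨j, -, -, -, -, rfl⟩
  · exact (crossEdges_bounds he hp).2.2
  · obtain ⟨hx, h1, h2, hz⟩ := straightEdge_bounds hp
    refine ⟨h1, h2, hz.ge, by linarith, fun h => ⟨j, ?_⟩, fun h => ⟨j, ?_⟩⟩ <;>
    exact Prod.ext hx (Prod.ext h hz)

theorem levels_bounds {N : ℕ} {w : List (Set ℕ)} {k : ℕ} {e : DirEdge} (he : e ∈ levels N k w)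
    {p : Space} (hp : p ∈ e.seg) : (k : ℝ) ≤ p.2.1 ∧ p.2.1 ≤ k + w.length ∧
      0 ≤ p.2.2 ∧ p.2.2 ≤ 1 / 2 ∧ (p.2.1 = k → ∃ j : ℕ, p = ((j : ℝ), (k : ℝ), 0)) ∧
      (p.2.1 = k + w.length → ∃ j : ℕ, p = ((j : ℝ), (k : ℝ) + w.length, 0)) := by
  induction w generalizing k with
  | nil => exact absurd he (Set.notMem_empty e)
  | cons c w ih =>
    have hw : (0 : ℝ) ≤ w.length := Nat.cast_nonneg _
    simp only [List.length_cons, Nat.cast_add, Nat.cast_one]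
    rcases he with he | he
    · obtain ⟨h1, h2, h3, h4, h5, h6⟩ := lev_bounds he hp
      refine ⟨h1, by linarith, h3, h4, h5, fun h => ?_⟩
      have h0 : (w.length : ℝ) = 0 := by linarith
      simpa [h0] using h6 (by linarith)
    · obtain ⟨h1, h2, h3, h4, h5, h6⟩ := ih he
      push_cast at h1 h2 h6
      refine ⟨by linarith, by linarith, h3, h4, fun h => by linarith, fun h => ?_⟩
      obtain ⟨j, hj⟩ := h6 (by linarith)
      exact ⟨j, by rw [hj, add_assoc, add_comm (1 : ℝ)]⟩

theorem levOff_bounds {N : ℕ} {c : Set ℕ} {lo hi k : ℕ} {e : DirEdge}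
    (he : e ∈ levOff N c lo hi k) {p : Space} (hp : p ∈ e.seg) :
    p.1 + 1 ≤ lo ∨ (hi : ℝ) + 1 ≤ p.1 := by
  rcases he with ⟨i, -, h, he⟩ | ⟨j, -, -, h, -, -, rfl⟩
  · obtain ⟨h1, h2, -⟩ := crossEdges_bounds he hp
    rcases h with h | h
    · left
      have : (i : ℝ) + 1 + 1 ≤ lo := by exact_mod_cast h
      linarith
    · right
      have : (hi : ℝ) + 1 ≤ i := by exact_mod_cast h
      linarith
  · obtain ⟨h1, -⟩ := straightEdge_bounds hp
    rw [h1]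
    exact_mod_cast h

/-- The closing strands run behind the braid, except for their end points. -/
theorem closing_front {N m : ℕ} {e : DirEdge} (he : e ∈ closingEdges N m)
    {p : Space} (hp : p ∈ e.seg) (hz : 0 ≤ p.2.2) :
    ∃ j : ℕ, p = ((j : ℝ), (m : ℝ), 0) ∨ p = ((j : ℝ), 0, 0) := by
  obtain ⟨j, -, -, rfl | rfl | rfl⟩ := he <;>
    obtain ⟨s, h0, h1, hx, hy, hz'⟩ := mem_seg_iff.1 hp <;> simp only at hx hy hz'
  · obtain rfl : s = 0 := by linarith
    exact ⟨j, Or.inl (Prod.ext (by simp [hx]) (Prod.ext (by simp [hy]) (by simp [hz'])))⟩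
  · linarith
  · obtain rfl : s = 1 := by linarith
    exact ⟨j, Or.inr (Prod.ext (by simp [hx]) (Prod.ext (by simp [hy]) (by simp [hz'])))⟩

theorem lev_insert {N i k : ℕ} {c : Set ℕ} (h1 : 1 ≤ i) (hN : i < N)
    (hc : ∀ j ∈ c, j + 1 < i ∨ i + 1 < j) :
    lev N (insert i c) k = levOff N c i (i + 1) k ∪ crossEdges i k := by
  ext e
  constructor
  · rintro (⟨j, rfl | hj, he⟩ | ⟨j, hj1, hj2, hj3, hj4, rfl⟩)
    · exact Or.inr he
    · exact Or.inl (Or.inl ⟨j, hj, hc j hj, he⟩)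
    · refine Or.inl (Or.inr ⟨j, hj1, hj2, ?_, fun h => hj3 (Or.inr h),
        fun i' hi' => hj4 i' (Or.inr hi'), rfl⟩)
      have := hj4 i (Or.inl rfl)
      have : j ≠ i := fun h => hj3 (Or.inl h)
      omega
  · rintro ((⟨j, hj, -, he⟩ | ⟨j, hj1, hj2, hj, hj3, hj4, rfl⟩) | he)
    · exact Or.inl ⟨j, Or.inr hj, he⟩
    · refine Or.inr ⟨j, hj1, hj2, ?_, ?_, rfl⟩
      · rintro (rfl | h)
        · omega
        · exact hj3 h
      · rintro i' (rfl | h)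
        · omega
        · exact hj4 i' h
    · exact Or.inl ⟨i, Or.inl rfl, he⟩

theorem lev_straight {N i k : ℕ} {c : Set ℕ} (h1 : 1 ≤ i) (hN : i < N)
    (hc : ∀ j ∈ c, j + 1 < i ∨ i + 1 < j) :
    lev N c k = levOff N c i (i + 1) k ∪ {straightEdge i k, straightEdge (i + 1) k} := by
  ext e
  constructor
  · rintro (⟨j, hj, he⟩ | ⟨j, hj1, hj2, hj3, hj4, rfl⟩)
    · exact Or.inl (Or.inl ⟨j, hj, hc j hj, he⟩)
    · by_cases h : j = i
      · subst h; exact Or.inr (Or.inl rfl)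
      by_cases h' : j = i + 1
      · subst h'; exact Or.inr (Or.inr rfl)
      · exact Or.inl (Or.inr ⟨j, hj1, hj2, by omega, hj3, hj4, rfl⟩)
  · rintro ((⟨j, hj, -, he⟩ | ⟨j, hj1, hj2, hj, hj3, hj4, rfl⟩) | rfl | rfl)
    · exact Or.inl ⟨j, hj, he⟩
    · exact Or.inr ⟨j, hj1, hj2, hj3, hj4, rfl⟩
    · refine Or.inr ⟨i, h1, hN.le, ?_, ?_, rfl⟩
      · intro h; have := hc i h; omega
      · intro j hj; have := hc j hj; omega
    · refine Or.inr ⟨i + 1, by omega, hN, ?_, ?_, rfl⟩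
      · intro h; have := hc _ h; omega
      · intro j hj; have := hc j hj; omega

theorem lev_cross_left {N i k : ℕ} (h1 : 1 ≤ i) (hN : i + 1 < N) :
    lev N {i} k = levOff N ∅ i (i + 2) k ∪ (crossEdges i k ∪ {straightEdge (i + 2) k}) := by
  ext e
  constructor
  · rintro (⟨j, rfl, he⟩ | ⟨j, hj1, hj2, hj3, hj4, rfl⟩)
    · exact Or.inr (Or.inl he)
    · by_cases h : j = i + 2
      · subst h; exact Or.inr (Or.inr rfl)
      · have := hj4 i rfl
        have : j ≠ i := hj3
        exact Or.inl (Or.inr ⟨j, hj1, hj2, by omega, by simp, by simp, rfl⟩)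
  · rintro ((⟨j, hj, -, he⟩ | ⟨j, hj1, hj2, hj, -, -, rfl⟩) | he | rfl)
    · exact absurd hj (Set.notMem_empty j)
    · exact Or.inr ⟨j, hj1, hj2, show j ≠ i by omega, by rintro _ rfl; omega, rfl⟩
    · exact Or.inl ⟨i, rfl, he⟩
    · exact Or.inr ⟨i + 2, by omega, by omega, show i + 2 ≠ i by omega, by rintro _ rfl; omega, rfl⟩

theorem lev_cross_right {N i k : ℕ} (h1 : 1 ≤ i) (hN : i + 1 < N) :
    lev N {i + 1} k = levOff N ∅ i (i + 2) k ∪ (crossEdges (i + 1) k ∪ {straightEdge i k}) := by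
  ext e
  constructor
  · rintro (⟨j, rfl, he⟩ | ⟨j, hj1, hj2, hj3, hj4, rfl⟩)
    · exact Or.inr (Or.inl he)
    · by_cases h : j = i
      · subst h; exact Or.inr (Or.inr rfl)
      · have := hj4 (i + 1) rfl
        have : j ≠ i + 1 := hj3
        exact Or.inl (Or.inr ⟨j, hj1, hj2, by omega, by simp, by simp, rfl⟩)
  · rintro ((⟨j, hj, -, he⟩ | ⟨j, hj1, hj2, hj, -, -, rfl⟩) | he | rfl)
    · exact absurd hj (Set.notMem_empty j)
    · exact Or.inr ⟨j, hj1, hj2, show j ≠ i + 1 by omega, by rintro _ rfl; omega, rfl⟩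
    · exact Or.inl ⟨i + 1, rfl, he⟩
    · exact Or.inr ⟨i, by omega, by omega, show i ≠ i + 1 by omega, by rintro _ rfl; omega, rfl⟩

/-! ### Local moves inside of a braid -/

/-- The part of a closure outside of the `h` levels between the words `u` and `v`. -/
def outerPart (N : ℕ) (u v : List (Set ℕ)) (h : ℕ) : Set DirEdge :=
  levels N 0 u ∪ levels N (u.length + h) v ∪ closingEdges N (u.length + h + v.length)

theorem levelClosure_eq_outerPart (N : ℕ) (u w v : List (Set ℕ)) :
    levelClosure N (u ++ w ++ v) = outerPart N u v w.length ∪ levels N u.length w := by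
  simp only [levelClosure, outerPart, levels_append, List.length_append, Nat.zero_add]
  ac_rfl

theorem outerPart_touch {N h : ℕ} {u v : List (Set ℕ)} {e : DirEdge} (he : e ∈ outerPart N u v h)
    {p : Space} (hp : p ∈ e.seg) (h1 : (u.length : ℝ) ≤ p.2.1) (h2 : p.2.1 ≤ u.length + h)
    (hz : 0 ≤ p.2.2) :
    ∃ j : ℕ, p = ((j : ℝ), (u.length : ℝ), 0) ∨ p = ((j : ℝ), (u.length : ℝ) + h, 0) := by
  have hu : (0 : ℝ) ≤ u.length := Nat.cast_nonneg _
  have hv : (0 : ℝ) ≤ v.length := Nat.cast_nonneg _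
  have hh : (0 : ℝ) ≤ h := Nat.cast_nonneg _
  rcases he with (he | he) | he
  · obtain ⟨-, h4, -, -, -, h5⟩ := levels_bounds he hp
    simp only [Nat.cast_zero, zero_add] at h4 h5
    obtain ⟨j, hj⟩ := h5 (by linarith)
    exact ⟨j, Or.inl hj⟩
  · obtain ⟨h4, -, -, -, h5, -⟩ := levels_bounds he hp
    push_cast at h4 h5
    obtain ⟨j, hj⟩ := h5 (by linarith)
    exact ⟨j, Or.inr hj⟩
  · obtain ⟨j, rfl | rfl⟩ := closing_front he hp hz
    · push_cast at h2
      have : (v.length : ℝ) = 0 := by linarith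
      exact ⟨j, Or.inr (by simp [this])⟩
    · have : (u.length : ℝ) = 0 := le_antisymm h1 hu
      exact ⟨j, Or.inl (by simp [this])⟩

/-- In the coordinates of the frame at the place `i` and the first removed level, the edges outside
meet the box over the places `i, …, i + r` only in points of its bottom and top at the places of
the strands. -/
theorem outerPart_frame {N i r h : ℕ} {u v : List (Set ℕ)} {e : DirEdge}
    (he : e ∈ outerPart N u v h) {q : Space}
    (hq : frame ((i : ℝ), (u.length : ℝ), 0) (1 / 2, 0) (0, 1 / 2) q ∈ e.seg)
    (hx0 : 0 ≤ q.1) (hx : q.1 ≤ 2 * r) (hy0 : 0 ≤ q.2.1) (hy : q.2.1 ≤ 2 * h) (hz : 0 ≤ q.2.2) :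
    ∃ s : ℕ, s ≤ r ∧ (q = (2 * (s : ℝ), 0, 0) ∨ q = (2 * (s : ℝ), 2 * (h : ℝ), 0)) := by
  have hj := outerPart_touch he hq (by simp only [frame_apply]; linarith)
    (by simp only [frame_apply]; linarith) (by simp only [frame_apply]; linarith)
  simp only [frame_apply, Prod.mk.injEq] at hj
  obtain ⟨j, hj⟩ := hj
  have hxj : (j : ℝ) = i + q.1 / 2 := by rcases hj with h | h <;> linarith [h.1]
  have a1 : (i : ℝ) ≤ j := by linarith
  have a2 : (j : ℝ) ≤ i + r := by linarith
  norm_cast at a1 a2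
  obtain ⟨s, rfl⟩ := Nat.exists_eq_add_of_le a1
  push_cast at hxj
  refine ⟨s, by omega, ?_⟩
  rcases hj with ⟨-, h1, h2⟩ | ⟨-, h1, h2⟩
  · exact Or.inl (Prod.ext (by linarith) (Prod.ext (by linarith) (by linarith)))
  · exact Or.inr (Prod.ext (by linarith) (Prod.ext (by linarith) (by linarith)))

/-- A crossing may be moved down into a level where its two strands go straight up. -/
theorem condIso_slide {N i : ℕ} {c d : Set ℕ} (u v : List (Set ℕ)) (h1 : 1 ≤ i) (hN : i < N)
    (hc : ∀ j ∈ c, j + 1 < i ∨ i + 1 < j) (hd : ∀ j ∈ d, j + 1 < i ∨ i + 1 < j) :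
    CondIso (levelClosure N (u ++ [c, insert i d] ++ v))
      (levelClosure N (u ++ [insert i c, d] ++ v)) := by
  set φ := frame ((i : ℝ), (u.length : ℝ), 0) (1 / 2, 0) (0, 1 / 2)
  set S := outerPart N u v 2 ∪ levOff N c i (i + 1) u.length ∪ levOff N d i (i + 1) (u.length + 1)
  have hS : Outside φ
      [((-1, 0, 0), 0), ((1, 0, 0), 2), ((0, -1, 0), 0), ((0, 1, 0), 4), ((0, 0, -1), 0)]
      [(0, 0, 0), (2, 0, 0), (0, 4, 0), (2, 4, 0)] S := by
    intro f hf q hq hK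
    simp only [List.mem_cons, List.not_mem_nil, or_false, forall_eq_or_imp, forall_eq,
      functional_apply, IntPoint.toSpace, exists_eq_or_imp, exists_eq_left] at hK ⊢
    norm_num at hK ⊢
    have hoff : ∀ {x k}, f ∈ levOff N x i (i + 1) k → False := by
      intro x k hf
      have := levOff_bounds hf hq
      simp only [φ, frame_apply] at this
      push_cast at this
      rcases this with h | h <;> linarith
    rcases hf with (hf | hf) | hf
    · obtain ⟨s, hs, hq⟩ := outerPart_frame (r := 1) hf hq (by linarith) (by push_cast; linarith)
        (by linarith) (by push_cast; linarith) (by linarith)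
      interval_cases s <;> norm_num at hq <;> tauto
    · exact (hoff hf).elim
    · exact (hoff hf).elim
  have key := Transforms.condIso (frame_injective (by norm_num)) hS transforms_slide
  convert key using 1
  · rw [levelClosure_eq_outerPart]
    simp only [levels, lev_insert h1 hN hd, lev_straight h1 hN hc, List.length_cons,
      List.length_nil, S]
    rw [show tangle φ [((0, 0, 0), (0, 2, 0)), ((2, 0, 0), (2, 2, 0)),
        ((0, 2, 0), (1, 3, 1)), ((1, 3, 1), (2, 4, 0)), ((2, 2, 0), (0, 4, 0))] =
        {straightEdge i u.length, straightEdge (i + 1) u.length} ∪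
          crossEdges i (u.length + 1) from ?_]
    · simp only [Set.union_empty]
      ac_rfl
    · ext e
      simp only [tangle, List.mem_cons, List.not_mem_nil, or_false, exists_eq_or_imp,
        exists_eq_left, IntEdge.map, IntPoint.toSpace, φ, frame_apply, straightEdge, crossEdges,
        Set.mem_union, Set.mem_insert_iff, Set.mem_singleton_iff, Set.mem_ofPred_eq]
      norm_num
      ring_nf
      tauto
  · rw [levelClosure_eq_outerPart]
    simp only [levels, lev_insert h1 hN hc, lev_straight h1 hN hd, List.length_cons,
      List.length_nil, S]
    rw [show tangle φ [((0, 0, 0), (1, 1, 1)), ((1, 1, 1), (2, 2, 0)), ((2, 0, 0), (0, 2, 0)),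
        ((0, 2, 0), (0, 4, 0)), ((2, 2, 0), (2, 4, 0))] =
        crossEdges i u.length ∪ {straightEdge i (u.length + 1),
          straightEdge (i + 1) (u.length + 1)} from ?_]
    · simp only [Set.union_empty]
      ac_rfl
    · ext e
      simp only [tangle, List.mem_cons, List.not_mem_nil, or_false, exists_eq_or_imp,
        exists_eq_left, IntEdge.map, IntPoint.toSpace, φ, frame_apply, straightEdge, crossEdges,
        Set.mem_union, Set.mem_insert_iff, Set.mem_singleton_iff, Set.mem_ofPred_eq]
      norm_num
      ring_nf
      tauto

/-- The braid relation for two adjacent crossings. -/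
theorem condIso_braid {N i : ℕ} (u v : List (Set ℕ)) (h1 : 1 ≤ i) (hN : i + 1 < N) :
    CondIso (levelClosure N (u ++ [{i}, {i + 1}, {i}] ++ v))
      (levelClosure N (u ++ [{i + 1}, {i}, {i + 1}] ++ v)) := by
  set φ := frame ((i : ℝ), (u.length : ℝ), 0) (1 / 2, 0) (0, 1 / 2)
  set S := outerPart N u v 3 ∪ levOff N ∅ i (i + 2) u.length ∪
    levOff N ∅ i (i + 2) (u.length + 1) ∪ levOff N ∅ i (i + 2) (u.length + 1 + 1)
  have hS : Outside φ
      [((-1, 0, 0), 0), ((1, 0, 0), 4), ((0, -1, 0), 0), ((0, 1, 0), 6), ((0, 0, -1), 0)]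
      [(0, 0, 0), (2, 0, 0), (4, 0, 0), (0, 6, 0), (2, 6, 0), (4, 6, 0)] S := by
    intro f hf q hq hK
    simp only [List.mem_cons, List.not_mem_nil, or_false, forall_eq_or_imp, forall_eq,
      functional_apply, IntPoint.toSpace, exists_eq_or_imp, exists_eq_left] at hK ⊢
    norm_num at hK ⊢
    have hoff : ∀ {x k}, f ∈ levOff N x i (i + 2) k → False := by
      intro x k hf
      have := levOff_bounds hf hq
      simp only [φ, frame_apply] at this
      push_cast at this
      rcases this with h | h <;> linarith
    rcases hf with ((hf | hf) | hf) | hf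
    · obtain ⟨s, hs, hq⟩ := outerPart_frame (r := 2) hf hq (by linarith) (by push_cast; linarith)
        (by linarith) (by push_cast; linarith) (by linarith)
      interval_cases s <;> norm_num at hq <;> tauto
    · exact (hoff hf).elim
    · exact (hoff hf).elim
    · exact (hoff hf).elim
  have key := Transforms.condIso (frame_injective (by norm_num)) hS transforms_braid
  convert key using 1
  · rw [levelClosure_eq_outerPart]
    simp only [levels, lev_cross_left h1 hN, lev_cross_right h1 hN, List.length_cons,
      List.length_nil, S]
    rw [show tangle φ [((0, 0, 0), (1, 1, 1)), ((1, 1, 1), (2, 2, 0)), ((2, 0, 0), (0, 2, 0)),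
        ((4, 0, 0), (4, 2, 0)),
        ((2, 2, 0), (3, 3, 1)), ((3, 3, 1), (4, 4, 0)), ((4, 2, 0), (2, 4, 0)),
        ((0, 2, 0), (0, 4, 0)),
        ((0, 4, 0), (1, 5, 1)), ((1, 5, 1), (2, 6, 0)), ((2, 4, 0), (0, 6, 0)),
        ((4, 4, 0), (4, 6, 0))] =
        (crossEdges i u.length ∪ {straightEdge (i + 2) u.length}) ∪
        ((crossEdges (i + 1) (u.length + 1) ∪ {straightEdge i (u.length + 1)}) ∪
        (crossEdges i (u.length + 1 + 1) ∪ {straightEdge (i + 2) (u.length + 1 + 1)})) from ?_]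
    · simp only [Set.union_empty]
      ac_rfl
    · ext e
      simp only [tangle, List.mem_cons, List.not_mem_nil, or_false, exists_eq_or_imp,
        exists_eq_left, IntEdge.map, IntPoint.toSpace, φ, frame_apply, straightEdge, crossEdges,
        Set.mem_union, Set.mem_insert_iff, Set.mem_singleton_iff, Set.mem_ofPred_eq]
      norm_num
      ring_nf
      tauto
  · rw [levelClosure_eq_outerPart]
    simp only [levels, lev_cross_left h1 hN, lev_cross_right h1 hN, List.length_cons,
      List.length_nil, S]
    rw [show tangle φ [((2, 0, 0), (3, 1, 1)), ((3, 1, 1), (4, 2, 0)), ((4, 0, 0), (2, 2, 0)),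
        ((0, 0, 0), (0, 2, 0)),
        ((0, 2, 0), (1, 3, 1)), ((1, 3, 1), (2, 4, 0)), ((2, 2, 0), (0, 4, 0)),
        ((4, 2, 0), (4, 4, 0)),
        ((2, 4, 0), (3, 5, 1)), ((3, 5, 1), (4, 6, 0)), ((4, 4, 0), (2, 6, 0)),
        ((0, 4, 0), (0, 6, 0))] =
        (crossEdges (i + 1) u.length ∪ {straightEdge i u.length}) ∪
        ((crossEdges i (u.length + 1) ∪ {straightEdge (i + 2) (u.length + 1)}) ∪
        (crossEdges (i + 1) (u.length + 1 + 1) ∪ {straightEdge i (u.length + 1 + 1)})) from ?_]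
    · simp only [Set.union_empty]
      ac_rfl
    · ext e
      simp only [tangle, List.mem_cons, List.not_mem_nil, or_false, exists_eq_or_imp,
        exists_eq_left, IntEdge.map, IntPoint.toSpace, φ, frame_apply, straightEdge, crossEdges,
        Set.mem_union, Set.mem_insert_iff, Set.mem_singleton_iff, Set.mem_ofPred_eq]
      norm_num
      ring_nf
      tauto

/-! ### Empty levels and destabilization -/

theorem mem_triangle_coord {A B C p : Space} (h : p ∈ convexHull ℝ {A, B, C}) :
    ∃ b c : ℝ, 0 ≤ b ∧ 0 ≤ c ∧ b + c ≤ 1 ∧ p.1 = A.1 + b * (B.1 - A.1) + c * (C.1 - A.1) ∧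
      p.2.1 = A.2.1 + b * (B.2.1 - A.2.1) + c * (C.2.1 - A.2.1) ∧
      p.2.2 = A.2.2 + b * (B.2.2 - A.2.2) + c * (C.2.2 - A.2.2) := by
  obtain ⟨a, b, c, ha, hb, hc, habc, rfl⟩ := mem_triangle h
  obtain rfl : a = 1 - b - c := by linarith
  refine ⟨b, c, hb, hc, by linarith, ?_, ?_, ?_⟩ <;>
  · simp only [Prod.fst_add, Prod.snd_add, Prod.smul_fst, Prod.smul_snd, smul_eq_mul]
    ring

/-- The closing strand at the place `j` of a braid with `m` levels. -/
def closeCol (j m : ℕ) : Set DirEdge :=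
  {(((j : ℝ), (m : ℝ), 0), ((j : ℝ), (m : ℝ) + 1, -1)),
    (((j : ℝ), (m : ℝ) + 1, -1), ((j : ℝ), -1, -1)), (((j : ℝ), -1, -1), ((j : ℝ), 0, 0))}

theorem mem_closingEdges {N m : ℕ} {e : DirEdge} :
    e ∈ closingEdges N m ↔ ∃ j, 1 ≤ j ∧ j ≤ N ∧ e ∈ closeCol j m := Iff.rfl

theorem closeCol_x {j m : ℕ} {e : DirEdge} (he : e ∈ closeCol j m) {p : Space} (hp : p ∈ e.seg) :
    p.1 = j := by
  rcases he with rfl | rfl | rfl <;>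
  · obtain ⟨s, -, -, hx, -, -⟩ := mem_seg_iff.1 hp
    simpa using hx

/-- The last level is straight at the place `j`, and this piece is absorbed by the closing
strand. -/
theorem condIso_absorb_col {S : Set DirEdge} {j m : ℕ}
    (hS : ∀ f ∈ S, ∀ p ∈ f.seg, p.1 = j → 0 ≤ p.2.2 ∧ p.2.1 ≤ m ∧ (p.2.1 = m → p.2.2 = 0)) :
    CondIso (S ∪ ({straightEdge j m} ∪ closeCol j (m + 1))) (S ∪ closeCol j m) := by
  have hm : (0 : ℝ) ≤ m := Nat.cast_nonneg _
  -- The long edge behind the braid is subdivided at its point over `y = m + 1`. Then the two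
  -- corners `(m + 2, -1)` and `(m + 1, 0)` of the `yz`-plane are cut off.
  have h1 : CondIso
      ((S ∪ {straightEdge j m, (((j : ℝ), (m : ℝ) + 1, 0), ((j : ℝ), (m : ℝ) + 2, -1)),
        (((j : ℝ), -1, -1), ((j : ℝ), 0, 0))}) ∪
        {(((j : ℝ), (m : ℝ) + 2, -1), ((j : ℝ), -1, -1))})
      ((S ∪ {straightEdge j m, (((j : ℝ), (m : ℝ) + 1, 0), ((j : ℝ), (m : ℝ) + 2, -1)),
        (((j : ℝ), -1, -1), ((j : ℝ), 0, 0))}) ∪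
        {(((j : ℝ), (m : ℝ) + 2, -1), ((j : ℝ), (m : ℝ) + 1, -1)),
          (((j : ℝ), (m : ℝ) + 1, -1), ((j : ℝ), -1, -1))}) := by
    refine (condIso_triangle ⟨?_, Or.inr ?_⟩ ?_).symm
    · simp only [ne_eq, Prod.mk.injEq, not_and]
      intros
      linarith
    · rw [openSegment_eq_image']
      refine ⟨1 / ((m : ℝ) + 3), ⟨by positivity, ?_⟩, ?_⟩
      · rw [div_lt_one (by positivity)]; linarith
      · refine Prod.ext (by simp) (Prod.ext ?_ (by simp))
        simp only [Prod.snd_add, Prod.fst_add, Prod.smul_snd, Prod.smul_fst, Prod.snd_sub,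
          Prod.fst_sub, smul_eq_mul]
        field_simp
        ring
    · intro f hf p hp hpt
      obtain ⟨b, c, hb, hc, hbc, hx, hy, hz⟩ := mem_triangle_coord hpt
      simp only at hx hy hz
      rcases hf with hf | rfl | rfl | rfl
      · have := hS f hf p hp (by linarith)
        linarith [this.1]
      · have := straightEdge_bounds hp
        linarith [this.2.2.2]
      · left
        obtain ⟨s, h0, h1, hx', hy', hz'⟩ := mem_seg_iff.1 hp
        simp only at hx' hy' hz'
        obtain rfl : s = 1 := by linarith
        exact Prod.ext (by linarith) (Prod.ext (by linarith) (by linarith))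
      · right
        obtain ⟨s, h0, h1, hx', hy', hz'⟩ := mem_seg_iff.1 hp
        simp only at hx' hy' hz'
        obtain rfl : s = 0 := by linarith
        exact Prod.ext (by linarith) (Prod.ext (by linarith) (by linarith))
  have h2 : CondIso
      ((S ∪ {straightEdge j m, (((j : ℝ), (m : ℝ) + 1, -1), ((j : ℝ), -1, -1)),
        (((j : ℝ), -1, -1), ((j : ℝ), 0, 0))}) ∪
        {(((j : ℝ), (m : ℝ) + 1, 0), ((j : ℝ), (m : ℝ) + 2, -1)),
          (((j : ℝ), (m : ℝ) + 2, -1), ((j : ℝ), (m : ℝ) + 1, -1))})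
      ((S ∪ {straightEdge j m, (((j : ℝ), (m : ℝ) + 1, -1), ((j : ℝ), -1, -1)),
        (((j : ℝ), -1, -1), ((j : ℝ), 0, 0))}) ∪
        {(((j : ℝ), (m : ℝ) + 1, 0), ((j : ℝ), (m : ℝ) + 1, -1))}) := by
    refine condIso_triangle ⟨?_, Or.inl (affineIndependent_of_minor ?_)⟩ ?_
    · norm_num
    · norm_num
    · intro f hf p hp hpt
      obtain ⟨b, c, hb, hc, hbc, hx, hy, hz⟩ := mem_triangle_coord hpt
      simp only at hx hy hz
      rcases hf with hf | rfl | rfl | rfl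
      · have := hS f hf p hp (by linarith)
        linarith [this.2.1]
      · left
        obtain ⟨h1, h2, h3, h4⟩ := straightEdge_bounds hp
        have : c = 0 := by linarith
        subst this
        exact Prod.ext (by linarith) (Prod.ext (by linarith) (by linarith))
      · right
        obtain ⟨s, h0, h1, hx', hy', hz'⟩ := mem_seg_iff.1 hp
        simp only at hx' hy' hz'
        have h5 : 0 ≤ s * ((m : ℝ) + 2) := by positivity
        have : c = 0 := by linarith
        subst this
        exact Prod.ext (by linarith) (Prod.ext (by linarith) (by linarith))
      · exfalso
        obtain ⟨s, h0, h1, hx', hy', hz'⟩ := mem_seg_iff.1 hp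
        simp only at hx' hy' hz'
        linarith
  have h3 : CondIso
      ((S ∪ {(((j : ℝ), (m : ℝ) + 1, -1), ((j : ℝ), -1, -1)),
        (((j : ℝ), -1, -1), ((j : ℝ), 0, 0))}) ∪
        {(((j : ℝ), (m : ℝ), 0), ((j : ℝ), (m : ℝ) + 1, 0)),
          (((j : ℝ), (m : ℝ) + 1, 0), ((j : ℝ), (m : ℝ) + 1, -1))})
      ((S ∪ {(((j : ℝ), (m : ℝ) + 1, -1), ((j : ℝ), -1, -1)),
        (((j : ℝ), -1, -1), ((j : ℝ), 0, 0))}) ∪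
        {(((j : ℝ), (m : ℝ), 0), ((j : ℝ), (m : ℝ) + 1, -1))}) := by
    refine condIso_triangle ⟨?_, Or.inl (affineIndependent_of_minor ?_)⟩ ?_
    · norm_num
    · norm_num
    · intro f hf p hp hpt
      obtain ⟨b, c, hb, hc, hbc, hx, hy, hz⟩ := mem_triangle_coord hpt
      simp only at hx hy hz
      rcases hf with hf | rfl | rfl
      · left
        obtain ⟨h1, h2, h3⟩ := hS f hf p hp (by linarith)
        have h4 := h3 (by linarith)
        exact Prod.ext (by linarith) (Prod.ext (by linarith) (by linarith))
      · right
        obtain ⟨s, h0, h1, hx', hy', hz'⟩ := mem_seg_iff.1 hp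
        simp only at hx' hy' hz'
        obtain rfl : b = 1 := by linarith
        obtain rfl : c = 0 := by linarith
        exact Prod.ext (by linarith) (Prod.ext (by linarith) (by linarith))
      · left
        obtain ⟨s, h0, h1, hx', hy', hz'⟩ := mem_seg_iff.1 hp
        simp only at hx' hy' hz'
        obtain rfl : s = 1 := by linarith
        exact Prod.ext (by linarith) (Prod.ext (by linarith) (by linarith))
  have e1 : S ∪ ({straightEdge j m} ∪ closeCol j (m + 1)) =
      (S ∪ {straightEdge j m, (((j : ℝ), (m : ℝ) + 1, 0), ((j : ℝ), (m : ℝ) + 2, -1)),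
        (((j : ℝ), -1, -1), ((j : ℝ), 0, 0))}) ∪
        {(((j : ℝ), (m : ℝ) + 2, -1), ((j : ℝ), -1, -1))} := by
    have : (m : ℝ) + 1 + 1 = m + 2 := by ring
    ext e
    simp only [closeCol, Set.mem_union, Set.mem_insert_iff, Set.mem_singleton_iff, Nat.cast_add,
      Nat.cast_one, this]
    tauto
  rw [e1]
  refine h1.trans ?_
  convert h2.trans ?_ using 1
  · ext e
    simp only [Set.mem_union, Set.mem_insert_iff, Set.mem_singleton_iff]
    tauto
  · convert h3 using 1
    · ext e
      simp only [straightEdge, Set.mem_union, Set.mem_insert_iff, Set.mem_singleton_iff]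
      tauto
    · ext e
      simp only [closeCol, Set.mem_union, Set.mem_insert_iff, Set.mem_singleton_iff]
      tauto

/-- An empty level at the top may be removed. -/
theorem condIso_absorb (N : ℕ) (w : List (Set ℕ)) :
    CondIso (levelClosure N (w ++ [∅])) (levelClosure N w) := by
  -- the closure after the strands at the places `1, …, r` have been treated
  set X : ℕ → Set DirEdge := fun r => levels N 0 w ∪
    {e | ∃ j, 1 ≤ j ∧ j ≤ N ∧ r < j ∧ e ∈ {straightEdge j w.length} ∪ closeCol j (w.length + 1)} ∪
    {e | ∃ j, 1 ≤ j ∧ j ≤ N ∧ j ≤ r ∧ e ∈ closeCol j w.length} with hX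
  have h0 : levelClosure N (w ++ [∅]) = X 0 := by
    ext e
    simp only [levelClosure, levels_append, levels, lev, Nat.zero_add, List.length_append,
      List.length_cons, List.length_nil, Set.mem_union, Set.union_empty, Set.mem_ofPred_eq,
      Set.mem_empty_iff_false, false_and, exists_false, false_or, not_false_iff, true_and,
      IsEmpty.forall_iff, implies_true, mem_closingEdges, hX, Set.mem_singleton_iff]
    constructor
    · rintro ((h | ⟨j, h1, h2, rfl⟩) | ⟨j, h1, h2, h⟩)
      · exact Or.inl (Or.inl h)
      · exact Or.inl (Or.inr ⟨j, h1, h2, h1, Or.inl rfl⟩)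
      · exact Or.inl (Or.inr ⟨j, h1, h2, h1, Or.inr h⟩)
    · rintro ((h | ⟨j, h1, h2, -, h | h⟩) | ⟨j, h1, -, h2, -⟩)
      · exact Or.inl (Or.inl h)
      · exact Or.inl (Or.inr ⟨j, h1, h2, h⟩)
      · exact Or.inr ⟨j, h1, h2, h⟩
      · omega
  have hN : levelClosure N w = X N := by
    ext e
    simp only [levelClosure, Set.mem_union, Set.mem_ofPred_eq, mem_closingEdges, hX]
    constructor
    · rintro (h | ⟨j, h1, h2, h⟩)
      · exact Or.inl (Or.inl h)
      · exact Or.inr ⟨j, h1, h2, h2, h⟩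
    · rintro ((h | ⟨j, -, h2, h3, -⟩) | ⟨j, h1, h2, -, h⟩)
      · exact Or.inl h
      · omega
      · exact Or.inr ⟨j, h1, h2, h⟩
  have step : ∀ r < N, CondIso (X r) (X (r + 1)) := by
    intro r hr
    set S : Set DirEdge := levels N 0 w ∪
      {e | ∃ j, 1 ≤ j ∧ j ≤ N ∧ r + 1 < j ∧
        e ∈ {straightEdge j w.length} ∪ closeCol j (w.length + 1)} ∪
      {e | ∃ j, 1 ≤ j ∧ j ≤ N ∧ j ≤ r ∧ e ∈ closeCol j w.length} with hSdef
    have key := condIso_absorb_col (S := S) (j := r + 1) (m := w.length) (by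
      rintro f ((hf | ⟨j, -, -, hj, hf⟩) | ⟨j, -, -, hj, hf⟩) p hp hpx
      · obtain ⟨-, h2, h3, -, -, h4⟩ := levels_bounds hf hp
        simp only [Nat.cast_zero, zero_add] at h2 h4
        refine ⟨h3, h2, fun h => ?_⟩
        obtain ⟨j, rfl⟩ := h4 h
        rfl
      · exfalso
        have : p.1 = j := by
          rcases hf with rfl | hf
          · exact (straightEdge_bounds hp).1
          · exact closeCol_x hf hp
        rw [this] at hpx
        norm_cast at hpx
        omega
      · exfalso
        rw [closeCol_x hf hp] at hpx
        norm_cast at hpx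
        omega)
    convert key using 1
    · ext e
      simp only [hX, hSdef, Set.mem_union, Set.mem_ofPred_eq]
      constructor
      · rintro ((h | ⟨j, h1, h2, h3, h⟩) | h)
        · exact Or.inl (Or.inl (Or.inl h))
        · by_cases hj : j = r + 1
          · subst hj; exact Or.inr h
          · exact Or.inl (Or.inl (Or.inr ⟨j, h1, h2, by omega, h⟩))
        · exact Or.inl (Or.inr h)
      · rintro (((h | ⟨j, h1, h2, h3, h⟩) | h) | h)
        · exact Or.inl (Or.inl h)
        · exact Or.inl (Or.inr ⟨j, h1, h2, by omega, h⟩)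
        · exact Or.inr h
        · exact Or.inl (Or.inr ⟨r + 1, by omega, by omega, by omega, h⟩)
    · ext e
      simp only [hX, hSdef, Set.mem_union, Set.mem_ofPred_eq]
      constructor
      · rintro ((h | h) | ⟨j, h1, h2, h3, h⟩)
        · exact Or.inl (Or.inl (Or.inl h))
        · exact Or.inl (Or.inl (Or.inr h))
        · by_cases hj : j = r + 1
          · subst hj; exact Or.inr h
          · exact Or.inl (Or.inr ⟨j, h1, h2, by omega, h⟩)
      · rintro (((h | h) | ⟨j, h1, h2, h3, h⟩) | h)
        · exact Or.inl (Or.inl h)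
        · exact Or.inl (Or.inr h)
        · exact Or.inr ⟨j, h1, h2, by omega, h⟩
        · exact Or.inr ⟨r + 1, by omega, by omega, by omega, h⟩
  rw [h0, hN]
  have : ∀ r ≤ N, CondIso (X 0) (X r) := by
    intro r
    induction r with
    | zero => exact fun _ => CondIso.refl _
    | succ r ih => exact fun hr => (ih (by omega)).trans (step r hr)
  exact this N le_rfl

/-- The strand at the place `N + 1` of the levels below `m`, with its first `k` edges merged. -/
def mergedColumn (N m k : ℕ) : Set DirEdge :=
  {((((N : ℝ) + 1), 0, 0), (((N : ℝ) + 1), (k : ℝ), 0))} ∪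
    {e | ∃ l, k ≤ l ∧ l < m ∧ e = straightEdge (N + 1) l}

/-- A straight strand is merged to a single edge. -/
theorem condIso_mergedColumn {S : Set DirEdge} {N m : ℕ} (hm : 1 ≤ m)
    (hS : ∀ f ∈ S, ∀ p ∈ f.seg, p.1 = (N : ℝ) + 1 → p.2.2 = 0 → 0 ≤ p.2.1 → p.2.1 ≤ m →
      p.2.1 = 0 ∨ p.2.1 = m) :
    CondIso (S ∪ mergedColumn N m 1)
      (S ∪ {((((N : ℝ) + 1), 0, 0), (((N : ℝ) + 1), (m : ℝ), 0))}) := by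
  have step : ∀ k, 1 ≤ k → k < m → CondIso (S ∪ mergedColumn N m k)
      (S ∪ mergedColumn N m (k + 1)) := by
    intro k hk hkm
    have hk' : (1 : ℝ) ≤ k := by exact_mod_cast hk
    have hkm' : (k : ℝ) + 1 ≤ m := by exact_mod_cast hkm
    have key := condIso_triangle (A := (((N : ℝ) + 1), 0, 0))
      (B := (((N : ℝ) + 1), (k : ℝ) + 1, 0)) (C := (((N : ℝ) + 1), (k : ℝ), 0))
      (S := S ∪ {e | ∃ l, k + 1 ≤ l ∧ l < m ∧ e = straightEdge (N + 1) l}) ⟨?_, Or.inr ?_⟩ ?_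
    · convert key using 1
      · ext e
        simp only [mergedColumn, Set.mem_union, Set.mem_ofPred_eq, Set.mem_insert_iff,
          Set.mem_singleton_iff]
        have e1 : straightEdge (N + 1) k =
            ((((N : ℝ) + 1), (k : ℝ), 0), (((N : ℝ) + 1), (k : ℝ) + 1, 0)) := by
          simp [straightEdge]
        rw [← e1]
        constructor
        · rintro (h | h | ⟨l, h1, h2, rfl⟩)
          · exact Or.inl (Or.inl h)
          · exact Or.inr (Or.inl h)
          · by_cases hl : l = k
            · subst hl; exact Or.inr (Or.inr rfl)
            · exact Or.inl (Or.inr ⟨l, by omega, h2, rfl⟩)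
        · rintro ((h | ⟨l, h1, h2, rfl⟩) | h | h)
          · exact Or.inl h
          · exact Or.inr (Or.inr ⟨l, by omega, h2, rfl⟩)
          · exact Or.inr (Or.inl h)
          · exact Or.inr (Or.inr ⟨k, le_rfl, hkm, h⟩)
      · ext e
        simp only [mergedColumn, Set.mem_union, Set.mem_ofPred_eq, Set.mem_singleton_iff,
          Nat.cast_add, Nat.cast_one]
        constructor
        · rintro (h | h | h)
          exacts [Or.inl (Or.inl h), Or.inr h, Or.inl (Or.inr h)]
        · rintro ((h | h) | h)
          exacts [Or.inl h, Or.inr (Or.inr h), Or.inr (Or.inl h)]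
    · simp only [ne_eq, Prod.mk.injEq, not_and]
      intros
      linarith
    · rw [openSegment_eq_image']
      refine ⟨(k : ℝ) / (k + 1), ⟨by positivity, ?_⟩, ?_⟩
      · rw [div_lt_one (by positivity)]; linarith
      · refine Prod.ext (by simp) (Prod.ext ?_ (by simp))
        simp only [Prod.snd_add, Prod.fst_add, Prod.smul_snd, Prod.smul_fst, Prod.snd_sub,
          Prod.fst_sub, smul_eq_mul]
        field_simp
        ring
    · intro f hf p hp hpt
      obtain ⟨b, c, hb, hc, hbc, hx, hy, hz⟩ := mem_triangle_coord hpt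
      simp only [sub_self, mul_zero, add_zero, sub_zero, zero_add] at hx hy hz
      have hy0 : 0 ≤ p.2.1 := by rw [hy]; positivity
      have hy1 : p.2.1 ≤ k + 1 := by
        rw [hy]
        have := mul_le_mul_of_nonneg_right hbc (show (0 : ℝ) ≤ k + 1 by positivity)
        linarith
      suffices h : p.2.1 = 0 ∨ p.2.1 = k + 1 by
        rcases h with h | h
        · exact Or.inl (Prod.ext hx (Prod.ext h hz))
        · exact Or.inr (Prod.ext hx (Prod.ext h hz))
      rcases hf with hf | ⟨l, hl, -, rfl⟩
      · rcases hS f hf p hp hx hz hy0 (by linarith) with h | h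
        · exact Or.inl h
        · exact Or.inr (by linarith)
      · obtain ⟨-, h1, -⟩ := straightEdge_bounds hp
        have : (k : ℝ) + 1 ≤ l := by exact_mod_cast hl
        exact Or.inr (by linarith)
  have all : ∀ k, 1 ≤ k → k ≤ m → CondIso (S ∪ mergedColumn N m 1) (S ∪ mergedColumn N m k) := by
    intro k hk
    induction k, hk using Nat.le_induction with
    | base => exact fun _ => CondIso.refl _
    | succ k hk ih => exact fun hkm => (ih (by omega)).trans (step k hk (by omega))
  convert all m hm le_rfl using 2
  ext e
  simp only [mergedColumn, Set.mem_union, Set.mem_ofPred_eq, Set.mem_singleton_iff]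
  constructor
  · exact Or.inl
  · rintro (h | ⟨l, h1, h2, -⟩)
    · exact h
    · omega

/-- The geometric content of the destabilization: a strand which passes once around the axis of
the closure and once through a crossing with the strand at the place `N`, and which lies to the
right of the rest `S` of the link, may be removed. -/
theorem condIso_removeLoop {S : Set DirEdge} {N m : ℕ} (hm : 1 ≤ m)
    (hS : ∀ f ∈ S, ∀ p ∈ f.seg, p.1 ≤ N ∧ (p.1 = N → p.2.2 = 0 → m ≤ p.2.1 →
      p.2.1 = m ∨ p.2.1 = m + 1)) :
    CondIso (S ∪ (mergedColumn N m 1 ∪ crossEdges N m ∪ closeCol (N + 1) (m + 1)))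
      (S ∪ {straightEdge N m}) := by
  have hm' : (1 : ℝ) ≤ m := by exact_mod_cast hm
  -- The straight part of the strand becomes one edge. Then two triangles in the plane `x = N + 1`
  -- shorten the strand to a small loop at the crossing, which `transforms_loop` removes.
  have h1 := condIso_mergedColumn (N := N) (S := S ∪ (crossEdges N m ∪ closeCol (N + 1) (m + 1)))
    hm ?_
  · have h2 := condIso_triangle (A := (((N : ℝ) + 1), -1, -1)) (B := (((N : ℝ) + 1), (m : ℝ), 0))
      (C := (((N : ℝ) + 1), 0, 0))
      (S := S ∪ (crossEdges N m ∪
        {((((N : ℝ) + 1), (m : ℝ) + 1, 0), (((N : ℝ) + 1), (m : ℝ) + 2, -1)),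
          ((((N : ℝ) + 1), (m : ℝ) + 2, -1), (((N : ℝ) + 1), -1, -1))}))
      ⟨?_, Or.inl (affineIndependent_of_minor ?_)⟩ ?_
    · have h3 := condIso_triangle (A := (((N : ℝ) + 1), (m : ℝ) + 2, -1))
        (B := (((N : ℝ) + 1), (m : ℝ), 0)) (C := (((N : ℝ) + 1), -1, -1))
        (S := S ∪ (crossEdges N m ∪
          {((((N : ℝ) + 1), (m : ℝ) + 1, 0), (((N : ℝ) + 1), (m : ℝ) + 2, -1))}))
        ⟨?_, Or.inl (affineIndependent_of_minor ?_)⟩ ?_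
      · set φ := frame ((N : ℝ), (m : ℝ), 0) (1 / 2, 0) (0, 1 / 2)
        have hS' : Outside φ [((-1, 0, 1), 0), ((-1, 0, -1), 0), ((0, -1, 0), 0)]
            [(0, 0, 0), (0, 2, 0)] S := by
          intro f hf q hq hK
          simp only [List.mem_cons, List.not_mem_nil, or_false, forall_eq_or_imp, forall_eq,
            functional_apply, IntPoint.toSpace, exists_eq_or_imp, exists_eq_left] at hK ⊢
          norm_num at hK ⊢
          obtain ⟨a1, a2⟩ := hS f hf _ hq
          simp only [φ, frame_apply] at a1 a2
          have b1 : q.1 = 0 := by linarith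
          have b2 : q.2.2 = 0 := by linarith
          rcases a2 (by linarith) (by linarith) (by linarith) with h | h
          · exact Or.inl (Prod.ext b1 (Prod.ext (by linarith) b2))
          · exact Or.inr (Prod.ext b1 (Prod.ext (by linarith) b2))
        have h4 := Transforms.condIso (frame_injective (by norm_num)) hS' transforms_loop
        convert h1.trans ?_ using 1
        · ext e
          simp only [Set.mem_union]
          tauto
        · convert h2.trans ?_ using 1
          · have : (m : ℝ) + 1 + 1 = m + 2 := by ring
            ext e
            simp only [closeCol, Set.mem_union, Set.mem_insert_iff, Set.mem_singleton_iff,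
              Nat.cast_add, Nat.cast_one, this]
            tauto
          · convert h3.trans ?_ using 1
            · ext e
              simp only [Set.mem_union, Set.mem_insert_iff, Set.mem_singleton_iff]
              tauto
            · convert h4 using 1
              · ext e
                simp only [tangle, List.mem_cons, List.not_mem_nil, or_false, exists_eq_or_imp,
                  exists_eq_left, IntEdge.map, IntPoint.toSpace, frame_apply, crossEdges,
                  Set.mem_union, Set.mem_insert_iff, Set.mem_singleton_iff, Set.mem_ofPred_eq]
                norm_num
                tauto
              · congr 1
                ext e
                simp only [tangle, List.mem_cons, List.not_mem_nil, or_false,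
                  exists_eq_left, IntEdge.map, IntPoint.toSpace, frame_apply, straightEdge,
                  Set.mem_singleton_iff, Set.mem_ofPred_eq]
                norm_num
      · norm_num
      · norm_num
        intro h
        linarith
      · intro f hf p hp hpt
        obtain ⟨b, c, hb, hc, hbc, hx, hy, hz⟩ := mem_triangle_coord hpt
        simp only at hx hy hz
        rcases hf with hf | (rfl | rfl | rfl) | rfl
        · linarith [(hS f hf p hp).1]
        all_goals
          obtain ⟨s, h0, h1, hx', hy', hz'⟩ := mem_seg_iff.1 hp
          simp only at hx' hy' hz'
        · linarith
        · exfalso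
          obtain rfl : s = 1 := by linarith
          have : b = 1 := by linarith
          obtain rfl : c = 0 := by linarith
          subst this
          linarith
        · right
          obtain rfl : s = 0 := by linarith
          exact Prod.ext (by linarith) (Prod.ext (by linarith) (by linarith))
        · left
          have h5 : c * ((m : ℝ) + 3) ≥ 0 := by positivity
          obtain rfl : s = 1 := by linarith
          exact Prod.ext (by linarith) (Prod.ext (by linarith) (by linarith))
    · norm_num
    · norm_num
      omega
    · intro f hf p hp hpt
      obtain ⟨b, c, hb, hc, hbc, hx, hy, hz⟩ := mem_triangle_coord hpt
      simp only at hx hy hz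
      have hym : p.2.1 ≤ m := by
        have : b * ((m : ℝ) + 1) + c * ((m : ℝ) + 1) ≤ 1 * ((m : ℝ) + 1) := by
          rw [← add_mul]
          gcongr
        have : 0 ≤ c * (m : ℝ) := by positivity
        linarith
      rcases hf with hf | (rfl | rfl | rfl) | (rfl | rfl)
      · linarith [(hS f hf p hp).1]
      all_goals
        obtain ⟨s, h0, h1, hx', hy', hz'⟩ := mem_seg_iff.1 hp
        simp only at hx' hy' hz'
      · linarith
      · linarith
      · right
        obtain rfl : s = 0 := by linarith
        exact Prod.ext (by linarith) (Prod.ext (by linarith) (by linarith))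
      · linarith
      · left
        obtain rfl : b = 0 := by linarith
        obtain rfl : c = 0 := by linarith
        exact Prod.ext (by linarith) (Prod.ext (by linarith) (by linarith))
  · rintro f (hf | hf | hf) p hp hx hz hy0 hym
    · linarith [(hS f hf p hp).1]
    · obtain ⟨-, -, h, -⟩ := crossEdges_bounds hf hp
      exact Or.inr (le_antisymm hym h)
    · left
      rcases hf with rfl | rfl | rfl <;>
      · obtain ⟨s, h0, h1, hx', hy', hz'⟩ := mem_seg_iff.1 hp
        push_cast at hx' hy' hz'
        linarith

theorem levels_x_le {N : ℕ} {w : List (Set ℕ)} (hw : ∀ c ∈ w, ∀ i ∈ c, i < N) {k : ℕ}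
    {e : DirEdge} (he : e ∈ levels N k w) {p : Space} (hp : p ∈ e.seg) : p.1 ≤ N := by
  induction w generalizing k with
  | nil => exact absurd he (Set.notMem_empty e)
  | cons c w ih =>
    rcases he with (⟨i, hi, he⟩ | ⟨j, -, hj, -, -, rfl⟩) | he
    · obtain ⟨-, h, -⟩ := crossEdges_bounds he hp
      have : (i : ℝ) + 1 ≤ N := by exact_mod_cast hw c (by simp) i hi
      linarith
    · rw [(straightEdge_bounds hp).1]
      exact_mod_cast hj
    · exact ih (fun d hd => hw d (by simp [hd])) he

/-- The levels of a braid on `N` strands, with one more strand to the right. -/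
theorem levels_succ {N : ℕ} {w : List (Set ℕ)} (hw : ∀ c ∈ w, ∀ i ∈ c, i < N) (k : ℕ) :
    levels (N + 1) k w = levels N k w ∪
      {e | ∃ l, k ≤ l ∧ l < k + w.length ∧ e = straightEdge (N + 1) l} := by
  induction w generalizing k with
  | nil =>
    ext e
    simp only [levels, List.length_nil, Set.mem_union, Set.mem_empty_iff_false, Set.mem_ofPred_eq,
      false_or, false_iff, not_exists, not_and]
    intros
    omega
  | cons c w ih =>
    have hc : lev (N + 1) c k = lev N c k ∪ {straightEdge (N + 1) k} := by
      have hcw := hw c (by simp)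
      ext e
      constructor
      · rintro (h | ⟨j, h1, h2, h3, h4, rfl⟩)
        · exact Or.inl (Or.inl h)
        · by_cases hj : j = N + 1
          · subst hj; exact Or.inr rfl
          · exact Or.inl (Or.inr ⟨j, h1, by omega, h3, h4, rfl⟩)
      · rintro ((h | ⟨j, h1, h2, h3, h4, rfl⟩) | rfl)
        · exact Or.inl h
        · exact Or.inr ⟨j, h1, by omega, h3, h4, rfl⟩
        · refine Or.inr ⟨N + 1, by omega, le_rfl, ?_, ?_, rfl⟩
          · intro h; have := hcw _ h; omega
          · intro i hi; have := hcw i hi; omega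
    simp only [levels, hc, ih (fun d hd => hw d (by simp [hd])), List.length_cons]
    ext e
    simp only [Set.mem_union, Set.mem_singleton_iff, Set.mem_ofPred_eq]
    constructor
    · rintro ((h | h) | h | ⟨l, h1, h2, h⟩)
      · exact Or.inl (Or.inl h)
      · exact Or.inr ⟨k, le_rfl, by omega, h⟩
      · exact Or.inl (Or.inr h)
      · exact Or.inr ⟨l, by omega, by omega, h⟩
    · rintro ((h | h) | ⟨l, h1, h2, h⟩)
      · exact Or.inl (Or.inl h)
      · exact Or.inr (Or.inl h)
      · by_cases hl : l = k
        · subst hl; exact Or.inl (Or.inr h)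
        · exact Or.inr (Or.inr ⟨l, by omega, by omega, h⟩)

/-- Destabilization: a last strand which takes part in one crossing only may be removed. -/
theorem condIso_destabilize {N : ℕ} {w : List (Set ℕ)} (hN : 1 ≤ N) (hw0 : w ≠ [])
    (hw : ∀ c ∈ w, ∀ i ∈ c, i < N) :
    CondIso (levelClosure (N + 1) (w ++ [{N}])) (levelClosure N (w ++ [∅])) := by
  have hm : 1 ≤ w.length := List.length_pos_iff.2 hw0
  set m := w.length with hmdef
  set S : Set DirEdge := levels N 0 w ∪ {e | ∃ j, 1 ≤ j ∧ j < N ∧ e = straightEdge j m} ∪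
    closingEdges N (m + 1) with hSdef
  have key := condIso_removeLoop (S := S) (N := N) hm ?_
  · convert key using 1
    · simp only [levelClosure, levels_append, levels, List.length_append, List.length_cons,
        List.length_nil, Nat.zero_add, levels_succ hw, ← hmdef, Set.union_empty]
      ext e
      simp only [hSdef, Set.mem_union, mem_closingEdges, lev, mergedColumn, Set.mem_ofPred_eq,
        Set.mem_singleton_iff, exists_eq_left, forall_eq]
      have e1 : straightEdge (N + 1) 0 =
          ((((N : ℝ) + 1), 0, 0), (((N : ℝ) + 1), ((1 : ℕ) : ℝ), 0)) := by
        simp [straightEdge]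
      rw [← e1]
      constructor
      · rintro (((h | ⟨l, h1, h2, h⟩) | h | ⟨j, h1, h2, h3, h4, h⟩) | ⟨j, h1, h2, h⟩)
        · exact Or.inl (Or.inl (Or.inl h))
        · rcases Nat.eq_zero_or_pos l with rfl | hl
          · exact Or.inr (Or.inl (Or.inl (Or.inl h)))
          · exact Or.inr (Or.inl (Or.inl (Or.inr ⟨l, hl, h2, h⟩)))
        · exact Or.inr (Or.inl (Or.inr h))
        · exact Or.inl (Or.inl (Or.inr ⟨j, h1, by omega, h⟩))
        · by_cases hj : j = N + 1
          · subst hj; exact Or.inr (Or.inr h)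
          · exact Or.inl (Or.inr ⟨j, h1, by omega, h⟩)
      · rintro (((h | ⟨j, h1, h2, h⟩) | ⟨j, h1, h2, h⟩) | ((h | ⟨l, h1, h2, h⟩) | h) | h)
        · exact Or.inl (Or.inl (Or.inl h))
        · exact Or.inl (Or.inr (Or.inr ⟨j, h1, by omega, by omega, by omega, h⟩))
        · exact Or.inr ⟨j, h1, by omega, h⟩
        · exact Or.inl (Or.inl (Or.inr ⟨0, le_rfl, hm, h⟩))
        · exact Or.inl (Or.inl (Or.inr ⟨l, by omega, h2, h⟩))
        · exact Or.inl (Or.inr (Or.inl h))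
        · exact Or.inr ⟨N + 1, by omega, le_rfl, h⟩
    · simp only [levelClosure, levels_append, levels, List.length_append, List.length_cons,
        List.length_nil, Nat.zero_add, ← hmdef, Set.union_empty]
      ext e
      simp only [hSdef, Set.mem_union, lev, Set.mem_ofPred_eq, Set.mem_empty_iff_false, false_and,
        exists_false, false_or, not_false_iff, true_and, IsEmpty.forall_iff, implies_true,
        Set.mem_singleton_iff]
      constructor
      · rintro ((h | ⟨j, h1, h2, h⟩) | h)
        · exact Or.inl (Or.inl (Or.inl h))
        · by_cases hj : j = N
          · subst hj; exact Or.inr h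
          · exact Or.inl (Or.inl (Or.inr ⟨j, h1, by omega, h⟩))
        · exact Or.inl (Or.inr h)
      · rintro (((h | ⟨j, h1, h2, h⟩) | h) | h)
        · exact Or.inl (Or.inl h)
        · exact Or.inl (Or.inr ⟨j, h1, by omega, h⟩)
        · exact Or.inr h
        · exact Or.inl (Or.inr ⟨N, hN, le_rfl, h⟩)
  · rintro f ((hf | ⟨j, -, hj, rfl⟩) | hf) p hp
    · refine ⟨levels_x_le hw hf hp, fun _ _ h => Or.inl ?_⟩
      have := (levels_bounds hf hp).2.1
      simp only [Nat.cast_zero, zero_add] at this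
      exact le_antisymm this h
    · have hx := (straightEdge_bounds hp).1
      have : (j : ℝ) + 1 ≤ N := by exact_mod_cast hj
      exact ⟨by linarith, fun h => by linarith⟩
    · obtain ⟨j, -, hj, he⟩ := mem_closingEdges.1 hf
      refine ⟨by rw [closeCol_x he hp]; exact_mod_cast hj, fun _ hz h => ?_⟩
      obtain ⟨j, rfl | rfl⟩ := closing_front hf hp hz.ge
      · right; push_cast; rfl
      · left
        exact le_antisymm (Nat.cast_nonneg m) h

/-! ### Moving a crossing around the axis -/

/-- Two parallel strands at the places `i`, `i + 1`, from `A` to `B` in the direction of the other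
two coordinates. -/
def band (i : ℕ) (A B : ℝ × ℝ) : Set DirEdge :=
  {(((i : ℝ), A), ((i : ℝ), B)), (((i : ℝ) + 1, A), ((i : ℝ) + 1, B))}

/-- The band `band i A B` with a crossing; the strand which goes to the right is bent at a point
over `μ`. -/
def twist (i : ℕ) (A B μ : ℝ × ℝ) : Set DirEdge :=
  {(((i : ℝ), A), ((i : ℝ) + 1 / 2, μ)), (((i : ℝ) + 1 / 2, μ), ((i : ℝ) + 1, B)),
    (((i : ℝ) + 1, A), ((i : ℝ), B))}

theorem band_bounds {i : ℕ} {A B : ℝ × ℝ} {e : DirEdge} (he : e ∈ band i A B) {p : Space}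
    (hp : p ∈ e.seg) : (p.1 = i ∨ p.1 = i + 1) ∧ ∃ r : ℝ, 0 ≤ r ∧ r ≤ 1 ∧
      p.2.1 = A.1 + r * (B.1 - A.1) ∧ p.2.2 = A.2 + r * (B.2 - A.2) := by
  rcases he with rfl | rfl <;>
  · obtain ⟨r, h0, h1, hx, hy, hz⟩ := mem_seg_iff.1 hp
    simp only [sub_self, mul_zero, add_zero] at hx
    exact ⟨by tauto, r, h0, h1, hy, hz⟩

/-- A crossing of two strands of the closure is moved around the corner at `B`, with edges in the
directions `u` and `v`. The hypothesis `hS` says that the rest of the link meets the region swept by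
the move only in the four end points of the strands; there `(s, t)` are the coordinates with respect
to `B` and the basis `u / 2`, `v / 2`. -/
theorem condIso_corner {S : Set DirEdge} {i : ℕ} {A B C μ ν : ℝ × ℝ} (u v : ℝ × ℝ)
    (hA : A = (B.1 - u.1, B.2 - u.2)) (hC : C = (B.1 + v.1, B.2 + v.2))
    (hμ : μ = (B.1 - v.1 / 2, B.2 - v.2 / 2)) (hν : ν = (B.1 + u.1 / 2, B.2 + u.2 / 2))
    (huv : u.1 * v.2 - u.2 * v.1 ≠ 0)
    (hS : ∀ f ∈ S, ∀ p ∈ f.seg, (i : ℝ) ≤ p.1 → p.1 ≤ i + 1 → ∀ s t : ℝ,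
      p.2.1 = B.1 + s * (u.1 / 2) + t * (v.1 / 2) → p.2.2 = B.2 + s * (u.2 / 2) + t * (v.2 / 2) →
      -s + t ≤ 2 → -s - 2 * t ≤ 2 → s - t ≤ 1 → 2 * s + t ≤ 2 →
      (p.1 = i ∨ p.1 = i + 1) ∧ (s = -2 ∧ t = 0 ∨ s = 0 ∧ t = 2)) :
    CondIso (S ∪ (twist i A B μ ∪ band i B C)) (S ∪ (band i A B ∪ twist i B C ν)) := by
  subst hA hC hμ hν
  set φ := frame ((i : ℝ), B) (u.1 / 2, u.2 / 2) (v.1 / 2, v.2 / 2)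
  have hS' : Outside φ [((-1, 0, 0), 0), ((1, 0, 0), 2), ((0, -1, 1), 2), ((0, -1, -2), 2),
        ((0, 1, -1), 1), ((0, 2, 1), 2)]
      [(0, -2, 0), (2, -2, 0), (0, 0, 2), (2, 0, 2)] S := by
    intro f hf q hq hK
    simp only [List.mem_cons, List.not_mem_nil, or_false, forall_eq_or_imp, forall_eq,
      functional_apply, IntPoint.toSpace, exists_eq_or_imp, exists_eq_left] at hK ⊢
    norm_num at hK ⊢
    obtain ⟨k1, k2, k3, k4, k5, k6⟩ := hK
    have := hS f hf _ hq (by simp only [φ, frame_apply]; linarith)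
      (by simp only [φ, frame_apply]; linarith) q.2.1 q.2.2 rfl rfl (by linarith) (by linarith)
      (by linarith) (by linarith)
    simp only [φ, frame_apply] at this
    have hx : q.1 = 0 ∨ q.1 = 2 := by
      rcases this.1 with h | h
      · left; linarith
      · right; linarith
    simp only [Prod.ext_iff]
    tauto
  have key := Transforms.condIso (frame_injective (by
    simp only
    intro h
    apply huv
    linear_combination 4 * h)) hS' transforms_corner
  convert key using 2 <;>
  · ext e
    simp only [tangle, List.mem_cons, List.not_mem_nil, or_false, exists_eq_or_imp,
      exists_eq_left, IntEdge.map, IntPoint.toSpace, frame_apply, band, twist,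
      Set.mem_union, Set.mem_insert_iff, Set.mem_singleton_iff, Set.mem_ofPred_eq]
    norm_num
    ring_nf
    tauto

/-- The bend of the front strand of a crossing may be chosen freely on one side of a line
`α y + β z = c` with the link on its other side. -/
theorem condIso_bend {S : Set DirEdge} {i : ℕ} {A B μ ν : ℝ × ℝ} (α β c : ℝ)
    (hA : α * A.1 + β * A.2 = c) (hB : α * B.1 + β * B.2 = c) (hμ : c < α * μ.1 + β * μ.2)
    (hν : c < α * ν.1 + β * ν.2) (hμν : μ ≠ ν)
    (hS : ∀ f ∈ S, ∀ p ∈ f.seg, (i : ℝ) ≤ p.1 → p.1 ≤ i + 1 → α * p.2.1 + β * p.2.2 ≤ c) :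
    CondIso (S ∪ twist i A B μ) (S ∪ twist i A B ν) := by
  have hμν' : μ.1 ≠ ν.1 ∨ μ.2 ≠ ν.2 := by
    by_contra! h
    exact hμν (Prod.ext h.1 h.2)
  have hback : ∀ p ∈ DirEdge.seg (((i : ℝ) + 1, A), ((i : ℝ), B)),
      α * p.2.1 + β * p.2.2 ≤ c := by
    intro p hp
    obtain ⟨s, h0, h1, -, hy, hz⟩ := mem_seg_iff.1 hp
    rw [hy, hz]
    simp only
    apply le_of_eq
    linear_combination (1 - s) * hA + s * hB
  have h1 := condIso_triangle (A := ((i : ℝ) + 1 / 2, μ)) (B := ((i : ℝ) + 1, B))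
    (C := ((i : ℝ) + 1 / 2, ν))
    (S := S ∪ {(((i : ℝ), A), ((i : ℝ) + 1 / 2, μ)), (((i : ℝ) + 1, A), ((i : ℝ), B))})
    ⟨?_, Or.inl (affineIndependent_of_minor ?_)⟩ ?_
  · have h2 := condIso_triangle (A := ((i : ℝ), A)) (B := ((i : ℝ) + 1 / 2, ν))
      (C := ((i : ℝ) + 1 / 2, μ))
      (S := S ∪ {(((i : ℝ) + 1 / 2, ν), ((i : ℝ) + 1, B)), (((i : ℝ) + 1, A), ((i : ℝ), B))})
      ⟨?_, Or.inl (affineIndependent_of_minor ?_)⟩ ?_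
    · convert h1.symm.trans ?_ using 1
      · ext e
        simp only [twist, Set.mem_union, Set.mem_insert_iff, Set.mem_singleton_iff]
        tauto
      · convert h2 using 1
        · ext e
          simp only [Set.mem_union, Set.mem_insert_iff, Set.mem_singleton_iff]
          tauto
        · ext e
          simp only [twist, Set.mem_union, Set.mem_insert_iff, Set.mem_singleton_iff]
          tauto
    · simp
    · simp only
      norm_num
      by_contra! h
      rcases hμν' with h' | h'
      · exact h' (by linarith [h.1])
      · exact h' (by linarith [h.2.1])
    · intro f hf p hp hpt
      obtain ⟨b, d, hb, hd, hbd, hx, -, -⟩ := mem_triangle_coord hpt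
      simp only at hx
      have hle : (α * p.2.1 + β * p.2.2 ≤ c) → p = ((i : ℝ), A) ∨ p = ((i : ℝ) + 1 / 2, ν) :=
        fun h => touch_of_face (g := functional 0 (-α) (-β)) (m := -c)
          (by simp only [functional_apply]; linarith) (by simp only [functional_apply]; linarith)
          (Or.inr (by simp only [functional_apply]; linarith))
          (by simp only [functional_apply]; linarith) hpt
          (by simp only [functional_apply]; linarith)
      rcases hf with hf | rfl | rfl
      · exact hle (hS f hf p hp (by linarith) (by linarith))
      · right
        refine touch_of_initial (g := functional 1 0 0) ?_ hp ?_
        · simp only [functional_apply]; linarith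
        · simp only [functional_apply]; linarith
      · exact hle (hback p hp)
  · simp
  · simp only
    norm_num
    by_contra! h
    rcases hμν' with h' | h'
    · exact h' (by linarith [h.1])
    · exact h' (by linarith [h.2.1])
  · intro f hf p hp hpt
    obtain ⟨b, d, hb, hd, hbd, hx, -, -⟩ := mem_triangle_coord hpt
    simp only at hx
    have hle : (α * p.2.1 + β * p.2.2 ≤ c) →
        p = ((i : ℝ) + 1 / 2, μ) ∨ p = ((i : ℝ) + 1, B) :=
      fun h => touch_of_face (g := functional 0 (-α) (-β)) (m := -c)
        (by simp only [functional_apply]; linarith) (by simp only [functional_apply]; linarith)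
        (Or.inl (by simp only [functional_apply]; linarith))
        (by simp only [functional_apply]; linarith) hpt
        (by simp only [functional_apply]; linarith)
    rcases hf with hf | rfl | rfl
    · exact hle (hS f hf p hp (by linarith) (by linarith))
    · left
      refine touch_of_initial (g := functional (-1) 0 0) (E := ((i : ℝ), A)) ?_
        (segment_symm ℝ ((i : ℝ), A) _ ▸ hp) ?_
      · simp only [functional_apply]; linarith
      · simp only [functional_apply]; linarith
    · exact hle (hback p hp)

/-- A crossing at the places `i`, `i + 1` is moved from the level `n - 1` around the axis to the
level `0`; here `S` is the rest of the link, and at these two places the levels `0` and `n - 1` are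
empty apart from the crossing. The axis is surrounded in four corners. Between them the bend
of the crossing is brought to the position required for the next corner. -/
theorem condIso_around {S : Set DirEdge} {i : ℕ} {n : ℝ} (hn : 2 ≤ n)
    (hS : ∀ f ∈ S, ∀ p ∈ f.seg, (i : ℝ) ≤ p.1 → p.1 ≤ i + 1 →
      1 ≤ p.2.1 ∧ p.2.1 ≤ n - 1 ∧ 0 ≤ p.2.2 ∧ p.2.2 ≤ 1 / 2 ∧
      (p.2.1 = 1 ∨ p.2.1 = n - 1 → p.1 = i ∨ p.1 = i + 1)) :
    CondIso
      (S ∪ (twist i (n - 1, 0) (n, 0) (n - 1 / 2, 1 / 2) ∪ band i (n, 0) (n + 1, -1) ∪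
        band i (n + 1, -1) (-1, -1) ∪ band i (-1, -1) (0, 0) ∪ band i (0, 0) (1, 0)))
      (S ∪ (band i (n - 1, 0) (n, 0) ∪ band i (n, 0) (n + 1, -1) ∪
        band i (n + 1, -1) (-1, -1) ∪ band i (-1, -1) (0, 0) ∪
        twist i (0, 0) (1, 0) (1 / 2, 1 / 2))) := by
  have c1 := condIso_corner (i := i) (A := (n - 1, 0)) (B := (n, 0)) (C := (n + 1, -1))
    (μ := (n - 1 / 2, 1 / 2)) (ν := (n + 1 / 2, 0)) (1, 0) (1, -1)
    (by ext <;> ring) (by ext <;> ring)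
    (by ext <;> ring) (by ext <;> ring)
    (S := S ∪ band i (n + 1, -1) (-1, -1) ∪ band i (-1, -1) (0, 0) ∪ band i (0, 0) (1, 0))
    (by norm_num) (by
      intro f hf p hp hx hx' s t hy hz k1 k2 k3 k4
      simp only at hy hz
      rcases hf with ((hf | hf) | hf) | hf
      · obtain ⟨a1, a2, a3, a4, a5⟩ := hS f hf p hp hx hx'
        have ht : t = 0 := by linarith
        have hs : s = -2 := by linarith
        exact ⟨a5 (Or.inr (by linarith)), Or.inl ⟨hs, ht⟩⟩
      all_goals
        obtain ⟨b1, r, b2, b3, b4, b5⟩ := band_bounds hf hp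
        simp only at b4 b5
        refine ⟨b1, ?_⟩
      · right
        constructor <;> linarith
      · exfalso; linarith
      · left
        constructor <;> linarith)
  have m1 := condIso_bend (i := i) (A := (n, 0)) (B := (n + 1, -1)) (μ := (n + 1 / 2, 0))
    (ν := (n + 1 + (n + 2) / 2, -1)) 1 1 n (by simp) (by simp) (by simp)
    (by simp only; linarith) (by simp)
    (S := S ∪ band i (n - 1, 0) (n, 0) ∪ band i (n + 1, -1) (-1, -1) ∪ band i (-1, -1) (0, 0) ∪
      band i (0, 0) (1, 0)) (by
      intro f hf p hp hx hx'
      rcases hf with (((hf | hf) | hf) | hf) | hf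
      · obtain ⟨a1, a2, a3, a4, a5⟩ := hS f hf p hp hx hx'
        linarith
      all_goals
        obtain ⟨b1, r, b2, b3, b4, b5⟩ := band_bounds hf hp
        simp only at b4 b5
      · linarith
      · have : 0 ≤ r * (n + 2) := by positivity
        linarith
      · linarith
      · linarith)
  have c2 := condIso_corner (i := i) (A := (n, 0)) (B := (n + 1, -1)) (C := (-1, -1))
    (μ := (n + 1 + (n + 2) / 2, -1)) (ν := (n + 1 + 1 / 2, -1 - 1 / 2)) (1, -1) (-(n + 2), 0)
    (by ext <;> ring) (by ext <;> ring)
    (by ext <;> ring) (by ext <;> ring)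
    (S := S ∪ band i (n - 1, 0) (n, 0) ∪ band i (-1, -1) (0, 0) ∪ band i (0, 0) (1, 0))
    (by simp only; intro h; linarith) (by
      intro f hf p hp hx hx' s t hy hz k1 k2 k3 k4
      simp only at hy hz
      rcases hf with ((hf | hf) | hf) | hf
      · obtain ⟨a1, a2, a3, a4, a5⟩ := hS f hf p hp hx hx'
        obtain rfl : s = -2 := by linarith
        obtain rfl : t = 0 := by linarith
        linarith
      all_goals
        obtain ⟨b1, r, b2, b3, b4, b5⟩ := band_bounds hf hp
        simp only at b4 b5
        refine ⟨b1, ?_⟩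
      · left
        constructor <;> linarith
      · right
        have e1 : t * (n + 2) ≤ (2 + s) * (n + 2) :=
          mul_le_mul_of_nonneg_right (by linarith) (by linarith)
        obtain rfl : s = -2 * r := by linarith
        have e2 : 2 * r ≤ r * n := by nlinarith
        obtain rfl : r = 0 := by linarith
        refine ⟨by ring, ?_⟩
        have : (t - 2) * (n + 2) = 0 := by linarith
        rcases mul_eq_zero.1 this with h | h <;> linarith
      · exfalso
        obtain rfl : s = -2 := by linarith
        obtain rfl : t = 0 := by linarith
        linarith)
  have m2 := condIso_bend (i := i) (A := (n + 1, -1)) (B := (-1, -1))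
    (μ := (n + 1 + 1 / 2, -1 - 1 / 2)) (ν := (-1 - 1 / 2, -1 - 1 / 2)) 0 (-1) 1
    (by simp) (by simp) (by norm_num) (by norm_num)
    (by simp only [ne_eq, Prod.mk.injEq, not_and]; intro h; linarith)
    (S := S ∪ band i (n - 1, 0) (n, 0) ∪ band i (n, 0) (n + 1, -1) ∪ band i (-1, -1) (0, 0) ∪
      band i (0, 0) (1, 0)) (by
      intro f hf p hp hx hx'
      rcases hf with (((hf | hf) | hf) | hf) | hf
      · obtain ⟨a1, a2, a3, a4, a5⟩ := hS f hf p hp hx hx'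
        linarith
      all_goals
        obtain ⟨b1, r, b2, b3, b4, b5⟩ := band_bounds hf hp
        simp only at b4 b5
        linarith)
  have c3 := condIso_corner (i := i) (A := (n + 1, -1)) (B := (-1, -1)) (C := (0, 0))
    (μ := (-1 - 1 / 2, -1 - 1 / 2)) (ν := (-1 - (n + 2) / 2, -1)) (-(n + 2), 0) (1, 1)
    (by ext <;> ring) (by ext <;> ring)
    (by ext <;> ring) (by ext <;> ring)
    (S := S ∪ band i (n - 1, 0) (n, 0) ∪ band i (n, 0) (n + 1, -1) ∪ band i (0, 0) (1, 0))
    (by simp only; intro h; linarith) (by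
      intro f hf p hp hx hx' s t hy hz k1 k2 k3 k4
      simp only at hy hz
      rcases hf with ((hf | hf) | hf) | hf
      · obtain ⟨a1, a2, a3, a4, a5⟩ := hS f hf p hp hx hx'
        obtain rfl : s = 0 := by linarith
        obtain rfl : t = 2 := by linarith
        linarith
      all_goals
        obtain ⟨b1, r, b2, b3, b4, b5⟩ := band_bounds hf hp
        simp only at b4 b5
        refine ⟨b1, ?_⟩
      · exfalso
        obtain rfl : s = 0 := by linarith
        obtain rfl : t = 2 := by linarith
        linarith
      · left
        obtain rfl : t = 2 - 2 * r := by linarith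
        have e1 : (-2 * r) * (n + 2) ≤ s * (n + 2) :=
          mul_le_mul_of_nonneg_right (by linarith) (by linarith)
        have e2 : (1 - r) * n ≤ 0 := by linarith
        have e3 : 0 ≤ (1 - r) * (n - 2) := mul_nonneg (by linarith) (by linarith)
        obtain rfl : r = 1 := by linarith
        refine ⟨?_, by ring⟩
        have : (s + 2) * (n + 2) = 0 := by linarith
        rcases mul_eq_zero.1 this with h | h <;> linarith
      · right
        constructor <;> linarith)
  have m3 := condIso_bend (i := i) (A := (-1, -1)) (B := (0, 0))
    (μ := (-1 - (n + 2) / 2, -1)) (ν := (-1 / 2, 0)) (-1) 1 0 (by simp) (by simp)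
    (by simp only; linarith) (by norm_num) (by simp)
    (S := S ∪ band i (n - 1, 0) (n, 0) ∪ band i (n, 0) (n + 1, -1) ∪
      band i (n + 1, -1) (-1, -1) ∪ band i (0, 0) (1, 0)) (by
      intro f hf p hp hx hx'
      rcases hf with (((hf | hf) | hf) | hf) | hf
      · obtain ⟨a1, a2, a3, a4, a5⟩ := hS f hf p hp hx hx'
        linarith
      all_goals
        obtain ⟨b1, r, b2, b3, b4, b5⟩ := band_bounds hf hp
        simp only at b4 b5
      · linarith
      · linarith
      · have : 0 ≤ (1 - r) * (n + 2) := mul_nonneg (by linarith) (by linarith)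
        linarith
      · linarith)
  have c4 := condIso_corner (i := i) (A := (-1, -1)) (B := (0, 0)) (C := (1, 0))
    (μ := (-1 / 2, 0)) (ν := (1 / 2, 1 / 2)) (1, 1) (1, 0)
    (by ext <;> ring) (by ext <;> ring)
    (by ext <;> ring) (by ext <;> ring)
    (S := S ∪ band i (n - 1, 0) (n, 0) ∪ band i (n, 0) (n + 1, -1) ∪ band i (n + 1, -1) (-1, -1))
    (by norm_num) (by
      intro f hf p hp hx hx' s t hy hz k1 k2 k3 k4
      simp only at hy hz
      rcases hf with ((hf | hf) | hf) | hf
      · obtain ⟨a1, a2, a3, a4, a5⟩ := hS f hf p hp hx hx'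
        have hs : s = 0 := by linarith
        have ht : t = 2 := by linarith
        exact ⟨a5 (Or.inl (by linarith)), Or.inr ⟨hs, ht⟩⟩
      all_goals
        obtain ⟨b1, r, b2, b3, b4, b5⟩ := band_bounds hf hp
        simp only at b4 b5
        refine ⟨b1, ?_⟩
      · right
        constructor <;> linarith
      · exfalso; linarith
      · left
        constructor <;> linarith)
  have h1 := (c1.trans_eq (by ac_rfl) m1).trans_eq (by ac_rfl) c2
  have h2 := (h1.trans_eq (by ac_rfl) m2).trans_eq (by ac_rfl) c3
  have h3 := (h2.trans_eq (by ac_rfl) m3).trans_eq (by ac_rfl) c4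
  convert h3 using 1 <;> ac_rfl

theorem crossEdges_eq_twist (i k : ℕ) : crossEdges i k =
    twist i ((k : ℝ), 0) ((k : ℝ) + 1, 0) ((k : ℝ) + 1 / 2, 1 / 2) := rfl

theorem straightEdge_pair (i k : ℕ) : ({straightEdge i k, straightEdge (i + 1) k} : Set DirEdge) =
    band i ((k : ℝ), 0) ((k : ℝ) + 1, 0) := by
  simp [straightEdge, band]

/-- The closing strands outside of the places `i`, `i + 1`. -/
def closeOff (N i m : ℕ) : Set DirEdge :=
  {e | ∃ j, 1 ≤ j ∧ j ≤ N ∧ j ≠ i ∧ j ≠ i + 1 ∧ e ∈ closeCol j m}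

theorem closingEdges_eq_band {N i m : ℕ} (h1 : 1 ≤ i) (hN : i < N) : closingEdges N m =
    closeOff N i m ∪ (band i ((m : ℝ), 0) ((m : ℝ) + 1, -1) ∪
      band i ((m : ℝ) + 1, -1) (-1, -1) ∪ band i (-1, -1) (0, 0)) := by
  ext e
  have key : e ∈ band i ((m : ℝ), 0) ((m : ℝ) + 1, -1) ∪ band i ((m : ℝ) + 1, -1) (-1, -1) ∪
      band i (-1, -1) (0, 0) ↔ e ∈ closeCol i m ∨ e ∈ closeCol (i + 1) m := by
    simp only [band, closeCol, Set.mem_union, Set.mem_insert_iff, Set.mem_singleton_iff,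
      Nat.cast_add, Nat.cast_one]
    tauto
  rw [Set.mem_union, key, mem_closingEdges]
  constructor
  · rintro ⟨j, hj1, hj2, h⟩
    by_cases hi : j = i
    · subst hi; exact Or.inr (Or.inl h)
    by_cases hi' : j = i + 1
    · subst hi'; exact Or.inr (Or.inr h)
    · exact Or.inl ⟨j, hj1, hj2, hi, hi', h⟩
  · rintro (⟨j, hj1, hj2, -, -, h⟩ | h | h)
    · exact ⟨j, hj1, hj2, h⟩
    · exact ⟨i, h1, hN.le, h⟩
    · exact ⟨i + 1, by omega, hN, h⟩

/-- A crossing at the top may be moved to the bottom. -/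
theorem condIso_rotate {N i : ℕ} (w : List (Set ℕ)) (h1 : 1 ≤ i) (hN : i < N) :
    CondIso (levelClosure N (∅ :: (w ++ [{i}]))) (levelClosure N ({i} :: (w ++ [∅]))) := by
  set S : Set DirEdge := levels N 1 w ∪ levOff N ∅ i (i + 1) 0 ∪
    levOff N ∅ i (i + 1) (w.length + 1) ∪ closeOff N i (w.length + 2) with hSdef
  have hw : (0 : ℝ) ≤ w.length := Nat.cast_nonneg _
  have key := condIso_around (S := S) (i := i) (n := (w.length : ℝ) + 2) (by linarith) (by
    intro f hf p hp hx hx'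
    rcases hf with ((hf | hf) | hf) | hf
    · obtain ⟨a1, a2, a3, a4, a5, a6⟩ := levels_bounds hf hp
      push_cast at a1 a2 a5 a6
      refine ⟨a1, by linarith, a3, a4, fun h => ?_⟩
      have : ∃ j : ℕ, p.1 = j := by
        rcases h with h | h
        · obtain ⟨j, hj⟩ := a5 h
          exact ⟨j, by rw [hj]⟩
        · obtain ⟨j, hj⟩ := a6 (by linarith)
          exact ⟨j, by rw [hj]⟩
      obtain ⟨j, hj⟩ := this
      rw [hj] at hx hx' ⊢
      norm_cast at hx hx' ⊢
      omega
    · exfalso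
      have := levOff_bounds hf hp
      push_cast at this
      rcases this with h | h <;> linarith
    · exfalso
      have := levOff_bounds hf hp
      push_cast at this
      rcases this with h | h <;> linarith
    · exfalso
      obtain ⟨j, -, -, h3, h4, hf⟩ := hf
      rw [closeCol_x hf hp] at hx hx'
      norm_cast at hx hx'
      omega)
  have hs : ∀ k, lev N {i} k = levOff N ∅ i (i + 1) k ∪ crossEdges i k := fun k => by
    rw [← lev_insert h1 hN (by simp), insert_empty_eq]
  have he : ∀ k, lev N ∅ k = levOff N ∅ i (i + 1) k ∪
      {straightEdge i k, straightEdge (i + 1) k} := fun k => lev_straight h1 hN (by simp)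
  have a1 : (w.length : ℝ) + 2 - 1 = w.length + 1 := by ring
  have a2 : (w.length : ℝ) + 2 - 1 / 2 = w.length + 1 + 1 / 2 := by ring
  have a3 : (w.length : ℝ) + 1 + 1 = w.length + 2 := by ring
  rw [a1, a2] at key
  convert key using 1
  all_goals
    simp only [levelClosure, levels, levels_append, List.length_cons, List.length_append,
      List.length_nil, hs, he, crossEdges_eq_twist, straightEdge_pair, Nat.zero_add,
      closingEdges_eq_band h1 hN, hSdef, Set.union_empty, Nat.add_assoc, Nat.add_comm 1,
      Nat.reduceAdd]
    push_cast
    simp only [a3, zero_add]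
    ext e
    simp only [Set.mem_union]
    tauto

/-! ### Words in positive letters -/

/-- The closure of the positive word `σ_{i₁} σ_{i₂} ⋯` on `N` strands, given by its indices. -/
def wordClosure (N : ℕ) (u : List ℕ) : Set DirEdge := levelClosure N (u.map fun i => {i})

/-- The indices of the word are those of generators of the braid group on `N` strands. -/
def IsWord (N : ℕ) (u : List ℕ) : Prop := ∀ i ∈ u, 1 ≤ i ∧ i < N

theorem isWord_append {N : ℕ} {u v : List ℕ} : IsWord N (u ++ v) ↔ IsWord N u ∧ IsWord N v :=
  List.forall_mem_append

theorem isWord_cons {N i : ℕ} {u : List ℕ} : IsWord N (i :: u) ↔ (1 ≤ i ∧ i < N) ∧ IsWord N u :=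
  List.forall_mem_cons

theorem levelEdges_eq_lev {N : ℕ} {l : BraidLetter N} (hl : l.positive = true) (k : ℕ) :
    l.levelEdges k = lev N {l.idx} k := by
  ext e
  simp only [BraidLetter.levelEdges, lev, crossEdges, BraidLetter.mid, BraidLetter.height, hl,
    if_true, Set.mem_union, Set.mem_ofPred_eq, Set.mem_singleton_iff, exists_eq_left, forall_eq,
    straightEdge]

theorem levels_map_idx {N : ℕ} (w : List (BraidLetter N)) (hw : ∀ l ∈ w, l.positive = true)
    (k₀ : ℕ) :
    {e | ∃ (k : ℕ) (l : BraidLetter N), w[k]? = some l ∧ e ∈ l.levelEdges (k₀ + k)} =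
      levels N k₀ ((w.map BraidLetter.idx).map fun i => {i}) := by
  induction w generalizing k₀ with
  | nil => simp [levels]
  | cons l w ih =>
    simp only [List.map_cons, levels, ← ih (fun l' h => hw l' (by simp [h])) (k₀ + 1),
      ← levelEdges_eq_lev (hw l (by simp))]
    ext e
    simp only [Set.mem_union, Set.mem_ofPred_eq]
    constructor
    · rintro ⟨k, l', h, he⟩
      rcases k with _ | k
      · simp only [List.getElem?_cons_zero, Option.some.injEq] at h
        subst h
        exact Or.inl he
      · exact Or.inr ⟨k, l', by simpa using h, by rwa [Nat.add_assoc, Nat.add_comm 1]⟩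
    · rintro (he | ⟨k, l', h, he⟩)
      · exact ⟨0, l, by simp, he⟩
      · exact ⟨k + 1, l', by simpa using h, by rwa [Nat.add_assoc, Nat.add_comm 1] at he⟩

theorem closureEdges_eq_wordClosure {N : ℕ} (w : BraidWord N)
    (hw : ∀ l ∈ w.toList, l.positive = true) :
    closureEdges w = wordClosure N (w.toList.map BraidLetter.idx) := by
  simp only [closureEdges, wordClosure, levelClosure, List.length_map]
  rw [← levels_map_idx w.toList hw 0]
  simp only [Nat.zero_add]

theorem IsWord.isLink {N : ℕ} {u : List ℕ} (hu : IsWord N u) : IsLink (wordClosure N u) := by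
  refine ⟨braidClosure (FreeMonoid.ofList (u.attach.map fun i =>
    (⟨i.1, (hu i.1 i.2).1, (hu i.1 i.2).2, true⟩ : BraidLetter N))), ?_⟩
  refine (closureEdges_eq_wordClosure _ ?_).trans ?_
  · intro l hl
    rw [FreeMonoid.toList_ofList] at hl
    obtain ⟨i, -, rfl⟩ := List.mem_map.1 hl
    rfl
  · rw [FreeMonoid.toList_ofList, List.map_map]
    exact congrArg _ (List.attach_map_subtype_val u)

theorem condIso_comm {N i j : ℕ} (a b : List ℕ) (hi : 1 ≤ i) (hij : i + 2 ≤ j) (hj : j < N) :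
    CondIso (wordClosure N (a ++ [i, j] ++ b)) (wordClosure N (a ++ [j, i] ++ b)) := by
  have h1 := condIso_slide (c := {i}) (d := ∅) (a.map fun i => {i}) (b.map fun i => {i})
    (show 1 ≤ j by omega) hj (by simp only [Set.mem_singleton_iff, forall_eq]; omega) (by simp)
  have h2 := condIso_slide (c := {j}) (d := ∅) (a.map fun i => {i}) (b.map fun i => {i})
    hi (show i < N by omega) (by simp only [Set.mem_singleton_iff, forall_eq]; omega) (by simp)
  rw [Set.pair_comm i j] at h2
  simpa [wordClosure] using h1.trans h2.symm

theorem condIso_braid_word {N i : ℕ} (a b : List ℕ) (hi : 1 ≤ i) (hN : i + 1 < N) :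
    CondIso (wordClosure N (a ++ [i, i + 1, i] ++ b))
      (wordClosure N (a ++ [i + 1, i, i + 1] ++ b)) := by
  simpa [wordClosure] using condIso_braid (a.map fun i => {i}) (b.map fun i => {i}) hi hN

/-- An empty level may be moved through a word. -/
theorem condIso_move_empty {N : ℕ} (a : List (Set ℕ)) {u : List ℕ} (hu : IsWord N u) :
    CondIso (levelClosure N (a ++ [∅] ++ u.map fun i => {i}))
      (levelClosure N (a ++ (u.map fun i => {i}) ++ [∅])) := by
  induction u generalizing a with
  | nil => simpa using CondIso.refl _
  | cons i u ih =>
    obtain ⟨⟨h1, hN⟩, hu⟩ := isWord_cons.1 hu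
    have h := condIso_slide (c := ∅) (d := ∅) a (u.map fun i => {i}) h1 hN (by simp) (by simp)
    have h' := ih (a ++ [{i}]) hu
    simp only [insert_empty_eq, List.append_assoc, List.cons_append, List.nil_append] at h h'
    simpa using h.trans h'

theorem condIso_cons_empty {N : ℕ} {u : List ℕ} (hu : IsWord N u) :
    CondIso (levelClosure N (∅ :: u.map fun i => {i})) (wordClosure N u) := by
  have h := condIso_move_empty [] hu
  simp only [List.nil_append, List.cons_append] at h
  exact h.trans (condIso_absorb N _)

/-- Closures of conjugate words are isotopic. -/
theorem iso_rotate {N : ℕ} {u v : List ℕ} (h : IsWord N (u ++ v)) :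
    Iso (wordClosure N (u ++ v)) (wordClosure N (v ++ u)) := by
  induction u generalizing v with
  | nil => simpa using Iso.refl h.isLink
  | cons i u ih =>
    obtain ⟨⟨h1, hN⟩, huv⟩ := isWord_cons.1 h
    have hiu : IsWord N ((u ++ v) ++ [i]) :=
      isWord_append.2 ⟨huv, isWord_cons.2 ⟨⟨h1, hN⟩, by simp [IsWord]⟩⟩
    have hr := condIso_rotate ((u ++ v).map fun i => {i}) h1 hN
    have h2 := condIso_cons_empty hiu
    have h3 := condIso_absorb N ((i :: (u ++ v)).map fun i => {i})
    have h4 : CondIso (wordClosure N ((u ++ v) ++ [i])) (wordClosure N (i :: (u ++ v))) := by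
      refine CondIso.trans h2.symm (CondIso.trans ?_ h3)
      simpa using hr
    have h5 := ih (v := v ++ [i]) (by simpa using hiu)
    have h6 := (h4.symm (Or.inr hiu.isLink)).trans (by simpa using h5)
    simpa using h6

/-- The closure does not change when a last strand with one crossing is added. -/
theorem iso_destabilize {N : ℕ} (hN : 1 ≤ N) {u : List ℕ} (hu : IsWord N u) :
    Iso (wordClosure (N + 1) (u ++ [N])) (wordClosure N u) := by
  have hu' : IsWord (N + 1) (u ++ [N]) := by
    refine isWord_append.2
      ⟨fun i hi => ?_, isWord_cons.2 ⟨⟨hN, Nat.lt_succ_self N⟩, by simp [IsWord]⟩⟩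
    have := hu i hi
    omega
  have h1 := condIso_cons_empty hu'
  have h2 := condIso_destabilize (w := ∅ :: u.map fun i => {i}) hN (by simp) (by
    intro c hc i hi
    rcases List.mem_cons.1 hc with rfl | hc
    · exact absurd hi (Set.notMem_empty i)
    · obtain ⟨j, hj, rfl⟩ := List.mem_map.1 hc
      obtain rfl : i = j := hi
      exact (hu i hj).2)
  have h3 := (condIso_absorb N (∅ :: u.map fun i => {i})).trans (condIso_cons_empty hu)
  refine (h1.symm.trans (CondIso.trans ?_ (h2.trans h3))) (Or.inl hu'.isLink)
  simpa using CondIso.refl _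

/-! ### The monoid of positive braids -/

/-- The defining relations of the monoid of positive braids with any number of strands. -/
inductive BraidRel : FreeMonoid ℕ → FreeMonoid ℕ → Prop
  | comm {i j : ℕ} (h : i + 2 ≤ j) :
      BraidRel (FreeMonoid.ofList [i, j]) (FreeMonoid.ofList [j, i])
  | braid (i : ℕ) :
      BraidRel (FreeMonoid.ofList [i, i + 1, i]) (FreeMonoid.ofList [i + 1, i, i + 1])

/-- The monoid of positive braids with any number of strands. -/
abbrev PosBraid : Type := PresentedMonoid BraidRel

namespace PosBraid

/-- The positive braid given by a list of indices of generators. -/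
def ofWord (u : List ℕ) : PosBraid := PresentedMonoid.mk BraidRel (FreeMonoid.ofList u)

/-- The generator `σ_i`. -/
def σ (i : ℕ) : PosBraid := PresentedMonoid.of BraidRel i

theorem ofWord_nil : ofWord [] = 1 := rfl

theorem ofWord_append (u v : List ℕ) : ofWord (u ++ v) = ofWord u * ofWord v := rfl

theorem ofWord_cons (i : ℕ) (u : List ℕ) : ofWord (i :: u) = σ i * ofWord u := rfl

theorem σ_comm {i j : ℕ} (h : i + 2 ≤ j) : σ i * σ j = σ j * σ i :=
  PresentedMonoid.mk_eq_mk_of_rel (BraidRel.comm h)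

theorem σ_braid (i : ℕ) : σ i * σ (i + 1) * σ i = σ (i + 1) * σ i * σ (i + 1) :=
  PresentedMonoid.mk_eq_mk_of_rel (BraidRel.braid i)

/-- Positive words that represent the same element of the monoid use the same generators, and
their closures are isotopic. This remains true inside longer words. -/
theorem iso_of_rel {u v : List ℕ} (h : ConGen.Rel BraidRel (FreeMonoid.ofList u)
    (FreeMonoid.ofList v)) :
    (∀ N, IsWord N u ↔ IsWord N v) ∧ ∀ N a b, IsWord N (a ++ u ++ b) →
      Iso (wordClosure N (a ++ u ++ b)) (wordClosure N (a ++ v ++ b)) := by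
  suffices H : ∀ x y : FreeMonoid ℕ, ConGen.Rel BraidRel x y →
      (∀ N, IsWord N x.toList ↔ IsWord N y.toList) ∧
      ∀ N a b, IsWord N (a ++ x.toList ++ b) →
        Iso (wordClosure N (a ++ x.toList ++ b)) (wordClosure N (a ++ y.toList ++ b)) from
    H _ _ h
  intro x y h
  induction h with
  | of x y h =>
    cases h with
    | comm hij =>
      rename_i i j
      simp only [FreeMonoid.toList_ofList]
      refine ⟨fun N => ?_, fun N a b h => condIso_comm a b ?_ hij ?_ (Or.inl h.isLink)⟩
      · simp only [isWord_cons]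
        tauto
      · exact (h i (by simp)).1
      · exact (h j (by simp)).2
    | braid i =>
      simp only [FreeMonoid.toList_ofList]
      refine ⟨fun N => ?_, fun N a b h => condIso_braid_word a b ?_ ?_ (Or.inl h.isLink)⟩
      · simp only [isWord_cons]
        tauto
      · exact (h i (by simp)).1
      · exact (h (i + 1) (by simp)).2
  | refl x => exact ⟨fun _ => Iff.rfl, fun N a b h => Iso.refl h.isLink⟩
  | symm _ ih =>
    refine ⟨fun N => (ih.1 N).symm, fun N a b h => (ih.2 N a b ?_).symm⟩
    simpa only [isWord_append, ih.1 N] using h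
  | trans _ _ ih ih' =>
    refine ⟨fun N => (ih.1 N).trans (ih'.1 N), fun N a b h =>
      (ih.2 N a b h).trans (ih'.2 N a b ?_)⟩
    simpa only [isWord_append, ih.1 N] using h
  | mul _ _ ih ih' =>
    rename_i w x y z _ _
    simp only [FreeMonoid.toList_mul]
    refine ⟨fun N => by simp only [isWord_append, ih.1 N, ih'.1 N], fun N a b h => ?_⟩
    have h1 := ih.2 N a (y.toList ++ b) (by simpa only [List.append_assoc] using h)
    have h2 := ih'.2 N (a ++ x.toList) b (by
      simp only [isWord_append, ← ih.1 N] at h ⊢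
      tauto)
    simp only [List.append_assoc] at h1 h2 ⊢
    exact h1.trans h2

theorem iso_of_ofWord_eq {N : ℕ} {u v : List ℕ} (h : ofWord u = ofWord v) (hu : IsWord N u) :
    Iso (wordClosure N u) (wordClosure N v) := by
  simpa using (iso_of_rel (PresentedMonoid.mk_eq_mk_iff.1 h)).2 N [] [] (by simpa using hu)

theorem isWord_of_ofWord_eq {N : ℕ} {u v : List ℕ} (h : ofWord u = ofWord v) (hu : IsWord N u) :
    IsWord N v :=
  ((iso_of_rel (PresentedMonoid.mk_eq_mk_iff.1 h)).1 N).1 hu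

/-- The positive braids on the first `N` strands. -/
def strands (N : ℕ) : Submonoid PosBraid where
  carrier := {x | ∃ u, IsWord N u ∧ ofWord u = x}
  one_mem' := ⟨[], by simp [IsWord], ofWord_nil⟩
  mul_mem' := by
    rintro _ _ ⟨u, hu, rfl⟩ ⟨v, hv, rfl⟩
    exact ⟨u ++ v, isWord_append.2 ⟨hu, hv⟩, ofWord_append u v⟩

theorem ofWord_mem_strands {N : ℕ} {u : List ℕ} (hu : IsWord N u) : ofWord u ∈ strands N :=
  ⟨u, hu, rfl⟩

theorem σ_mem_strands {N i : ℕ} (h1 : 1 ≤ i) (hN : i < N) : σ i ∈ strands N :=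
  ofWord_mem_strands (u := [i]) (isWord_cons.2 ⟨⟨h1, hN⟩, by simp [IsWord]⟩)

theorem strands_mono {M N : ℕ} (h : M ≤ N) : strands M ≤ strands N := by
  rintro _ ⟨u, hu, rfl⟩
  exact ⟨u, fun i hi => ⟨(hu i hi).1, (hu i hi).2.trans_le h⟩, rfl⟩

theorem strands_induction {N : ℕ} {p : PosBraid → Prop} (one : p 1)
    (mul : ∀ i x, 1 ≤ i → i < N → p x → p (σ i * x)) {x : PosBraid} (hx : x ∈ strands N) :
    p x := by
  obtain ⟨u, hu, rfl⟩ := hx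
  induction u with
  | nil => exact one
  | cons i u ih =>
    obtain ⟨⟨h1, h2⟩, hu⟩ := isWord_cons.1 hu
    exact mul i _ h1 h2 (ih hu)

/-! ### Positive braids with isotopic closures -/

/-- The closures of `x` as a braid on `M` strands and of `y` as a braid on `N` strands are
isotopic. -/
def SameClosure (M : ℕ) (x : PosBraid) (N : ℕ) (y : PosBraid) : Prop :=
  ∃ u v, IsWord M u ∧ IsWord N v ∧ ofWord u = x ∧ ofWord v = y ∧
    Iso (wordClosure M u) (wordClosure N v)

namespace SameClosure

variable {L M N : ℕ} {x y z : PosBraid}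

theorem refl (h : x ∈ strands N) : SameClosure N x N x := by
  obtain ⟨u, hu, rfl⟩ := h
  exact ⟨u, u, hu, hu, rfl, rfl, Iso.refl hu.isLink⟩

theorem symm (h : SameClosure M x N y) : SameClosure N y M x := by
  obtain ⟨u, v, hu, hv, hx, hy, h⟩ := h
  exact ⟨v, u, hv, hu, hy, hx, h.symm⟩

theorem trans (h : SameClosure L x M y) (h' : SameClosure M y N z) : SameClosure L x N z := by
  obtain ⟨u, v, hu, hv, hx, hy, h⟩ := h
  obtain ⟨v', w, hv', hw, hy', hz, h'⟩ := h'
  exact ⟨u, w, hu, hw, hx, hz, (h.trans (iso_of_ofWord_eq (hy.trans hy'.symm) hv)).trans h'⟩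

/-- The relation does not depend on the words chosen to represent the two braids. -/
theorem iso {u v : List ℕ} (h : SameClosure M (ofWord u) N (ofWord v)) :
    Iso (wordClosure M u) (wordClosure N v) := by
  obtain ⟨u', v', hu, hv, hx, hy, h⟩ := h
  exact ((iso_of_ofWord_eq hx.symm (isWord_of_ofWord_eq hx hu)).trans h).trans
    (iso_of_ofWord_eq hy hv)

theorem conj (hx : x ∈ strands N) (hy : y ∈ strands N) : SameClosure N (x * y) N (y * x) := by
  obtain ⟨u, hu, rfl⟩ := hx
  obtain ⟨v, hv, rfl⟩ := hy
  exact ⟨u ++ v, v ++ u, isWord_append.2 ⟨hu, hv⟩, isWord_append.2 ⟨hv, hu⟩, rfl, rfl,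
    iso_rotate (isWord_append.2 ⟨hu, hv⟩)⟩

theorem destabilize (hN : 1 ≤ N) (hx : x ∈ strands N) :
    SameClosure (N + 1) (x * σ N) N x := by
  obtain ⟨u, hu, rfl⟩ := hx
  refine ⟨u ++ [N], u, isWord_append.2 ⟨fun i hi => ?_, ?_⟩, hu, rfl, rfl,
    iso_destabilize hN hu⟩
  · exact ⟨(hu i hi).1, (hu i hi).2.trans (Nat.lt_succ_self N)⟩
  · exact isWord_cons.2 ⟨⟨hN, Nat.lt_succ_self N⟩, by simp [IsWord]⟩

/-- Conjugation and destabilization at a crossing in the middle of the braid. -/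
theorem destabilize_middle (hN : 1 ≤ N) (hx : x ∈ strands N) (hy : y ∈ strands N) :
    SameClosure (N + 1) (x * σ N * y) N (x * y) := by
  have hx' := strands_mono (Nat.le_succ N) hx
  have hy' := strands_mono (Nat.le_succ N) hy
  have h := conj (mul_mem hx' (σ_mem_strands hN (Nat.lt_succ_self N))) hy'
  rw [← mul_assoc] at h
  exact (h.trans (destabilize hN (mul_mem hy hx))).trans (conj hy hx)

end SameClosure

end PosBraid

namespace PosBraid

/-! ### Powers of `W(n)` in the monoid of positive braids -/

/-- The braid `σ_s σ_{s+1} ⋯` with `k` letters. -/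
def up (s : ℕ) : ℕ → PosBraid
  | 0 => 1
  | k + 1 => up s k * σ (s + k)

/-- The braid `σ_m σ_{m-1} ⋯ σ_1`; this is `W(m + 1)`. -/
def w : ℕ → PosBraid
  | 0 => 1
  | m + 1 => σ (m + 1) * w m

/-- The braid `σ_1 σ_2 ⋯ σ_m`, which is `w m` read backwards. -/
def v (m : ℕ) : PosBraid := up 1 m

theorem v_succ (m : ℕ) : v (m + 1) = v m * σ (m + 1) := by
  rw [v, v, up, Nat.add_comm 1 m]

theorem up_succ' (s k : ℕ) : up s (k + 1) = σ s * up (s + 1) k := by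
  induction k with
  | zero => simp [up]
  | succ k ih => rw [up, ih, up, mul_assoc, Nat.add_right_comm, Nat.add_assoc]

theorem up_mem_strands {s k N : ℕ} (h1 : 1 ≤ s) (hN : s + k ≤ N) : up s k ∈ strands N := by
  induction k with
  | zero => exact one_mem _
  | succ k ih => exact mul_mem (ih (by omega)) (σ_mem_strands (by omega) (by omega))

theorem w_mem_strands {m N : ℕ} (h : m < N) : w m ∈ strands N := by
  induction m with
  | zero => exact one_mem _
  | succ m ih => exact mul_mem (σ_mem_strands (by omega) h) (ih (by omega))

theorem v_mem_strands {m N : ℕ} (h : m < N) : v m ∈ strands N :=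
  up_mem_strands le_rfl (by omega)

/-- A braid on the first `m` strands commutes with every `σ_i` with `i > m`. -/
theorem commute_σ {m i : ℕ} (h : m < i) {x : PosBraid} (hx : x ∈ strands m) :
    Commute x (σ i) := by
  refine strands_induction (p := fun x => Commute x (σ i)) (Commute.one_left _)
    (fun j x h1 hj hx => ?_) hx
  exact Commute.mul_left (σ_comm (by omega)) hx

theorem commute_up {m s : ℕ} (h : m < s) (k : ℕ) {x : PosBraid} (hx : x ∈ strands m) :
    Commute x (up s k) := by
  induction k with
  | zero => exact Commute.one_right _
  | succ k ih => exact ih.mul_right (commute_σ (by omega) hx)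

/-- The endomorphism `σ_i ↦ σ_{i+1}`. -/
def shift : PosBraid →* PosBraid :=
  PresentedMonoid.lift (fun i => σ (i + 1)) (by
    intro x y h
    cases h with
    | comm h => exact σ_comm (by omega)
    | braid i =>
      have := σ_braid (i + 1)
      simpa [FreeMonoid.lift_ofList, mul_assoc] using this)

theorem shift_σ (i : ℕ) : shift (σ i) = σ (i + 1) := rfl

theorem shift_up (s k : ℕ) : shift (up s k) = up (s + 1) k := by
  induction k with
  | zero => exact map_one _
  | succ k ih => rw [up, map_mul, ih, shift_σ, up, Nat.add_right_comm]

theorem shift_mem_strands {N : ℕ} {x : PosBraid} (hx : x ∈ strands N) :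
    shift x ∈ strands (N + 1) := by
  refine strands_induction (p := fun x => shift x ∈ strands (N + 1)) ?_ (fun j x h1 hj hx => ?_) hx
  · rw [map_one]
    exact one_mem _
  · rw [map_mul]
    exact mul_mem (σ_mem_strands (by omega) (by omega)) hx

theorem w_succ_eq_shift (m : ℕ) : w (m + 1) = shift (w m) * σ 1 := by
  induction m with
  | zero => simp [w]
  | succ m ih => rw [w, w, map_mul, shift_σ, mul_assoc, ← ih, w]

theorem σ_mul_w {m i : ℕ} (h1 : 1 ≤ i) (h : i + 1 ≤ m) : σ i * w m = w m * σ (i + 1) := by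
  induction m with
  | zero => omega
  | succ m ih =>
    rcases Nat.lt_or_ge i m with hi | hi
    · rw [w, ← mul_assoc, σ_comm (by omega), mul_assoc, ih hi, mul_assoc]
    · obtain rfl : i = m := by omega
      obtain ⟨k, rfl⟩ : ∃ k, i = k + 1 := ⟨i - 1, by omega⟩
      have hc : w k * σ (k + 1 + 1) = σ (k + 1 + 1) * w k :=
        commute_σ (m := k + 1) (by omega) (w_mem_strands (by omega))
      rw [w, w]
      simp only [mul_assoc, hc]
      simp only [← mul_assoc, σ_braid]

/-- A braid on the first `m` strands can be pushed through `w m`; it comes out on the last `m` of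
the `m + 1` strands. -/
theorem mul_w {m : ℕ} {x : PosBraid} (hx : x ∈ strands m) : x * w m = w m * shift x := by
  refine strands_induction (p := fun x => x * w m = w m * shift x) (by simp)
    (fun j x h1 hj hx => ?_) hx
  rw [map_mul, shift_σ, mul_assoc, hx, ← mul_assoc, σ_mul_w h1 hj, mul_assoc]

/-- The anti-automorphism that reads words backwards. -/
def rev : PosBraid →* PosBraidᵐᵒᵖ :=
  PresentedMonoid.lift (fun i => MulOpposite.op (σ i)) (by
    intro x y h
    cases h with
    | comm h => exact congrArg MulOpposite.op (σ_comm h).symm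
    | braid i =>
      have := congrArg MulOpposite.op (σ_braid i)
      simpa [FreeMonoid.lift_ofList, mul_assoc] using this)

theorem rev_σ (i : ℕ) : rev (σ i) = MulOpposite.op (σ i) := rfl

theorem rev_w (m : ℕ) : rev (w m) = MulOpposite.op (v m) := by
  induction m with
  | zero => exact map_one _
  | succ m ih => rw [w, map_mul, ih, rev_σ, v_succ, MulOpposite.op_mul]

theorem rev_v (m : ℕ) : rev (v m) = MulOpposite.op (w m) := by
  induction m with
  | zero => exact map_one _
  | succ m ih => rw [v_succ, map_mul, ih, rev_σ, w, MulOpposite.op_mul]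

theorem unop_rev_mem_strands {N : ℕ} {x : PosBraid} (hx : x ∈ strands N) :
    (rev x).unop ∈ strands N := by
  refine strands_induction (p := fun x => (rev x).unop ∈ strands N) ?_ (fun j x h1 hj hx => ?_) hx
  · rw [map_one]
    exact one_mem _
  · rw [map_mul, MulOpposite.unop_mul]
    exact mul_mem hx (σ_mem_strands h1 hj)

/-- For `a ≥ 1` the generator `σ_{m+1}` occurs only once on the right-hand side. This prepares the
removal of the last strand. -/
theorem w_succ_pow {m s a : ℕ} (h1 : 1 ≤ s) (h : s + a = m + 2) :
    w (m + 1) ^ a = up s a * w m ^ a := by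
  induction a generalizing s with
  | zero => simp [up]
  | succ a ih =>
    have hs : s + a = m + 1 := by omega
    rw [pow_succ', ih (s := s + 1) (by omega) (by omega), ← shift_up, ← mul_assoc,
      ← mul_w (up_mem_strands h1 hs.le), up, hs, w, pow_succ']
    simp only [mul_assoc]

/-- The analogue of `w_succ_pow` that splits off the first strand instead of the last one. -/
theorem w_succ_pow_eq_shift {m a : ℕ} (h : a ≤ m + 1) :
    w (m + 1) ^ a = shift (w m) ^ a * v a := by
  induction a with
  | zero => simp [v, up]
  | succ a ih =>
    rw [pow_succ, ih (by omega), mul_assoc, v, mul_w (up_mem_strands le_rfl (by omega)), shift_up,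
      w_succ_eq_shift, pow_succ, v, up_succ']
    simp only [mul_assoc]

/-- The remainder `up s c` left over by `w_succ_pow` passes through `w m ^ (c + 1)` and becomes
`v c`. This follows by comparing `w_succ_pow` and `w_succ_pow_eq_shift`. -/
theorem up_mul_w_pow {m s c : ℕ} (h1 : 1 ≤ s) (h : s + c = m + 1) :
    up s c * w m ^ (c + 1) = w m ^ (c + 1) * v c := by
  rcases m with _ | m
  · obtain rfl : c = 0 := by omega
    simp [up, v]
  · have hs : w m * w (m + 1) = w (m + 1) * shift (w m) :=
      mul_w (w_mem_strands (Nat.lt_succ_self m))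
    have hp : w m ^ c * w (m + 1) = w (m + 1) * shift (w m) ^ c := by
      rw [← map_pow]
      exact mul_w (pow_mem (w_mem_strands (Nat.lt_succ_self m)) c)
    calc up s c * w (m + 1) ^ (c + 1)
        = up s c * w (m + 1) * w (m + 1) ^ c := by rw [pow_succ', mul_assoc]
      _ = up s c * (w (m + 1) * shift (w m) ^ c) * v c := by
        rw [w_succ_pow_eq_shift (by omega)]
        simp only [mul_assoc]
      _ = up s c * w m ^ c * w (m + 1) * v c := by rw [← hp]; simp only [mul_assoc]
      _ = w (m + 1) ^ (c + 1) * v c := by rw [← w_succ_pow h1 (by omega), ← pow_succ]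

/-- Both sides are the full twist on `m + 1` strands. -/
theorem w_pow_eq_v_pow (m : ℕ) : w m ^ (m + 1) = v m ^ (m + 1) := by
  induction m with
  | zero => simp [w, v, up]
  | succ m ih =>
    have h1 : w (m + 1) ^ (m + 1) = v (m + 1) * w m ^ (m + 1) :=
      w_succ_pow le_rfl (by omega)
    have h2 : v (m + 1) ^ (m + 1) = v m ^ (m + 1) * w (m + 1) := by
      have := congrArg (fun x => (rev x).unop) h1
      simpa only [map_pow, map_mul, rev_w, rev_v, MulOpposite.unop_pow, MulOpposite.unop_mul,
        MulOpposite.unop_op] using this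
    rw [pow_succ, h1, ih, mul_assoc, ← h2, ← pow_succ']

/-! ### Removing strands from the closure -/

/-- The last strand of the closure of `W(n) ^ a * y` is removed, where `1 ≤ a < n` and `y` does not
involve this strand; here `n = m + 2` and `a = c + 1`. -/
theorem sameClosure_w_succ {m c : ℕ} (h : c ≤ m) {y : PosBraid} (hy : y ∈ strands (m + 1)) :
    SameClosure (m + 2) (w (m + 1) ^ (c + 1) * y) (m + 1) (w m ^ (c + 1) * v c * y) := by
  obtain ⟨s, hs⟩ : ∃ s, s + c = m + 1 := ⟨m + 1 - c, by omega⟩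
  have hu : up s c ∈ strands (m + 1) := up_mem_strands (by omega) hs.le
  have hw : w m ^ (c + 1) ∈ strands (m + 1) := pow_mem (w_mem_strands (Nat.lt_succ_self m)) _
  have key := SameClosure.destabilize_middle (by omega) hu (mul_mem hw hy)
  rw [← mul_assoc (up s c), up_mul_w_pow (by omega) hs] at key
  rwa [w_succ_pow (s := s) (by omega) (by omega), up, hs, mul_assoc]

/-- The counterpart of `sameClosure_w_succ`, obtained by reading all relations backwards. -/
theorem sameClosure_v_succ {m c : ℕ} (h : c ≤ m) {y : PosBraid} (hy : y ∈ strands (m + 1)) :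
    SameClosure (m + 2) (v (m + 1) ^ (c + 1) * y) (m + 1) (w c * v m ^ (c + 1) * y) := by
  obtain ⟨s, hs⟩ : ∃ s, s + c = m + 1 := ⟨m + 1 - c, by omega⟩
  have hu : up s c ∈ strands (m + 1) := up_mem_strands (by omega) hs.le
  have hv : v m ^ (c + 1) ∈ strands (m + 1) := pow_mem (v_mem_strands (Nat.lt_succ_self m)) _
  have hd := unop_rev_mem_strands hu
  have h1 : v (m + 1) ^ (c + 1) = v m ^ (c + 1) * σ (m + 1) * (rev (up s c)).unop := by
    have := congrArg (fun x => (rev x).unop)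
      (w_succ_pow (m := m) (s := s) (a := c + 1) (by omega) (by omega))
    simpa only [up, hs, map_pow, map_mul, rev_w, rev_σ, MulOpposite.unop_pow, MulOpposite.unop_mul,
      MulOpposite.unop_op, mul_assoc] using this
  have h2 : v m ^ (c + 1) * (rev (up s c)).unop = w c * v m ^ (c + 1) := by
    have := congrArg (fun x => (rev x).unop) (up_mul_w_pow (m := m) (s := s) (by omega) hs)
    simpa only [map_pow, map_mul, rev_w, rev_v, MulOpposite.unop_pow, MulOpposite.unop_mul,
      MulOpposite.unop_op] using this
  have key := SameClosure.destabilize_middle (by omega) hv (mul_mem hd hy)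
  rwa [← mul_assoc (v m ^ (c + 1)), h2, ← mul_assoc, ← h1] at key

theorem sameClosure_w_add {m c : ℕ} (h : c ≤ m) (k : ℕ) {y : PosBraid}
    (hy : y ∈ strands (m + 1)) :
    SameClosure (m + k + 1) (w (m + k) ^ (c + 1) * y) (m + 1)
      (w m ^ (c + 1) * v c ^ k * y) := by
  induction k generalizing y with
  | zero =>
    rw [pow_zero, mul_one]
    exact SameClosure.refl (mul_mem (pow_mem (w_mem_strands (Nat.lt_succ_self m)) _) hy)
  | succ k ih =>
    have hv : v c ∈ strands (m + 1) := v_mem_strands (by omega)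
    have h1 := sameClosure_w_succ (m := m + k) (c := c) (by omega)
      (strands_mono (by omega) hy)
    have h2 := ih (mul_mem hv hy)
    rw [← mul_assoc] at h2
    have h3 := h1.trans h2
    rwa [mul_assoc _ (v c ^ k), ← mul_assoc (v c ^ k), ← pow_succ, ← mul_assoc] at h3

theorem sameClosure_v_add {m c : ℕ} (h : c ≤ m) (k : ℕ) {y : PosBraid}
    (hy : y ∈ strands (m + 1)) :
    SameClosure (m + k + 1) (v (m + k) ^ (c + 1) * y) (m + 1)
      (w c ^ k * v m ^ (c + 1) * y) := by
  induction k generalizing y with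
  | zero =>
    rw [pow_zero, one_mul]
    exact SameClosure.refl (mul_mem (pow_mem (v_mem_strands (Nat.lt_succ_self m)) _) hy)
  | succ k ih =>
    have hw : ∀ M, m + 1 ≤ M → w c ∈ strands M := fun M hM => w_mem_strands (by omega)
    have hv : ∀ M, m + k + 1 ≤ M → v (m + k) ^ (c + 1) ∈ strands M :=
      fun M hM => pow_mem (v_mem_strands (by omega)) _
    have h1 := sameClosure_v_succ (m := m + k) (c := c) (by omega)
      (strands_mono (by omega) hy)
    have h2 := SameClosure.conj (hw (m + k + 1) (by omega)) (mul_mem (hv _ le_rfl)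
      (strands_mono (by omega) hy))
    have h3 := ih (mul_mem hy (hw _ le_rfl))
    have h4 := SameClosure.conj (N := m + 1)
      (mul_mem (mul_mem (pow_mem (hw _ le_rfl) k)
        (pow_mem (v_mem_strands (Nat.lt_succ_self m)) (c + 1))) hy) (hw _ le_rfl)
    simp only [← mul_assoc] at h1 h2 h3 h4
    rw [pow_succ' (w c)]
    exact ((h1.trans h2).trans h3).trans h4

/-! ### Reversing both factors -/

/-- Conjugation by `w j` replaces the first factor `w j * up (j + 1) (d + 1)` by
`w (j + 1) * up (j + 2) d`. -/
theorem sameClosure_conj_w {N j d c : ℕ} {z z' : PosBraid} (hN : j + d + 1 < N)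
    (hz : z ∈ strands N) (h : z * w j = w j * z') :
    SameClosure N ((w j * up (j + 1) (d + 1)) ^ (c + 1) * z) N
      ((w (j + 1) * up (j + 2) d) ^ (c + 1) * z') := by
  have hw : w j ∈ strands N := w_mem_strands (by omega)
  have hu : up (j + 1) (d + 1) ∈ strands N := up_mem_strands (by omega) (by omega)
  have hc : up (j + 2) d * w j = w j * up (j + 2) d :=
    (commute_up (m := j + 1) (by omega) d (w_mem_strands (by omega))).symm
  have hs : up (j + 1) (d + 1) * w j = w (j + 1) * up (j + 2) d := by
    rw [up_succ', mul_assoc, hc, w, mul_assoc]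
  have hp : ∀ c, (w j * up (j + 1) (d + 1)) ^ c * w j =
      w j * (w (j + 1) * up (j + 2) d) ^ c := by
    intro c
    have : SemiconjBy (w j) (w (j + 1) * up (j + 2) d) (w j * up (j + 1) (d + 1)) := by
      rw [SemiconjBy, mul_assoc, hs]
    exact (this.pow_right c).symm
  have key := SameClosure.conj hw
    (mul_mem (mul_mem hu (pow_mem (mul_mem hw hu) c)) hz)
  have e1 : w j * (up (j + 1) (d + 1) * (w j * up (j + 1) (d + 1)) ^ c * z) =
      (w j * up (j + 1) (d + 1)) ^ (c + 1) * z := by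
    rw [pow_succ']
    simp only [mul_assoc]
  have e2 : up (j + 1) (d + 1) * (w j * up (j + 1) (d + 1)) ^ c * z * w j =
      (w (j + 1) * up (j + 2) d) ^ (c + 1) * z' := by
    rw [mul_assoc _ z, h, ← mul_assoc, mul_assoc _ _ (w j), hp, ← mul_assoc, hs, pow_succ']
  rwa [e1, e2] at key

/-- Both factors of `V(p) ^ (c + 1) V(a) ^ k`, where `a < p`, may be reversed at the same time. -/
theorem sameClosure_v_w {p a : ℕ} (h : a < p) (c k : ℕ) :
    SameClosure (p + 1) (v p ^ (c + 1) * v a ^ k) (p + 1) (w p ^ (c + 1) * w a ^ k) := by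
  have hwm : ∀ {j N}, j < N → w j ∈ strands N := fun h => w_mem_strands h
  -- While `j ≤ a`, conjugation by `w j` acts on both factors in the same way.
  have h1 : ∀ j d e, j + d = p → j + e = a →
      SameClosure (p + 1) (v p ^ (c + 1) * v a ^ k) (p + 1)
        ((w j * up (j + 1) d) ^ (c + 1) * (w j * up (j + 1) e) ^ k) := by
    intro j
    induction j with
    | zero =>
      intro d e hd he
      obtain rfl : d = p := by omega
      obtain rfl : e = a := by omega
      simp only [w, one_mul, Nat.zero_add]
      exact SameClosure.refl (mul_mem (pow_mem (v_mem_strands (by omega)) _)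
        (pow_mem (v_mem_strands (by omega)) _))
    | succ j ih =>
      intro d e hd he
      refine (ih (d + 1) (e + 1) (by omega) (by omega)).trans
        (sameClosure_conj_w (by omega) ?_ ?_)
      · exact pow_mem (mul_mem (hwm (by omega)) (up_mem_strands (by omega) (by omega))) _
      · have hc : up (j + 2) e * w j = w j * up (j + 2) e :=
          (commute_up (m := j + 1) (by omega) e (hwm (by omega))).symm
        have : SemiconjBy (w j) (w (j + 1) * up (j + 2) e) (w j * up (j + 1) (e + 1)) := by
          rw [SemiconjBy, mul_assoc, up_succ', mul_assoc (σ (j + 1)), hc, w, mul_assoc]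
        exact (this.pow_right k).symm
  have hz : ∀ t, shift^[t] (w a ^ k) ∈ strands (a + t + 1) := by
    intro t
    induction t with
    | zero => exact pow_mem (hwm (by omega)) _
    | succ t ih =>
      rw [Function.iterate_succ_apply']
      exact shift_mem_strands ih
  -- Afterwards the conjugation only shifts the second factor.
  have h2 : ∀ t d, a + t + 1 + d = p →
      SameClosure (p + 1) (v p ^ (c + 1) * v a ^ k) (p + 1)
        ((w (a + t + 1) * up (a + t + 2) d) ^ (c + 1) * shift^[t] (w a ^ k)) := by
    intro t
    induction t with
    | zero =>
      intro d hd
      have h0 := h1 a (d + 1) 0 (by omega) (by omega)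
      rw [up, mul_one] at h0
      refine h0.trans (sameClosure_conj_w (by omega) (pow_mem (hwm (by omega)) _) ?_)
      exact (pow_succ (w a) k).symm.trans (pow_succ' (w a) k)
    | succ t ih =>
      intro d hd
      refine (ih (d + 1) (by omega)).trans
        (sameClosure_conj_w (by omega) (strands_mono (by omega) (hz t)) ?_)
      rw [Function.iterate_succ_apply']
      exact mul_w (hz t)
  -- Conjugation by `w p` undoes the shifts.
  have h3 : ∀ t, a + t + 1 ≤ p → SameClosure (p + 1) (w p ^ (c + 1) * shift^[t] (w a ^ k)) (p + 1)
      (w p ^ (c + 1) * w a ^ k) := by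
    intro t
    induction t with
    | zero =>
      intro _
      exact SameClosure.refl (mul_mem (pow_mem (hwm (by omega)) _) (pow_mem (hwm (by omega)) _))
    | succ t ih =>
      intro ht
      refine SameClosure.trans ?_ (ih (by omega))
      have := SameClosure.conj (N := p + 1)
        (mul_mem (pow_mem (hwm (Nat.lt_succ_self p)) c) (strands_mono (by omega) (hz t)))
        (hwm (Nat.lt_succ_self p))
      rw [mul_assoc, mul_w (strands_mono (by omega : a + t + 1 ≤ p) (hz t)), ← mul_assoc,
        ← pow_succ, ← mul_assoc, ← pow_succ'] at this
      rwa [Function.iterate_succ_apply']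
  obtain ⟨t, rfl⟩ : ∃ t, p = a + t + 1 := ⟨p - a - 1, by omega⟩
  have h4 := h2 t 0 rfl
  rw [up, mul_one] at h4
  exact h4.trans (h3 t le_rfl)

/-! ### The symmetry -/

/-- The symmetry in the case `a₁ ≤ b₁`, where `a₁ = a + 1`, `b₁ = b + 1`, `a₂ - a₁ = l + 1` and
`b₂ - b₁ = k`. -/
theorem sameClosure_symmetry_of_le {a b : ℕ} (hab : a ≤ b) (k l : ℕ) :
    SameClosure (b + k + 1) (w (b + k) ^ (a + 1) * w b ^ (l + 1)) (a + (l + 1) + 1)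
      (w (a + (l + 1)) ^ (b + 1) * w a ^ k) := by
  have hwb : ∀ n, w b ^ n ∈ strands (b + 1) := fun n => pow_mem (w_mem_strands (by omega)) _
  have hva : ∀ {N}, a < N → v a ^ k ∈ strands N := fun h => pow_mem (v_mem_strands h) _
  have h1 : SameClosure (b + k + 1) (w (b + k) ^ (a + 1) * w b ^ (l + 1)) (b + 1)
      (w b ^ (a + (l + 1) + 1) * v a ^ k) := by
    have h := (sameClosure_w_add hab k (hwb (l + 1))).trans
      (SameClosure.conj (mul_mem (hwb (a + 1)) (hva (by omega))) (hwb (l + 1)))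
    rwa [← mul_assoc, ← pow_add, show l + 1 + (a + 1) = a + (l + 1) + 1 by omega] at h
  have h2 := sameClosure_v_w (show a < a + (l + 1) by omega) b k
  refine h1.trans (SameClosure.trans ?_ h2)
  -- Strands are removed from the braid with more strands, down to the number of strands of the
  -- other one; the result contains a full twist, in which `w` and `v` are interchangeable.
  rcases Nat.lt_or_ge b (a + (l + 1)) with h | h
  · obtain ⟨j, hj⟩ : ∃ j, a + (l + 1) = b + j := ⟨a + (l + 1) - b, by omega⟩
    have h3 := sameClosure_v_add (le_refl b) j (hva (show a < b + 1 by omega))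
    rw [← w_pow_eq_v_pow, ← pow_add, ← hj, show j + (b + 1) = a + (l + 1) + 1 by omega] at h3
    exact h3.symm
  · obtain ⟨j, rfl⟩ : ∃ j, b = a + (l + 1) + j := ⟨b - (a + (l + 1)), by omega⟩
    have h3 := sameClosure_w_add (le_refl (a + (l + 1))) j
      (hva (show a < a + (l + 1) + 1 by omega))
    rwa [w_pow_eq_v_pow, ← pow_add, show a + (l + 1) + 1 + j = a + (l + 1) + j + 1 by omega] at h3

theorem sameClosure_symmetry (a b k l : ℕ) :
    SameClosure (b + (k + 1) + 1) (w (b + (k + 1)) ^ (a + 1) * w b ^ (l + 1)) (a + (l + 1) + 1)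
      (w (a + (l + 1)) ^ (b + 1) * w a ^ (k + 1)) := by
  rcases Nat.le_total a b with h | h
  · exact sameClosure_symmetry_of_le h (k + 1) l
  · exact (sameClosure_symmetry_of_le h (l + 1) k).symm

/-! ### The braid words `W(n)` -/

theorem ofWord_map_idx_braidW {N m : ℕ} (h : m + 1 ≤ N) :
    ofWord ((braidW h).toList.map BraidLetter.idx) = w m := by
  have h1 : (braidW h).toList.map BraidLetter.idx =
      (List.range m).reverse.map fun i => i + 1 := by
    rw [braidW, FreeMonoid.toList_ofList, List.map_map, ← List.map_coe_finRange_eq_range,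
      ← List.map_reverse, List.map_map]
    rfl
  rw [h1]
  clear h1 h
  induction m with
  | zero => rfl
  | succ m ih =>
    rw [List.range_succ, List.reverse_append, List.reverse_singleton, List.singleton_append,
      List.map_cons, ofWord_cons, ih, w]

/-- The homomorphism that sends a braid word to the positive braid with the same indices. -/
def ofIndices (N : ℕ) : BraidWord N →* PosBraid where
  toFun u := ofWord (u.toList.map BraidLetter.idx)
  map_one' := rfl
  map_mul' x y := by rw [FreeMonoid.toList_mul, List.map_append, ofWord_append]

/-- The braid words all of whose letters are positive. -/
def positiveWords (N : ℕ) : Submonoid (BraidWord N) where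
  carrier := {u | ∀ l ∈ u.toList, l.positive = true}
  one_mem' := by simp
  mul_mem' := by
    intro x y hx hy l hl
    rw [FreeMonoid.toList_mul, List.mem_append] at hl
    exact hl.elim (hx l) (hy l)

theorem braidW_mem_positiveWords {N n : ℕ} (h : n ≤ N) : braidW h ∈ positiveWords N := by
  intro l hl
  rw [braidW, FreeMonoid.toList_ofList] at hl
  obtain ⟨i, -, rfl⟩ := List.mem_map.1 hl
  rfl

theorem SameClosure.sameLink {M N : ℕ} {x : BraidWord M} {y : BraidWord N}
    (hx : x ∈ positiveWords M) (hy : y ∈ positiveWords N)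
    (h : SameClosure M (ofIndices M x) N (ofIndices N y)) :
    SameLink (braidClosure x) (braidClosure y) := by
  obtain ⟨L, L', hL, hL', h⟩ := h.iso
  rw [← closureEdges_eq_wordClosure _ hx] at hL
  rw [← closureEdges_eq_wordClosure _ hy] at hL'
  obtain rfl : L = braidClosure x := PolyLink.ext hL
  obtain rfl : L' = braidClosure y := PolyLink.ext hL'
  exact h

end PosBraid

theorem mainTheorem5 (a₁ a₂ b₁ b₂ : ℕ) (ha₁ : 0 < a₁) (hb₁ : 0 < b₁)
    (ha : a₁ < a₂) (hb : b₁ < b₂) :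
    SameLink
      (braidClosure (braidW (le_refl b₂) ^ a₁ * braidW hb.le ^ (a₂ - a₁) : BraidWord b₂))
      (braidClosure (braidW (le_refl a₂) ^ b₁ * braidW ha.le ^ (b₂ - b₁) : BraidWord a₂)) := by
  obtain ⟨a, rfl⟩ : ∃ a, a₁ = a + 1 := ⟨a₁ - 1, by omega⟩
  obtain ⟨b, rfl⟩ : ∃ b, b₁ = b + 1 := ⟨b₁ - 1, by omega⟩
  obtain ⟨l, rfl⟩ : ∃ l, a₂ = a + (l + 1) + 1 := ⟨a₂ - a - 2, by omega⟩
  obtain ⟨k, rfl⟩ : ∃ k, b₂ = b + (k + 1) + 1 := ⟨b₂ - b - 2, by omega⟩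
  have hP : ∀ {N n : ℕ} (h : n ≤ N), braidW h ∈ PosBraid.positiveWords N :=
    PosBraid.braidW_mem_positiveWords
  refine PosBraid.SameClosure.sameLink
    (mul_mem (pow_mem (hP _) _) (pow_mem (hP _) _))
    (mul_mem (pow_mem (hP _) _) (pow_mem (hP _) _)) ?_
  have hW : ∀ {N m : ℕ} (h : m + 1 ≤ N), PosBraid.ofIndices N (braidW h) = PosBraid.w m :=
    PosBraid.ofWord_map_idx_braidW
  simp only [map_mul, map_pow, hW]
  rw [show a + (l + 1) + 1 - (a + 1) = l + 1 by omega,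
    show b + (k + 1) + 1 - (b + 1) = k + 1 by omega]
  exact PosBraid.sameClosure_symmetry a b k l
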